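/- For $n$ qubits let $|S_k\rangle=|S_{n,k}\rangle=\binom{n}{k}^{-1/2}\sum|b_1\dots b_n\rangle$ (sum over all bit strings with exactly $k$ ones) be the Dicke states. A normalized qubit $\cos\frac\theta2|0\rangle+e^{i\varphi}\sin\frac\theta2|1\rangle$ (up to a phase) is identified with the point of the unit sphere $S^2\subset\mathbb R^3$ with polar angle $\theta$ and azimuth $\varphi$ (its Bloch vector). The \emph{Majorana points} (MPs) of a non-zero symmetric $n$-qubit vector $|\psi\rangle$ are the Bloch vectors of the qubits $|\phi_1\rangle,\dots,|\phi_n\rangle$ in its representation $|\psi\rangle=c\sum_{P\in S_n}|\phi_{P(1)}\rangle\otimes\cdots\otimes|\phi_{P(n)}\rangle$, $c\neq0$. The \emph{closest product points} (CPPs) of $|\psi\rangle$ are the Bloch vectors of those normalized qubits $|\sigma\rangle$ for which $|\sigma\rangle^{\otimes n}$ maximizes $|\langle\lambda|\psi\rangle|$ over all product states $|\lambda\rangle=|\chi_1\rangle\otimes\cdots\otimes|\chi_n\rangle$ of normalized qubits. For the vertex set $V\subset S^2$ of a Platonic solid inscribed in $S^2$, the \emph{dual vertices} are the radial projections to $S^2$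 of the centres of its faces, i.e. the outward unit normals of its faces. Consider the following vectors (not all are normalized; normalization does not affect MPs and CPPs): $$|\Psi_4\rangle=\tfrac1{\sqrt3}|S_0\rangle+\sqrt{\tfrac23}\,|S_3\rangle,\qquad |\Psi_6\rangle=\tfrac1{\sqrt2}\bigl(|S_1\rangle+|S_5\rangle\bigr),\qquad |\Psi_8\rangle=\sqrt5|S_0\rangle-\sqrt{14}|S_4\rangle+\sqrt5|S_8\rangle,$$ $$|\Psi_{12}\rangle=\sqrt7|S_1\rangle-\sqrt{11}|S_6\rangle-\sqrt7|S_{11}\rangle,$$ $$|\Psi_{20}\rangle=\sqrt{187}|S_0\rangle+\sqrt{627}|S_5\rangle+\sqrt{247}|S_{10}\rangle-\sqrt{627}|S_{15}\rangle+\sqrt{187}|S_{20}\rangle .$$ Then: (1) The 12 MPs of the icosahedron state $|\Psi_{12}\rangle$ are the vertices of a regular icosahedron. It has exactly 20 CPPs; they are the vertices of a regular dodecahedron, namely the dual vertices of the icosahedron of MPs. (2) The 20 MPs of the dodecahedron state $|\Psi_{20}\rangle$ are the vertices of a regular dodecahedron. It has exactly 12 CPPs; they are the vertices of a regular icosahedron,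 namely the dual vertices of the dodecahedron of MPs. (3) $|\Psi_{12}\rangle$ and $|\Psi_{20}\rangle$ are mutually dual: the CPPs of either one are exactly the MPs of the other. (4) The 6 MPs of the octahedron state $|\Psi_6\rangle$ are the vertices of a regular octahedron. It has exactly 8 CPPs; they are the vertices of a cube, namely the dual vertices of the octahedron of MPs. (5) The 8 MPs of the cube state $|\Psi_8\rangle$ are the vertices of a cube. It has exactly 6 CPPs; they are the vertices of a regular octahedron, namely the dual vertices of the cube of MPs. (6) $|\Psi_6\rangle$ and $|\Psi_8\rangle$ are mutually dual: the CPPs of either one are exactly the MPs of the other. (7) The tetrahedron state $|\Psi_4\rangle$ is self-dual: its 4 MPs are the vertices of a regular tetrahedron, and its CPPs are exactly these same 4 points (whereas the dual vertices of the tetrahedron of MPs are the antipodes of the MPs). -/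

import Mathlib

namespace MajoranaStates

noncomputable section

open scoped RealInnerProductSpace

/-! ### Qubits, product states, closest product points -/

/-- The Hilbert space `ℂ²` of one qubit; coordinate `0` is the amplitude of `|0⟩`, coordinate `1`
that of `|1⟩`. -/
abbrev Qubit : Type := EuclideanSpace ℂ (Fin 2)

/-- The Hilbert space `(ℂ²)^{⊗ n}` of `n` qubits, in coordinates with respect to the orthonormal
computational basis `|b₁ b₂ … bₙ⟩`, which is indexed by the bit strings `b`. -/
abbrev NQubit (n : ℕ) : Type := EuclideanSpace ℂ (Fin n → Fin 2)

/-- Euclidean three-space, in which the Bloch (Majorana) sphere is the unit sphere. -/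
abbrev Space : Type := EuclideanSpace ℝ (Fin 3)

/-- The product vector `φ₁ ⊗ φ₂ ⊗ ⋯ ⊗ φₙ`. -/
def productState {n : ℕ} (φ : Fin n → Qubit) : NQubit n :=
  WithLp.toLp 2 fun b => ∏ i, φ i (b i)

/-- The Dicke state `|S_{n,k}⟩ = (n choose k)^{-1/2} ∑ |b⟩`, the sum being over all bit strings `b`
with exactly `k` ones. -/
def dicke (n k : ℕ) : NQubit n :=
  WithLp.toLp 2 fun b =>
    if (Finset.univ.filter fun i => b i = 1).card = k then
      (((√(n.choose k : ℝ))⁻¹ : ℝ) : ℂ)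
    else 0

/-- The Bloch vector of a normalized qubit. For
`cos (θ/2) |0⟩ + e^{iφ} sin (θ/2) |1⟩` it is the point of the unit sphere with polar angle `θ` and
azimuth `φ`. -/
def blochVector (σ : Qubit) : Space :=
  !₂[2 * (starRingEnd ℂ (σ 0) * σ 1).re, 2 * (starRingEnd ℂ (σ 0) * σ 1).im,
    ‖σ 0‖ ^ 2 - ‖σ 1‖ ^ 2]

/-- `⊗ φᵢ`, with normalized qubits `φᵢ`, is a closest product state of `ψ`: among all products
`⊗ χᵢ` of normalized qubits (symmetric or not) it has the largest overlap `|⟨χ|ψ⟩|`. This does not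
depend on the normalization of `ψ`. -/
def IsClosestProduct {n : ℕ} (ψ : NQubit n) (φ : Fin n → Qubit) : Prop :=
  (∀ i, ‖φ i‖ = 1) ∧
    ∀ χ : Fin n → Qubit, (∀ i, ‖χ i‖ = 1) →
      ‖inner ℂ (productState χ) ψ‖ ≤ ‖inner ℂ (productState φ) ψ‖

/-- The closest product points of `ψ`: the Bloch vectors of the normalized qubits `σ` for which
`σ^{⊗ n}` is a closest product state of `ψ`. -/
def closestProductPoints {n : ℕ} (ψ : NQubit n) : Set Space :=
  {p | ∃ σ : Qubit, IsClosestProduct ψ (fun _ => σ) ∧ p = blochVector σ}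

/-- The normalized qubits `φ₁, …, φₙ` are a Majorana representation of the vector `ψ`: up to a
nonzero factor (normalization and global phase),
`ψ = ∑_P φ_{P(1)} ⊗ ⋯ ⊗ φ_{P(n)}`, the sum being over all permutations `P`. -/
def IsMajoranaRep {n : ℕ} (ψ : NQubit n) (φ : Fin n → Qubit) : Prop :=
  (∀ i, ‖φ i‖ = 1) ∧
    ∃ c : ℂ, c ≠ 0 ∧ ψ = c • ∑ P : Equiv.Perm (Fin n), productState fun i => φ (P i)

/-- The set of Majorana points of `ψ`: the Bloch vectors of the qubits in its Majorana
representation (which is unique up to order and phases). -/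
def majoranaPoints {n : ℕ} (ψ : NQubit n) : Set Space :=
  {p | ∃ φ : Fin n → Qubit, IsMajoranaRep ψ φ ∧ ∃ i, p = blochVector (φ i)}

/-! ### Platonic solids inscribed in the unit sphere -/

/-- `V` is inscribed in the unit sphere and is the image of the centered configuration `W` under a
linear isometry followed by a scaling. -/
def IsInscribedCopy (W V : Set Space) : Prop :=
  V ⊆ Metric.sphere 0 1 ∧
    ∃ g : Space ≃ₗᵢ[ℝ] Space, ∃ r : ℝ, 0 < r ∧ V = (fun v => r • g v) '' W

/-- `V` is the vertex set of a regular tetrahedron inscribed in the unit sphere. -/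
def IsTetrahedron (V : Set Space) : Prop :=
  IsInscribedCopy {!₂[1, 1, 1], !₂[1, -1, -1], !₂[-1, 1, -1], !₂[-1, -1, 1]} V

/-- `V` is the vertex set of a regular octahedron inscribed in the unit sphere: a copy of the
points `(0, 0, ±1)` and their cyclic permutations. -/
def IsOctahedron (V : Set Space) : Prop :=
  IsInscribedCopy {v | ∃ i : Fin 3, v i = 0 ∧ v (i + 1) = 0 ∧ |v (i + 2)| = 1} V

/-- `V` is the vertex set of a cube inscribed in the unit sphere: a copy of the points
`(±1, ±1, ±1)`. -/
def IsCube (V : Set Space) : Prop :=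
  IsInscribedCopy {v | ∀ i : Fin 3, |v i| = 1} V

/-- `V` is the vertex set of a regular icosahedron inscribed in the unit sphere: a copy of the
points `(0, ±1, ±φ)` and their cyclic permutations, `φ` being the golden ratio. -/
def IsIcosahedron (V : Set Space) : Prop :=
  IsInscribedCopy
    {v | ∃ i : Fin 3, v i = 0 ∧ |v (i + 1)| = 1 ∧ |v (i + 2)| = Real.goldenRatio} V

/-- `V` is the vertex set of a regular dodecahedron inscribed in the unit sphere: a copy of the
points `(±1, ±1, ±1)` and `(0, ±φ⁻¹, ±φ)` and the cyclic permutations of the latter, `φ` being the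
golden ratio. -/
def IsDodecahedron (V : Set Space) : Prop :=
  IsInscribedCopy
    ({v | ∀ i : Fin 3, |v i| = 1} ∪
      {v | ∃ i : Fin 3, v i = 0 ∧ |v (i + 1)| = Real.goldenRatio⁻¹ ∧
        |v (i + 2)| = Real.goldenRatio}) V

/-- The points of `V` that are farthest in direction `u`: the vertices of the face of the convex
hull of `V` which is exposed by `u`. -/
def exposedVertices (V : Set Space) (u : Space) : Set Space :=
  {v | v ∈ V ∧ ∀ w ∈ V, ⟪u, w⟫ ≤ ⟪u, v⟫}

/-- The vertices of the dual of a polyhedron with vertex set `V` on the unit sphere, itself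
inscribed in the unit sphere: the unit vectors `u` that are outward normal to a two-dimensional
face. As the vertices of a face lie on a circle of the sphere, whose centre lies on the normal line
through the origin, these are the radial projections of the face centres. -/
def dualVertices (V : Set Space) : Set Space :=
  {u | ‖u‖ = 1 ∧ Module.finrank ℝ (vectorSpan ℝ (exposedVertices V u)) = 2}

/-! ### The Platonic states -/

/-- The tetrahedron state of four qubits. -/
def tetrahedronState : NQubit 4 :=
  (1 / √3 : ℝ) • dicke 4 0 + √(2 / 3 : ℝ) • dicke 4 3

/-- The octahedron state of six qubits. -/
def octahedronState : NQubit 6 :=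
  (1 / √2 : ℝ) • (dicke 6 1 + dicke 6 5)

/-- The cube state of eight qubits (not normalized), in the orientation dual to
`octahedronState`. -/
def cubeState : NQubit 8 :=
  √5 • dicke 8 0 - √14 • dicke 8 4 + √5 • dicke 8 8

/-- The icosahedron state of twelve qubits (not normalized). -/
def icosahedronState : NQubit 12 :=
  √7 • dicke 12 1 - √11 • dicke 12 6 - √7 • dicke 12 11

/-- The dodecahedron state of twenty qubits (not normalized). -/
def dodecahedronState : NQubit 20 :=
  √187 • dicke 20 0 + √627 • dicke 20 5 + √247 • dicke 20 10 - √627 • dicke 20 15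
    + √187 • dicke 20 20

end

end MajoranaStates

namespace MajoranaStates
open Function

section Banach

variable {E ι : Type*} [NormedAddCommGroup E] [InnerProductSpace ℂ E]

/-- The unit vectors that are combinations of `u` and `y` with coefficients in `[0, 1]`. -/
def unitArc (u y : E) : Set E :=
  {z | ‖z‖ = 1 ∧ ∃ a ∈ Set.Icc (0 : ℝ) 1, ∃ b ∈ Set.Icc (0 : ℝ) 1, z = (a : ℂ) • u + (b : ℂ) • y}

theorem isCompact_unitArc (u y : E) : IsCompact (unitArc u y) := by
  have h : unitArc u y = (fun p : ℝ × ℝ => (p.1 : ℂ) • u + (p.2 : ℂ) • y) ''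
      (Set.Icc 0 1 ×ˢ Set.Icc 0 1) ∩ Metric.sphere 0 1 := by
    ext z
    simp only [unitArc, Set.mem_ofPred_eq, Set.mem_inter_iff, Set.mem_image, Set.mem_prod,
      Prod.exists, mem_sphere_zero_iff_norm]
    constructor
    · rintro ⟨hz, a, ha, b, hb, rfl⟩
      exact ⟨⟨a, b, ⟨ha, hb⟩, rfl⟩, hz⟩
    · rintro ⟨⟨a, b, ⟨ha, hb⟩, rfl⟩, hz⟩
      exact ⟨hz, a, ha, b, hb, rfl⟩
  rw [h]
  refine IsCompact.inter_right ?_ Metric.isClosed_sphere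
  exact (isCompact_Icc.prod isCompact_Icc).image (by fun_prop)

theorem norm_sq_combination {u y : E} (hu : ‖u‖ = 1) (hy : ‖y‖ = 1) {c : ℝ}
    (hc : inner ℂ u y = (c : ℂ)) (a b : ℝ) :
    ‖(a : ℂ) • u + (b : ℂ) • y‖ ^ 2 = a ^ 2 + b ^ 2 + 2 * (a * b * c) := by
  rw [@norm_add_sq ℂ, inner_smul_left, inner_smul_right, hc, norm_smul, norm_smul, hu, hy]
  simp only [Complex.conj_ofReal, Complex.norm_real, mul_one, Real.norm_eq_abs, sq_abs]
  rw [← Complex.ofReal_mul, ← Complex.ofReal_mul]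
  have h : RCLike.re ((a * (b * c) : ℝ) : ℂ) = a * (b * c) := Complex.ofReal_re _
  rw [h]
  ring

theorem re_inner_combination {u y : E} (hu : ‖u‖ = 1) (hy : ‖y‖ = 1) {c : ℝ}
    (hc : inner ℂ u y = (c : ℂ)) (a b : ℝ) :
    (inner ℂ (u + y) ((a : ℂ) • u + (b : ℂ) • y)).re = (a + b) * (1 + c) := by
  have h1 : inner ℂ u u = (1 : ℂ) := by rw [inner_self_eq_norm_sq_to_K, hu]; simp
  have h2 : inner ℂ y y = (1 : ℂ) := by rw [inner_self_eq_norm_sq_to_K, hy]; simp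
  have h3 : inner ℂ y u = (c : ℂ) := by rw [← inner_conj_symm, hc, Complex.conj_ofReal]
  rw [inner_add_left, inner_add_right, inner_add_right]
  simp only [inner_smul_right, h1, h2, h3, hc]
  simp
  ring

theorem coeff_le_one {a b c : ℝ} (ha : 0 ≤ a) (hb : 0 ≤ b) (hc : 0 ≤ c)
    (h : a ^ 2 + b ^ 2 + 2 * (a * b * c) = 1) : a ∈ Set.Icc (0 : ℝ) 1 ∧ b ∈ Set.Icc (0 : ℝ) 1 := by
  have : 0 ≤ a * b * c := by positivity
  exact ⟨⟨ha, by nlinarith⟩, ⟨hb, by nlinarith⟩⟩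

theorem exists_phase (c : ℂ) : ∃ e : ℂ, ‖e‖ = 1 ∧ e * c = (‖c‖ : ℂ) := by
  rcases eq_or_ne c 0 with rfl | h
  · exact ⟨1, by simp, by simp⟩
  · refine ⟨(starRingEnd ℂ c) / (‖c‖ : ℂ), ?_, ?_⟩
    · have := norm_ne_zero_iff.2 h
      simp [this]
    · have : (‖c‖ : ℂ) ≠ 0 := by exact_mod_cast norm_ne_zero_iff.2 h
      field_simp
      rw [mul_comm, Complex.mul_conj, Complex.normSq_eq_norm_sq]
      push_cast
      ring

theorem isCompact_unitTuples [FiniteDimensional ℂ E] : IsCompact {ξ : ι → E | ∀ i, ‖ξ i‖ = 1} := by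
  have : ProperSpace E := FiniteDimensional.proper ℂ E
  have h : {ξ : ι → E | ∀ i, ‖ξ i‖ = 1} = Set.pi Set.univ fun _ => Metric.sphere 0 1 := by
    ext; simp
  rw [h]
  exact isCompact_univ_pi fun _ => isCompact_sphere 0 1

/-- A linear functional which attains its norm bound at the unit vector `y` is a multiple of the
inner product with `y`. -/
theorem functional_eq_of_norm_attained [FiniteDimensional ℂ E] {f : E →ₗ[ℂ] ℂ} {y : E} (hy : ‖y‖ = 1)
    (hf : ∀ z, ‖f z‖ ≤ ‖f y‖ * ‖z‖) (z : E) : f z = f y * inner ℂ y z := by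
  set v : E := (InnerProductSpace.toDual ℂ E).symm (LinearMap.toContinuousLinearMap f) with hv
  have hfv : ∀ z, f z = inner ℂ v z := fun z => by
    rw [hv, InnerProductSpace.toDual_symm_apply]; rfl
  have hv1 : ‖v‖ ≤ ‖f y‖ := by
    rcases eq_or_ne v 0 with h | h
    · simp [h]
    · have h1 := hf v
      rw [hfv v, inner_self_eq_norm_sq_to_K] at h1
      simp only [Complex.coe_algebraMap, norm_pow, Complex.norm_real, norm_norm] at h1
      have := norm_pos_iff.2 h
      nlinarith
  have h0 : ‖v - (starRingEnd ℂ (f y)) • y‖ ^ 2 ≤ 0 := by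
    rw [@norm_sub_sq ℂ, inner_smul_right, ← hfv y, norm_smul, hy, ← Complex.normSq_eq_conj_mul_self]
    simp only [RCLike.norm_conj, mul_one, Complex.normSq_eq_norm_sq]
    have : (RCLike.re ((‖f y‖ ^ 2 : ℝ) : ℂ)) = ‖f y‖ ^ 2 := Complex.ofReal_re _
    rw [this]
    have := norm_nonneg v
    nlinarith
  have h1 : v = (starRingEnd ℂ (f y)) • y := by
    have := pow_eq_zero_iff (two_ne_zero) |>.1 (le_antisymm h0 (sq_nonneg _))
    exact sub_eq_zero.1 (norm_eq_zero.1 this)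
  rw [hfv z, h1, inner_smul_left, Complex.conj_conj]

variable [Fintype ι]

/-- The tuples of unit vectors at which a multilinear form has its largest modulus. -/
def maximizers (A : MultilinearMap ℂ (fun _ : ι => E) ℂ) : Set (ι → E) :=
  {χ | (∀ i, ‖χ i‖ = 1) ∧ ∀ ξ : ι → E, (∀ i, ‖ξ i‖ = 1) → ‖A ξ‖ ≤ ‖A χ‖}

variable {A : MultilinearMap ℂ (fun _ : ι => E) ℂ} {χ : ι → E}

theorem norm_le_of_mem_maximizers (hχ : χ ∈ maximizers A) (ξ : ι → E) :
    ‖A ξ‖ ≤ ‖A χ‖ * ∏ i, ‖ξ i‖ := by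
  by_cases h : ∃ i, ξ i = 0
  · obtain ⟨i, hi⟩ := h
    rw [A.map_coord_zero i hi, norm_zero]
    positivity
  · push Not at h
    have h1 : ξ = fun i => ((‖ξ i‖ : ℝ) : ℂ) • (((‖ξ i‖⁻¹ : ℝ) : ℂ) • ξ i) := by
      funext i
      rw [smul_smul, ← Complex.ofReal_mul, mul_inv_cancel₀ (norm_ne_zero_iff.2 (h i))]
      simp
    have h2 : ‖A fun i => (((‖ξ i‖⁻¹ : ℝ) : ℂ) • ξ i)‖ ≤ ‖A χ‖ := hχ.2 _ fun i => by
      rw [norm_smul, Complex.norm_real, norm_inv, norm_norm,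
        inv_mul_cancel₀ (norm_ne_zero_iff.2 (h i))]
    calc ‖A ξ‖ = ‖A fun i => ((‖ξ i‖ : ℝ) : ℂ) • (((‖ξ i‖⁻¹ : ℝ) : ℂ) • ξ i)‖ := by rw [← h1]
      _ = (∏ i, ‖ξ i‖) * ‖A fun i => (((‖ξ i‖⁻¹ : ℝ) : ℂ) • ξ i)‖ := by
        rw [A.map_smul_univ, smul_eq_mul, norm_mul, norm_prod]
        simp
      _ ≤ ‖A χ‖ * ∏ i, ‖ξ i‖ := by
        rw [mul_comm]
        gcongr

theorem isClosed_maximizers (hA : Continuous A) : IsClosed (maximizers A) := by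
  simp only [maximizers, Set.ofPred_and, Set.ofPred_forall]
  refine IsClosed.inter (isClosed_iInter fun i => ?_)
    (isClosed_iInter fun ξ => isClosed_iInter fun _ => ?_)
  · exact isClosed_eq (by fun_prop) continuous_const
  · exact isClosed_le continuous_const hA.norm

variable [DecidableEq ι]

theorem norm_update_update_le (hχ : χ ∈ maximizers A) {i j : ι} (hij : i ≠ j) (x y : E) :
    ‖A (update (update χ i x) j y)‖ ≤ ‖A χ‖ * (‖x‖ * ‖y‖) := by
  refine (norm_le_of_mem_maximizers hχ _).trans (le_of_eq ?_)
  congr 1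
  rw [← Finset.mul_prod_erase _ _ (Finset.mem_univ i),
    ← Finset.mul_prod_erase _ _ (Finset.mem_erase.2 ⟨hij.symm, Finset.mem_univ j⟩),
    Finset.prod_eq_one]
  · simp [hij]
  · intro k hk
    simp only [Finset.mem_erase, Finset.mem_univ, and_true] at hk
    rw [update_of_ne hk.1, update_of_ne hk.2, hχ.1]

variable [FiniteDimensional ℂ E]

/-- Two entries of a maximizing tuple of a symmetric form may be replaced by their normalized
sum. -/
theorem update_update_mem_maximizers (hA : ∀ (P : Equiv.Perm ι) v, A (v ∘ P) = A v)
    (hχ : χ ∈ maximizers A) {i j : ι} (hij : i ≠ j) (hne : χ i + χ j ≠ 0) {m : E}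
    (hm : m = ((‖χ i + χ j‖⁻¹ : ℝ) : ℂ) • (χ i + χ j)) :
    update (update χ i m) j m ∈ maximizers A := by
  set x := χ i with hx
  set y := χ j with hy
  set B : E → E → ℂ := fun p q => A (update (update χ i p) j q) with hB
  have hsymm : ∀ p q, B p q = B q p := fun p q => by
    rw [hB]
    simp only
    rw [← hA (Equiv.swap i j) (update (update χ i p) j q)]
    congr 1
    funext k
    simp only [comp_apply, Equiv.swap_apply_def, update_apply]
    split_ifs <;> simp_all
  have hBxy : B x y = A χ := by simp [hB, hx, hy]
  have h1 : ∀ z, B x z = B x y * inner ℂ y z := by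
    refine functional_eq_of_norm_attained (f := A.toLinearMap (update χ i x) j) (hχ.1 j)
      fun z => ?_
    have h := norm_update_update_le hχ hij x z
    rw [hχ.1 i, one_mul] at h
    change ‖B x z‖ ≤ ‖B x y‖ * ‖z‖
    rwa [hBxy]
  have h2 : ∀ z, B y z = B y x * inner ℂ x z := by
    refine functional_eq_of_norm_attained (f := A.toLinearMap (update χ i y) j) (hχ.1 i)
      fun z => ?_
    have h := norm_update_update_le hχ hij y z
    rw [hχ.1 j, one_mul] at h
    change ‖B y z‖ ≤ ‖B y x‖ * ‖z‖
    rwa [hsymm y x, hBxy]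
  have hr : ∀ (p q r : E), B p (q + r) = B p q + B p r := fun p q r => by simp [hB]
  have hrs : ∀ (c : ℂ) (p q : E), B p (c • q) = c * B p q := fun c p q => by simp [hB]
  have hl : ∀ (p q r : E), B (q + r) p = B q p + B r p := fun p q r => by
    rw [hsymm, hr, hsymm q, hsymm r]
  have hsum : B (x + y) (x + y) = A χ * ((‖x + y‖ : ℝ) : ℂ) ^ 2 := by
    have h3 : inner ℂ (x + y) (x + y) = ((‖x + y‖ : ℝ) : ℂ) ^ 2 := inner_self_eq_norm_sq_to_K _
    rw [hl, h1, h2, hsymm y x, hBxy, ← mul_add, ← inner_add_left, add_comm y x, h3]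
  have hmm : ‖B m m‖ = ‖A χ‖ := by
    rw [hm, hrs, hsymm, hrs, hsum]
    have := norm_ne_zero_iff.2 hne
    simp only [norm_mul, Complex.norm_real, norm_pow, norm_norm, norm_inv]
    field_simp
  refine ⟨fun k => ?_, fun ξ hξ => ?_⟩
  · have hm1 : ‖m‖ = 1 := by
      rw [hm, norm_smul, Complex.norm_real, norm_inv, norm_norm,
        inv_mul_cancel₀ (norm_ne_zero_iff.2 hne)]
    simp only [update_apply]
    split_ifs
    exacts [hm1, hm1, hχ.1 k]
  · change ‖A ξ‖ ≤ ‖B m m‖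
    rw [hmm]
    exact hχ.2 ξ hξ

/-- Some maximizing tuple has equal entries at the places in `s`. -/
theorem exists_maximizer_eq_on [Nonempty ι] (hAc : Continuous A)
    (hA : ∀ (P : Equiv.Perm ι) v, A (v ∘ P) = A v)
    (hne : (maximizers A).Nonempty) (s : Finset ι) :
    ∃ χ ∈ maximizers A, ∃ u, ‖u‖ = 1 ∧ ∀ i ∈ s, χ i = u := by
  induction s using Finset.induction_on with
  | empty =>
    obtain ⟨χ, hχ⟩ := hne
    exact ⟨χ, hχ, χ (Classical.arbitrary ι), hχ.1 _, by simp⟩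
  | insert j s hjs ih =>
    obtain ⟨χ, hχ, u, hu, hχu⟩ := ih
    obtain ⟨e, he, hec⟩ := exists_phase (inner ℂ u (χ j))
    set y := e • χ j with hy
    set c := ‖inner ℂ u (χ j)‖ with hcdef
    have hc0 : 0 ≤ c := norm_nonneg _
    have hy1 : ‖y‖ = 1 := by rw [hy, norm_smul, he, hχ.1, one_mul]
    have hc : inner ℂ u y = (c : ℂ) := by rw [hy, inner_smul_right, hec]
    have hχ' : update χ j y ∈ maximizers A := by
      have hval : ‖A (update χ j y)‖ = ‖A χ‖ := by
        rw [hy, A.map_update_smul, update_eq_self, norm_smul, he, one_mul]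
      refine ⟨fun k => ?_, fun ξ hξ => hval.symm ▸ hχ.2 ξ hξ⟩
      simp only [update_apply]
      split_ifs
      exacts [hy1, hχ.1 k]
    set T : Set (ι → E) := maximizers A ∩ {ξ | ∀ i ∈ insert j s, ξ i ∈ unitArc u y} with hT
    have hTc : IsCompact T := by
      refine isCompact_unitTuples.of_isClosed_subset
        ((isClosed_maximizers hAc).inter ?_) fun ξ hξ => hξ.1.1
      simp only [Set.ofPred_forall]
      exact isClosed_iInter fun i => isClosed_iInter fun _ =>
        (isCompact_unitArc u y).isClosed.preimage (continuous_apply i)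
    have hTne : T.Nonempty := by
      refine ⟨update χ j y, hχ', fun i hi => ?_⟩
      rcases Finset.mem_insert.1 hi with h | hi
      · rw [h, update_self]
        exact ⟨hy1, 0, by simp, 1, by simp, by simp⟩
      · rw [update_of_ne (ne_of_mem_of_not_mem hi hjs), hχu i hi]
        exact ⟨hu, 1, by simp, 0, by simp, by simp⟩
    obtain ⟨ξ, hξT, hξmax⟩ := hTc.exists_isMaxOn hTne
      (f := fun ξ : ι → E => ∑ i ∈ insert j s, (inner ℂ (u + y) (ξ i)).re) (by fun_prop)
    refine ⟨ξ, hξT.1, ξ j, hξT.1.1 j, fun i hi => ?_⟩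
    by_contra hij
    have hne' : i ≠ j := by rintro rfl; exact hij rfl
    obtain ⟨hp1, a, ha, b, hb, hp⟩ := hξT.2 i hi
    obtain ⟨hq1, a', ha', b', hb', hq⟩ := hξT.2 j (Finset.mem_insert_self j s)
    have hpn := norm_sq_combination hu hy1 hc a b
    have hqn := norm_sq_combination hu hy1 hc a' b'
    rw [← hp, hp1] at hpn
    rw [← hq, hq1] at hqn
    have hpq : ξ i + ξ j = ((a + a' : ℝ) : ℂ) • u + ((b + b' : ℝ) : ℂ) • y := by
      rw [hp, hq]; push_cast; module
    have hab : 0 < a + b := by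
      rcases (add_nonneg ha.1 hb.1).eq_or_lt with h | h
      · have h1 : a = 0 := by linarith [ha.1, hb.1]
        have h2 : b = 0 := by linarith [ha.1, hb.1]
        rw [h1, h2] at hpn; norm_num at hpn
      · exact h
    have hab' : 0 ≤ a' + b' := add_nonneg ha'.1 hb'.1
    have hre : (inner ℂ (u + y) (ξ i + ξ j)).re = (a + a' + (b + b')) * (1 + c) := by
      rw [hpq, re_inner_combination hu hy1 hc]
    have hrepos : 0 < (inner ℂ (u + y) (ξ i + ξ j)).re := by
      rw [hre]; apply mul_pos <;> linarith
    have hsum0 : ξ i + ξ j ≠ 0 := by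
      intro h; rw [h, inner_zero_right] at hrepos; simp at hrepos
    have hnpos : 0 < ‖ξ i + ξ j‖ := norm_pos_iff.2 hsum0
    have hlt : ‖ξ i + ξ j‖ < 2 := by
      have h1 := parallelogram_law_with_norm ℂ (ξ i) (ξ j)
      rw [hp1, hq1] at h1
      have h2 : 0 < ‖ξ i - ξ j‖ := norm_pos_iff.2 (sub_ne_zero.2 hij)
      nlinarith
    set r := ‖ξ i + ξ j‖⁻¹ with hr
    have hrpos : 0 < r := inv_pos.2 hnpos
    set m := (r : ℂ) • (ξ i + ξ j) with hm
    have hm1 : ‖m‖ = 1 := by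
      rw [hm, norm_smul, Complex.norm_real, Real.norm_of_nonneg hrpos.le, hr,
        inv_mul_cancel₀ hnpos.ne']
    have hmarc : m ∈ unitArc u y := by
      have h1 : m = ((r * (a + a') : ℝ) : ℂ) • u + ((r * (b + b') : ℝ) : ℂ) • y := by
        rw [hm, hpq]; push_cast; module
      have h2 := norm_sq_combination hu hy1 hc (r * (a + a')) (r * (b + b'))
      rw [← h1, hm1, one_pow] at h2
      have h3 := coeff_le_one (mul_nonneg hrpos.le (add_nonneg ha.1 ha'.1))
        (mul_nonneg hrpos.le (add_nonneg hb.1 hb'.1)) hc0 h2.symm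
      exact ⟨hm1, _, h3.1, _, h3.2, h1⟩
    have hnew : update (update ξ i m) j m ∈ T := by
      refine ⟨update_update_mem_maximizers hA hξT.1 hne' hsum0 hm, fun k hk => ?_⟩
      simp only [update_apply]
      split_ifs
      exacts [hmarc, hmarc, hξT.2 k hk]
    have hle := hξmax hnew
    simp only [Set.mem_ofPred_eq] at hle
    rw [← Finset.add_sum_erase _ _ (Finset.mem_insert_self j s),
      ← Finset.add_sum_erase _ _ (Finset.mem_erase.2 ⟨hne', hi⟩),
      ← Finset.add_sum_erase (insert j s) _ (Finset.mem_insert_self j s),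
      ← Finset.add_sum_erase ((insert j s).erase j) _ (Finset.mem_erase.2 ⟨hne', hi⟩),
      Finset.sum_congr rfl (g := fun k => (inner ℂ (u + y) (ξ k)).re)] at hle
    · simp only [update_self, update_of_ne hne'] at hle
      have h1 : (inner ℂ (u + y) m).re = r * (inner ℂ (u + y) (ξ i + ξ j)).re := by
        rw [hm, inner_smul_right, Complex.re_ofReal_mul]
      have h2 : (inner ℂ (u + y) (ξ i + ξ j)).re
          = (inner ℂ (u + y) (ξ i)).re + (inner ℂ (u + y) (ξ j)).re := by
        rw [inner_add_right, Complex.add_re]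
      have h3 : 1 < 2 * r := by
        rw [hr]
        have := mul_inv_cancel₀ hnpos.ne'
        nlinarith [inv_pos.2 hnpos]
      nlinarith
    · intro k hk
      simp only [Finset.mem_erase] at hk
      rw [update_of_ne hk.2.1, update_of_ne hk.1]

/-- Banach's theorem: a symmetric multilinear form on a Hilbert space attains its norm on the
diagonal. -/
theorem norm_le_of_diagonal_le [Nonempty ι] (hAc : Continuous A)
    (hA : ∀ (P : Equiv.Perm ι) v, A (v ∘ P) = A v)
    {C : ℝ} (hC : ∀ u : E, ‖u‖ = 1 → ‖A fun _ => u‖ ≤ C) {ξ : ι → E} (hξ : ∀ i, ‖ξ i‖ = 1) :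
    ‖A ξ‖ ≤ C := by
  obtain ⟨χ, hχ1, hχ2⟩ := isCompact_unitTuples.exists_isMaxOn (f := fun ξ : ι → E => ‖A ξ‖)
    ⟨ξ, hξ⟩ hAc.norm.continuousOn
  obtain ⟨χ', hχ', u, hu, h⟩ := exists_maximizer_eq_on hAc hA
    ⟨χ, hχ1, fun ξ hξ => hχ2 hξ⟩ Finset.univ
  have : χ' = fun _ => u := funext fun i => h i (Finset.mem_univ i)
  subst this
  exact (hχ'.2 ξ hξ).trans (hC u hu)

end Banach
end MajoranaStates

namespace MajoranaStates

/-! ### Overlaps with product states -/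

/-- The overlap `χ ↦ ⟨ψ | χ₁ ⊗ ⋯ ⊗ χₙ⟩` as a multilinear form. -/
noncomputable def overlapForm {n : ℕ} (ψ : NQubit n) :
    MultilinearMap ℂ (fun _ : Fin n => Qubit) ℂ :=
  ∑ b : Fin n → Fin 2, starRingEnd ℂ (ψ b) •
    (MultilinearMap.mkPiAlgebra ℂ (Fin n) ℂ).compLinearMap
      fun i => (EuclideanSpace.proj (𝕜 := ℂ) (b i)).toLinearMap

theorem overlapForm_apply {n : ℕ} (ψ : NQubit n) (χ : Fin n → Qubit) :
    overlapForm ψ χ = ∑ b, starRingEnd ℂ (ψ b) * ∏ i, χ i (b i) := by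
  simp [overlapForm]

theorem inner_productState {n : ℕ} (ψ : NQubit n) (χ : Fin n → Qubit) :
    inner ℂ ψ (productState χ) = overlapForm ψ χ := by
  rw [overlapForm_apply, PiLp.inner_apply]
  simp [productState, mul_comm]

theorem continuous_overlapForm {n : ℕ} (ψ : NQubit n) : Continuous (overlapForm ψ) := by
  have : (overlapForm ψ : (Fin n → Qubit) → ℂ) =
      fun χ => ∑ b, starRingEnd ℂ (ψ b) * ∏ i, χ i (b i) := funext (overlapForm_apply ψ)
  rw [this]
  fun_prop

/-- The number of ones of a bit string. -/
def weight {n : ℕ} (b : Fin n → Fin 2) : ℕ := (Finset.univ.filter fun i => b i = 1).card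

theorem weight_le {n : ℕ} (b : Fin n → Fin 2) : weight b ≤ n :=
  (Finset.card_le_univ _).trans (by simp)

theorem exists_perm_of_weight_eq {n : ℕ} {b b' : Fin n → Fin 2} (h : weight b = weight b') :
    ∃ P : Equiv.Perm (Fin n), b = b' ∘ P := by
  have h1 : Fintype.card {i // b i = 1} = Fintype.card {i // b' i = 1} := by
    rw [Fintype.card_subtype, Fintype.card_subtype]; exact h
  have h2 : Fintype.card {i // ¬ b i = 1} = Fintype.card {i // ¬ b' i = 1} := by
    rw [Fintype.card_subtype_compl, Fintype.card_subtype_compl, h1]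
  obtain ⟨e⟩ := Fintype.card_eq.1 h1
  obtain ⟨e'⟩ := Fintype.card_eq.1 h2
  refine ⟨Equiv.subtypeCongr e e', funext fun i => ?_⟩
  by_cases hi : b i = 1
  · have : (Equiv.subtypeCongr e e') i = e ⟨i, hi⟩ := by
      simp [Equiv.subtypeCongr, Equiv.sumCompl, hi]
    rw [Function.comp_apply, this, hi, (e ⟨i, hi⟩).2]
  · have : (Equiv.subtypeCongr e e') i = e' ⟨i, hi⟩ := by
      simp [Equiv.subtypeCongr, Equiv.sumCompl, hi]
    rw [Function.comp_apply, this]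
    have := (e' ⟨i, hi⟩).2
    omega

/-- A vector is symmetric if its amplitudes are invariant under permutations of the qubits. -/
def IsSymm {n : ℕ} (ψ : NQubit n) : Prop := ∀ (P : Equiv.Perm (Fin n)) b, ψ (b ∘ P) = ψ b

theorem weight_comp_perm {n : ℕ} (P : Equiv.Perm (Fin n)) (b : Fin n → Fin 2) :
    weight (b ∘ P) = weight b := by
  refine Finset.card_bij (fun i _ => P i) (by simp) (by simp) fun i hi => ?_
  exact ⟨P.symm i, by simpa using hi, by simp⟩

theorem isSymm_dicke (n k : ℕ) : IsSymm (dicke n k) := fun P b => by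
  have := weight_comp_perm P b
  unfold weight at this
  simp only [dicke, this]

theorem IsSymm.add {n : ℕ} {ψ ξ : NQubit n} (h : IsSymm ψ) (h' : IsSymm ξ) : IsSymm (ψ + ξ) :=
  fun P b => by simp [h P b, h' P b]

theorem IsSymm.sub {n : ℕ} {ψ ξ : NQubit n} (h : IsSymm ψ) (h' : IsSymm ξ) : IsSymm (ψ - ξ) :=
  fun P b => by simp [h P b, h' P b]

theorem IsSymm.smul {n : ℕ} {ψ : NQubit n} (h : IsSymm ψ) (c : ℝ) : IsSymm (c • ψ) :=
  fun P b => by simp [h P b]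

theorem overlapForm_comp_perm {n : ℕ} {ψ : NQubit n} (h : IsSymm ψ) (P : Equiv.Perm (Fin n))
    (χ : Fin n → Qubit) : overlapForm ψ (χ ∘ P) = overlapForm ψ χ := by
  rw [overlapForm_apply, overlapForm_apply]
  refine Fintype.sum_equiv (P.arrowCongr (Equiv.refl _)) _ _ fun b => ?_
  congr 1
  · congr 1
    exact (h P.symm b).symm
  · refine Fintype.prod_equiv P _ _ fun i => ?_
    have h1 : (P.arrowCongr (Equiv.refl (Fin 2))) b (P i) = b i := by
      simp [Equiv.arrowCongr_apply]
    rw [h1]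
    rfl

/-- The overlap with `σ ⊗ ⋯ ⊗ σ`. -/
noncomputable def amplitude {n : ℕ} (ψ : NQubit n) (σ : Qubit) : ℂ := overlapForm ψ fun _ => σ

theorem prod_apply_eq_pow {n : ℕ} (σ : Qubit) (b : Fin n → Fin 2) :
    ∏ i, σ (b i) = σ 0 ^ (n - weight b) * σ 1 ^ weight b := by
  have h : ∀ i, σ (b i) = if b i = 1 then σ 1 else σ 0 := fun i => by
    split_ifs with h
    · rw [h]
    · rw [show b i = 0 by omega]
  have h2 : (Finset.univ.filter fun i => ¬ b i = 1).card = n - weight b := by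
    have := Finset.card_filter_add_card_filter_not (s := Finset.univ) fun i => b i = 1
    simp only [Finset.card_univ, Fintype.card_fin] at this
    unfold weight
    omega
  rw [Finset.prod_congr rfl fun i _ => h i, Finset.prod_ite, Finset.prod_const, Finset.prod_const,
    h2, mul_comm]
  rfl

theorem amplitude_eq {n : ℕ} (ψ : NQubit n) (σ : Qubit) :
    amplitude ψ σ = ∑ b, starRingEnd ℂ (ψ b) * (σ 0 ^ (n - weight b) * σ 1 ^ weight b) := by
  rw [amplitude, overlapForm_apply]
  exact Finset.sum_congr rfl fun b _ => by rw [prod_apply_eq_pow]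

theorem card_weight_eq (n k : ℕ) :
    (Finset.univ.filter fun b : Fin n → Fin 2 => weight b = k).card = n.choose k := by
  have h : (Finset.powersetCard k (Finset.univ : Finset (Fin n))).card = n.choose k := by
    rw [Finset.card_powersetCard, Finset.card_fin]
  rw [← h]
  refine Finset.card_bij (fun b _ => Finset.univ.filter fun i => b i = 1) ?_ ?_ ?_
  · intro b hb
    exact Finset.mem_powersetCard.2 ⟨Finset.subset_univ _, (Finset.mem_filter.1 hb).2⟩
  · intro b _ b' _ h
    funext i
    have := Finset.ext_iff.1 h i
    simp only [Finset.mem_filter, Finset.mem_univ, true_and] at this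
    omega
  · intro s hs
    rw [Finset.mem_powersetCard] at hs
    have h1 : (Finset.univ.filter fun i => (if i ∈ s then (1 : Fin 2) else 0) = 1) = s := by
      ext i; simp
    exact ⟨fun i => if i ∈ s then 1 else 0, by
      rw [Finset.mem_filter, weight, h1]
      exact ⟨Finset.mem_univ _, hs.2⟩, h1⟩

theorem amplitude_dicke (n k : ℕ) (σ : Qubit) :
    amplitude (dicke n k) σ = (√(n.choose k : ℝ) : ℂ) * (σ 0 ^ (n - k) * σ 1 ^ k) := by
  rw [amplitude_eq]
  have h : ∀ b : Fin n → Fin 2, starRingEnd ℂ (dicke n k b) *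
      (σ 0 ^ (n - weight b) * σ 1 ^ weight b) = if weight b = k then
        (((√(n.choose k : ℝ))⁻¹ : ℝ) : ℂ) * (σ 0 ^ (n - k) * σ 1 ^ k) else 0 := fun b => by
    change starRingEnd ℂ (if weight b = k then _ else _) * _ = _
    split_ifs with h
    · rw [Complex.conj_ofReal, h]
    · simp
  rw [Finset.sum_congr rfl fun b _ => h b, ← Finset.sum_filter, Finset.sum_const, card_weight_eq,
    nsmul_eq_mul, ← mul_assoc]
  congr 1
  rw [← Complex.ofReal_natCast, ← Complex.ofReal_mul]
  congr 1
  rcases (Nat.zero_le (n.choose k)).eq_or_lt with h0 | h0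
  · simp [← h0]
  · have h1 : (0 : ℝ) < √(n.choose k) := Real.sqrt_pos.2 (by exact_mod_cast h0)
    field_simp
    rw [Real.sq_sqrt (by positivity)]

theorem amplitude_add {n : ℕ} (ψ ξ : NQubit n) (σ : Qubit) :
    amplitude (ψ + ξ) σ = amplitude ψ σ + amplitude ξ σ := by
  simp [amplitude_eq, add_mul, Finset.sum_add_distrib]

theorem amplitude_sub {n : ℕ} (ψ ξ : NQubit n) (σ : Qubit) :
    amplitude (ψ - ξ) σ = amplitude ψ σ - amplitude ξ σ := by
  simp [amplitude_eq, sub_mul, Finset.sum_sub_distrib]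

theorem amplitude_smul {n : ℕ} (c : ℝ) (ψ : NQubit n) (σ : Qubit) :
    amplitude (c • ψ) σ = c * amplitude ψ σ := by
  simp [amplitude_eq, Finset.mul_sum, mul_assoc]

/-! ### Bloch vectors -/

theorem norm_sq_qubit (σ : Qubit) : ‖σ‖ ^ 2 = ‖σ 0‖ ^ 2 + ‖σ 1‖ ^ 2 := by
  rw [EuclideanSpace.norm_sq_eq]; simp

theorem norm_sq_inner_eq {φ σ : Qubit} (hφ : ‖φ‖ = 1) (hσ : ‖σ‖ = 1) :
    ‖inner ℂ φ σ‖ ^ 2 = (1 + inner ℝ (blochVector φ) (blochVector σ)) / 2 := by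
  have h1 := norm_sq_qubit φ
  have h2 := norm_sq_qubit σ
  rw [hφ] at h1
  rw [hσ] at h2
  simp only [PiLp.inner_apply, Fin.sum_univ_two, Fin.sum_univ_three, blochVector]
  simp only [← Complex.normSq_eq_norm_sq, Complex.normSq_apply] at *
  simp
  set a := (φ 0).re; set b := (φ 0).im; set c := (φ 1).re; set d := (φ 1).im
  set a' := (σ 0).re; set b' := (σ 0).im; set c' := (σ 1).re; set d' := (σ 1).im
  have h3 : (a * a + b * b + (c * c + d * d)) * (a' * a' + b' * b' + (c' * c' + d' * d')) = 1 := by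
    rw [← h1, ← h2]; norm_num
  linear_combination (1 / 2) * h3

theorem norm_blochVector {σ : Qubit} (hσ : ‖σ‖ = 1) : ‖blochVector σ‖ = 1 := by
  have h := norm_sq_inner_eq hσ hσ
  rw [inner_self_eq_norm_sq_to_K, real_inner_self_eq_norm_sq, hσ] at h
  norm_num at h
  rw [← sq_eq_sq₀ (norm_nonneg _) zero_le_one]
  linarith

theorem norm_sq_space (p : Space) : ‖p‖ ^ 2 = p 0 ^ 2 + p 1 ^ 2 + p 2 ^ 2 := by
  rw [EuclideanSpace.norm_sq_eq]; simp [Fin.sum_univ_three]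

theorem exists_blochVector_eq {p : Space} (hp : ‖p‖ = 1) :
    ∃ σ : Qubit, ‖σ‖ = 1 ∧ blochVector σ = p := by
  have h := norm_sq_space p
  rw [hp] at h
  suffices ∃ σ : Qubit, ‖σ‖ ^ 2 = 1 ∧ blochVector σ = p by
    obtain ⟨σ, h1, h2⟩ := this
    exact ⟨σ, by rwa [← sq_eq_sq₀ (norm_nonneg _) zero_le_one, one_pow], h2⟩
  by_cases hz : p 2 = -1
  · refine ⟨!₂[0, 1], by rw [norm_sq_qubit]; simp, ?_⟩
    have h0 : p 0 = 0 := by nlinarith [sq_nonneg (p 0), sq_nonneg (p 1)]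
    have h1 : p 1 = 0 := by nlinarith [sq_nonneg (p 0), sq_nonneg (p 1)]
    ext i
    fin_cases i <;> simp [blochVector, *]
  · have hz' : 0 < (1 + p 2) / 2 := by
      have : -1 ≤ p 2 := by nlinarith [sq_nonneg (p 0), sq_nonneg (p 1)]
      have := lt_of_le_of_ne this (Ne.symm hz)
      linarith
    set a := √((1 + p 2) / 2) with ha
    have ha0 : 0 < a := Real.sqrt_pos.2 hz'
    have ha2 : a ^ 2 = (1 + p 2) / 2 := Real.sq_sqrt hz'.le
    have hb : ‖(⟨p 0 / (2 * a), p 1 / (2 * a)⟩ : ℂ)‖ ^ 2 = (1 - p 2) / 2 := by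
      rw [← Complex.normSq_eq_norm_sq, Complex.normSq_mk]
      field_simp
      rw [ha2]
      linear_combination -h
    have ha' : ‖(a : ℂ)‖ ^ 2 = (1 + p 2) / 2 := by
      rw [Complex.norm_real, Real.norm_eq_abs, sq_abs, ha2]
    refine ⟨!₂[(a : ℂ), ⟨p 0 / (2 * a), p 1 / (2 * a)⟩], ?_, ?_⟩
    · rw [norm_sq_qubit]
      change ‖(a : ℂ)‖ ^ 2 + ‖(⟨p 0 / (2 * a), p 1 / (2 * a)⟩ : ℂ)‖ ^ 2 = 1
      rw [hb, ha']; ring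
    · ext i
      fin_cases i
      · simp [blochVector]; field_simp
      · simp [blochVector]; field_simp
      · change ‖(a : ℂ)‖ ^ 2 - ‖(⟨p 0 / (2 * a), p 1 / (2 * a)⟩ : ℂ)‖ ^ 2 = p 2
        rw [hb, ha']; ring

/-! ### Closest product points -/

theorem isClosestProduct_iff {n : ℕ} [NeZero n] {ψ : NQubit n} (hψ : IsSymm ψ) (σ : Qubit) :
    IsClosestProduct ψ (fun _ => σ) ↔
      ‖σ‖ = 1 ∧ ∀ τ : Qubit, ‖τ‖ = 1 → ‖amplitude ψ τ‖ ≤ ‖amplitude ψ σ‖ := by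
  have h : ∀ χ : Fin n → Qubit, ‖inner ℂ (productState χ) ψ‖ = ‖overlapForm ψ χ‖ := fun χ => by
    rw [← inner_productState, norm_inner_symm]
  simp only [IsClosestProduct, h]
  constructor
  · rintro ⟨h1, h2⟩
    exact ⟨h1 0, fun τ hτ => h2 (fun _ => τ) fun _ => hτ⟩
  · rintro ⟨h1, h2⟩
    exact ⟨fun _ => h1, fun χ hχ => norm_le_of_diagonal_le (continuous_overlapForm ψ)
      (overlapForm_comp_perm hψ) h2 hχ⟩

theorem closestProductPoints_eq {n : ℕ} [NeZero n] {ψ : NQubit n} (hψ : IsSymm ψ)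
    {F : Space → ℝ} (hF : ∀ σ : Qubit, ‖σ‖ = 1 → ‖amplitude ψ σ‖ ^ 2 = F (blochVector σ)) :
    closestProductPoints ψ = {p | ‖p‖ = 1 ∧ ∀ q : Space, ‖q‖ = 1 → F q ≤ F p} := by
  ext p
  simp only [closestProductPoints, isClosestProduct_iff hψ, Set.mem_ofPred_eq]
  constructor
  · rintro ⟨σ, ⟨h1, h2⟩, rfl⟩
    refine ⟨norm_blochVector h1, fun q hq => ?_⟩
    obtain ⟨τ, hτ, rfl⟩ := exists_blochVector_eq hq
    rw [← hF σ h1, ← hF τ hτ]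
    gcongr
    exact h2 τ hτ
  · rintro ⟨h1, h2⟩
    obtain ⟨σ, hσ, rfl⟩ := exists_blochVector_eq h1
    refine ⟨σ, ⟨hσ, fun τ hτ => ?_⟩, rfl⟩
    have := h2 _ (norm_blochVector hτ)
    rw [← hF σ hσ, ← hF τ hτ] at this
    exact (pow_le_pow_iff_left₀ (norm_nonneg _) (norm_nonneg _) two_ne_zero).1 this

/-! ### Majorana points -/

theorem inner_productState_productState {n : ℕ} (φ χ : Fin n → Qubit) :
    inner ℂ (productState φ) (productState χ) = ∏ i, inner ℂ (φ i) (χ i) := by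
  rw [inner_productState, overlapForm_apply]
  simp only [PiLp.inner_apply]
  rw [Finset.prod_univ_sum, Fintype.piFinset_univ]
  refine Finset.sum_congr rfl fun b _ => ?_
  simp [productState, ← Finset.prod_mul_distrib, mul_comm]

/-- The symmetrized product vector. -/
noncomputable def symmProduct {n : ℕ} (φ : Fin n → Qubit) : NQubit n :=
  ∑ P : Equiv.Perm (Fin n), productState fun i => φ (P i)

theorem amplitude_symmProduct {n : ℕ} (φ : Fin n → Qubit) (c : ℂ) (σ : Qubit) :
    amplitude (c • symmProduct φ) σ =
      starRingEnd ℂ c * ((n.factorial : ℂ) * ∏ i, inner ℂ (φ i) σ) := by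
  rw [amplitude, ← inner_productState, inner_smul_left, symmProduct, sum_inner]
  congr 1
  have h : ∀ P : Equiv.Perm (Fin n), inner ℂ (productState fun i => φ (P i))
      (productState fun _ => σ) = ∏ i, inner ℂ (φ i) σ := fun P => by
    rw [inner_productState_productState]
    exact Equiv.prod_comp P fun i => inner ℂ (φ i) σ
  rw [Finset.sum_congr rfl fun P _ => h P]
  simp [Fintype.card_perm]

theorem isSymm_smul_symmProduct {n : ℕ} (φ : Fin n → Qubit) (c : ℂ) :
    IsSymm (c • symmProduct φ) := fun P b => by
  have h : ∀ b, symmProduct φ b = ∑ R : Equiv.Perm (Fin n), ∏ i, φ (R i) (b i) := fun b => by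
    simp [symmProduct, productState]
  simp only [PiLp.smul_apply, h]
  congr 1
  refine Fintype.sum_equiv (Equiv.mulRight P⁻¹) _ _ fun R => ?_
  refine Fintype.prod_equiv P _ _ fun i => ?_
  simp

open Polynomial in
/-- The polynomial `z ↦ amplitude ψ (1, z)`. -/
noncomputable def amplitudePoly {n : ℕ} (ψ : NQubit n) : ℂ[X] :=
  ∑ b : Fin n → Fin 2, C (starRingEnd ℂ (ψ b)) * X ^ weight b

theorem eval_amplitudePoly {n : ℕ} (ψ : NQubit n) (z : ℂ) :
    (amplitudePoly ψ).eval z = amplitude ψ !₂[1, z] := by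
  simp [amplitudePoly, amplitude_eq, Polynomial.eval_finsetSum]

theorem coeff_amplitudePoly {n : ℕ} {ψ : NQubit n} (hψ : IsSymm ψ) (b : Fin n → Fin 2) :
    (amplitudePoly ψ).coeff (weight b) = (n.choose (weight b) : ℂ) * starRingEnd ℂ (ψ b) := by
  simp only [amplitudePoly, Polynomial.finsetSum_coeff, Polynomial.coeff_C_mul_X_pow]
  rw [← Finset.sum_filter, ← card_weight_eq, ← nsmul_eq_mul, ← Finset.sum_const]
  refine Finset.sum_congr (by simp [eq_comm]) fun b' hb' => ?_
  simp only [Finset.mem_filter, Finset.mem_univ, true_and] at hb'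
  obtain ⟨P, rfl⟩ := exists_perm_of_weight_eq hb'
  rw [hψ]

theorem choose_weight_ne_zero {n : ℕ} (b : Fin n → Fin 2) : (n.choose (weight b) : ℂ) ≠ 0 := by
  exact_mod_cast (Nat.choose_pos (weight_le b)).ne'

theorem eq_of_amplitudePoly_eq {n : ℕ} {ψ ξ : NQubit n} (hψ : IsSymm ψ) (hξ : IsSymm ξ)
    (h : amplitudePoly ψ = amplitudePoly ξ) : ψ = ξ := by
  ext b
  have h1 := coeff_amplitudePoly hψ b
  rw [h, coeff_amplitudePoly hξ b] at h1
  exact (star_injective (mul_left_cancel₀ (choose_weight_ne_zero b) h1)).symm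

theorem natDegree_amplitudePoly_le {n : ℕ} (ψ : NQubit n) : (amplitudePoly ψ).natDegree ≤ n :=
  Polynomial.natDegree_sum_le_of_forall_le _ _ fun b _ =>
    (Polynomial.natDegree_C_mul_X_pow_le _ _).trans (weight_le b)

theorem exists_fin_map_eq {α : Type*} {n : ℕ} (M : Multiset α) (h : M.card = n) :
    ∃ φ : Fin n → α, Finset.univ.val.map φ = M := by
  subst h
  induction M using Quotient.inductionOn with
  | h L =>
    refine ⟨fun i => L.get i, ?_⟩
    rw [Fin.univ_val_map]
    exact congrArg _ (List.ofFn_get L)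

theorem isMajoranaRep_iff {n : ℕ} {ψ : NQubit n} {φ : Fin n → Qubit} : IsMajoranaRep ψ φ ↔
    (∀ i, ‖φ i‖ = 1) ∧ ∃ c : ℂ, c ≠ 0 ∧ ψ = c • symmProduct φ := Iff.rfl

/-- Every nonzero symmetric vector has a Majorana representation. -/
theorem exists_isMajoranaRep {n : ℕ} {ψ : NQubit n} (hψ : IsSymm ψ) (h0 : ψ ≠ 0) :
    ∃ φ : Fin n → Qubit, IsMajoranaRep ψ φ := by
  simp only [isMajoranaRep_iff]
  set p := amplitudePoly ψ with hp
  have hp0 : p ≠ 0 := fun h => h0 <| by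
    refine eq_of_amplitudePoly_eq hψ (fun _ _ => rfl) ?_
    rw [← hp, h]
    simp [amplitudePoly]
  have hsplit := IsAlgClosed.splits p
  have hcard : p.roots.card = p.natDegree := hsplit.natDegree_eq_card_roots.symm
  obtain ⟨φ, hφ⟩ := exists_fin_map_eq (n := n)
    (p.roots.map (fun r => (!₂[-starRingEnd ℂ r, 1] : Qubit)) +
      Multiset.replicate (n - p.natDegree) !₂[1, 0])
    (by
      rw [Multiset.card_add, Multiset.card_map, Multiset.card_replicate, hcard]
      exact Nat.add_sub_cancel' (natDegree_amplitudePoly_le ψ))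
  have hprod : ∀ z : ℂ, ∏ i, inner ℂ (φ i) (!₂[1, z] : Qubit) = (p.roots.map (z - ·)).prod :=
    fun z => by
    have h1 : ∏ i, inner ℂ (φ i) (!₂[1, z] : Qubit) =
        ((Finset.univ.val.map φ).map fun v => inner ℂ v (!₂[1, z] : Qubit)).prod := by
      rw [Multiset.map_map]; rfl
    rw [h1, hφ]
    simp only [Multiset.map_add, Multiset.prod_add, Multiset.map_map, Multiset.map_replicate,
      Multiset.prod_replicate]
    simp [PiLp.inner_apply, sub_eq_neg_add]
  have hne : ∀ i, φ i ≠ 0 := fun i hi => by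
    have h1 : (0 : Qubit) ∈ Finset.univ.val.map φ := by
      rw [← hi]; exact Multiset.mem_map_of_mem _ (Finset.mem_univ i)
    rw [hφ, Multiset.mem_add, Multiset.mem_map, Multiset.mem_replicate] at h1
    rcases h1 with ⟨r, -, h⟩ | ⟨-, h⟩
    · have := congrArg (fun v : Qubit => v 1) h; simp at this
    · have := congrArg (fun v : Qubit => v 0) h; simp at this
  have hnorm : ∀ i, ((‖φ i‖ : ℝ) : ℂ) ≠ 0 := fun i => by
    exact_mod_cast norm_ne_zero_iff.2 (hne i)
  set d : ℂ := starRingEnd ℂ p.leadingCoeff / n.factorial * ∏ i, ((‖φ i‖ : ℝ) : ℂ) with hd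
  have hfac : (n.factorial : ℂ) ≠ 0 := by exact_mod_cast n.factorial_ne_zero
  refine ⟨fun i => ((‖φ i‖⁻¹ : ℝ) : ℂ) • φ i, fun i => ?_, d, ?_, ?_⟩
  · rw [norm_smul, Complex.norm_real, norm_inv, norm_norm,
      inv_mul_cancel₀ (norm_ne_zero_iff.2 (hne i))]
  · refine mul_ne_zero (div_ne_zero ?_ hfac) (Finset.prod_ne_zero_iff.2 fun i _ => hnorm i)
    simpa using hp0
  · refine eq_of_amplitudePoly_eq hψ (isSymm_smul_symmProduct _ _) (Polynomial.funext fun z => ?_)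
    rw [eval_amplitudePoly (d • _), amplitude_symmProduct]
    simp only [inner_smul_left, Complex.conj_ofReal, Finset.prod_mul_distrib, hprod]
    conv_lhs => rw [← hp, hsplit.eval_eq_prod_roots]
    rw [hd]
    simp only [map_mul, map_div₀, Complex.conj_conj, map_natCast, map_prod, Complex.conj_ofReal,
      Complex.ofReal_inv, Finset.prod_inv_distrib]
    have := Finset.prod_ne_zero_iff.2 fun i (_ : i ∈ Finset.univ) => hnorm i
    field_simp

theorem inner_eq_zero_iff {φ σ : Qubit} (hφ : ‖φ‖ = 1) (hσ : ‖σ‖ = 1) :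
    inner ℂ φ σ = 0 ↔ blochVector φ = -blochVector σ := by
  have h := norm_sq_inner_eq hφ hσ
  have h2 := inner_eq_one_iff_of_norm_eq_one (𝕜 := ℝ) (norm_blochVector hφ)
    (y := -blochVector σ) (by rw [norm_neg, norm_blochVector hσ])
  rw [← h2, inner_neg_right, ← norm_eq_zero, ← pow_eq_zero_iff two_ne_zero, h]
  constructor <;> intro h <;> linarith

theorem majoranaPoints_eq {n : ℕ} {ψ : NQubit n} (hψ : IsSymm ψ) (h0 : ψ ≠ 0)
    {F : Space → ℝ} (hF : ∀ σ : Qubit, ‖σ‖ = 1 → ‖amplitude ψ σ‖ ^ 2 = F (blochVector σ)) :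
    majoranaPoints ψ = {p | ‖p‖ = 1 ∧ F (-p) = 0} := by
  have key : ∀ φ : Fin n → Qubit, IsMajoranaRep ψ φ → ∀ p : Space, ‖p‖ = 1 →
      (F (-p) = 0 ↔ ∃ i, p = blochVector (φ i)) := by
    intro φ hrep p hp
    obtain ⟨hφ, c, hc, hψφ⟩ := isMajoranaRep_iff.1 hrep
    obtain ⟨σ, hσ, hσp⟩ := exists_blochVector_eq (p := -p) (by rwa [norm_neg])
    have hfac : (n.factorial : ℂ) ≠ 0 := by exact_mod_cast n.factorial_ne_zero
    rw [← hσp, ← hF σ hσ, pow_eq_zero_iff two_ne_zero, norm_eq_zero, hψφ, amplitude_symmProduct]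
    simp only [mul_eq_zero, map_eq_zero, hc, hfac, false_or, Finset.prod_eq_zero_iff,
      Finset.mem_univ, true_and]
    refine exists_congr fun i => ?_
    rw [inner_eq_zero_iff (hφ i) hσ, hσp, neg_neg, eq_comm]
  ext p
  constructor
  · rintro ⟨φ, hφ, i, rfl⟩
    have hn := norm_blochVector (hφ.1 i)
    exact ⟨hn, (key φ hφ _ hn).2 ⟨i, rfl⟩⟩
  · rintro ⟨h1, h2⟩
    obtain ⟨φ, hφ⟩ := exists_isMajoranaRep hψ h0
    exact ⟨φ, hφ, (key φ hφ p h1).1 h2⟩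

/-- If `|⟨σ ⊗ ⋯ ⊗ σ | ψ⟩|²` is a multiple of `∏ (1 + ⟨r, vₖ⟩)`, with `r` the Bloch vector of `σ`,
then the unit vectors `vₖ` are the Majorana points of `ψ`. -/
theorem majoranaPoints_eq_range {n : ℕ} {ψ : NQubit n} (hψ : IsSymm ψ) (h0 : ψ ≠ 0)
    {κ : Type*} [Fintype κ] {v : κ → Space} (hv : ∀ k, ‖v k‖ = 1) {c : ℝ} (hc : c ≠ 0)
    (hF : ∀ σ : Qubit, ‖σ‖ = 1 →
      ‖amplitude ψ σ‖ ^ 2 = c * ∏ k, (1 + inner ℝ (blochVector σ) (v k))) :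
    majoranaPoints ψ = Set.range v := by
  rw [majoranaPoints_eq hψ h0 (F := fun p => c * ∏ k, (1 + inner ℝ p (v k))) hF]
  ext p
  simp only [Set.mem_ofPred_eq, mul_eq_zero, hc, false_or, Finset.prod_eq_zero_iff,
    Finset.mem_univ, true_and, inner_neg_left, Set.mem_range]
  have h1 : ∀ k, ‖p‖ = 1 → (1 + -inner ℝ p (v k) = 0 ↔ v k = p) := fun k hp => by
    rw [eq_comm (b := p), ← inner_eq_one_iff_of_norm_eq_one (𝕜 := ℝ) hp (hv k)]
    constructor <;> intro h <;> linarith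
  constructor
  · rintro ⟨hp, k, hk⟩
    exact ⟨k, (h1 k hp).1 hk⟩
  · rintro ⟨k, rfl⟩
    exact ⟨hv k, k, (h1 k (hv k)).2 rfl⟩

end MajoranaStates

namespace MajoranaStates
open Real

/-! ### Orthonormal frames and vertex families -/

/-- The isometry whose coordinates are the inner products with an orthonormal triple. -/
noncomputable def frame (r : Fin 3 → Space) (h : Orthonormal ℝ r) : Space ≃ₗᵢ[ℝ] Space :=
  (OrthonormalBasis.mk h (h.linearIndependent.span_eq_top_of_card_eq_finrank (by simp)).ge).repr

theorem frame_apply (r : Fin 3 → Space) (h : Orthonormal ℝ r) (q : Space) (i : Fin 3) :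
    frame r h q i = inner ℝ (r i) q := by
  rw [frame, OrthonormalBasis.repr_apply_apply, OrthonormalBasis.coe_mk]

theorem inner_space (p q : Space) : inner ℝ p q = p 0 * q 0 + p 1 * q 1 + p 2 * q 2 := by
  simp [PiLp.inner_apply, Fin.sum_univ_three, mul_comm]

theorem orthonormal_triple {r : Fin 3 → Space} (h0 : inner ℝ (r 0) (r 0) = (1 : ℝ))
    (h1 : inner ℝ (r 1) (r 1) = (1 : ℝ)) (h2 : inner ℝ (r 2) (r 2) = (1 : ℝ))
    (h01 : inner ℝ (r 0) (r 1) = (0 : ℝ)) (h02 : inner ℝ (r 0) (r 2) = (0 : ℝ))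
    (h12 : inner ℝ (r 1) (r 2) = (0 : ℝ)) : Orthonormal ℝ r := by
  rw [orthonormal_iff_ite]
  intro i j
  fin_cases i <;> fin_cases j <;> simp only [Fin.zero_eta, Fin.mk_one, Fin.reduceFinMk] <;>
    first
      | exact h0
      | exact h1
      | exact h2
      | exact h01
      | exact h02
      | exact h12
      | (rw [real_inner_comm]; first | exact h01 | exact h02 | exact h12)

/-- The vector with entry `p` at place `i` and entries `q`, `r` at the places that follow
cyclically. -/
noncomputable def cycVec (i : Fin 3) (p q r : ℝ) : Space := WithLp.toLp 2 fun k => ![p, q, r] (k - i)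

theorem inner_cycVec (v : Space) (i : Fin 3) (p q r : ℝ) :
    inner ℝ v (cycVec i p q r) = v i * p + v (i + 1) * q + v (i + 2) * r := by
  rw [inner_space]
  fin_cases i <;> simp [cycVec, show (0 : Fin 3) - 1 = 2 from rfl,
    show (0 : Fin 3) - 2 = 1 from rfl, show (1 : Fin 3) - 2 = 2 from rfl,
    show (2 : Fin 3) - 1 = 1 from rfl] <;> ring

theorem cycVec_apply_zero (i : Fin 3) (p q r : ℝ) : cycVec i p q r i = p := by
  simp [cycVec]

theorem cycVec_apply_one (i : Fin 3) (p q r : ℝ) : cycVec i p q r (i + 1) = q := by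
  simp [cycVec]

theorem cycVec_apply_two (i : Fin 3) (p q r : ℝ) : cycVec i p q r (i + 2) = r := by
  simp [cycVec]

theorem cycVec_eq (i : Fin 3) (v : Space) : cycVec i (v i) (v (i + 1)) (v (i + 2)) = v := by
  ext k
  have : k = i ∨ k = i + 1 ∨ k = i + 2 := by omega
  rcases this with rfl | rfl | rfl
  · rw [cycVec_apply_zero]
  · rw [cycVec_apply_one]
  · rw [cycVec_apply_two]

theorem norm_sq_cycVec (i : Fin 3) (p q r : ℝ) : ‖cycVec i p q r‖ ^ 2 = p ^ 2 + q ^ 2 + r ^ 2 := by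
  rw [← real_inner_self_eq_norm_sq, inner_cycVec, cycVec_apply_zero, cycVec_apply_one,
    cycVec_apply_two]
  ring

/-- The signs `1` and `-1`. -/
def sgn (b : Bool) : ℝ := if b then 1 else -1

@[simp] theorem sgn_true : sgn true = 1 := rfl
@[simp] theorem sgn_false : sgn false = -1 := rfl
@[simp] theorem abs_sgn (b : Bool) : |sgn b| = 1 := by cases b <;> simp
@[simp] theorem sgn_sq (b : Bool) : sgn b ^ 2 = 1 := by cases b <;> simp

theorem exists_sgn_mul {x r : ℝ} (h : |x| = r) : ∃ b, x = sgn b * r := by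
  rcases abs_cases x with h1 | h1
  · exact ⟨true, by simp; linarith⟩
  · exact ⟨false, by simp; linarith⟩

theorem sgn_injective : Function.Injective sgn := fun a b h => by
  cases a <;> cases b <;> first | rfl | (norm_num at h)

/-! ### Squared moduli of binary forms on unit qubits -/

theorem blochVector_apply_zero (σ : Qubit) :
    blochVector σ 0 = 2 * (starRingEnd ℂ (σ 0) * σ 1).re := by simp [blochVector]

theorem blochVector_apply_one (σ : Qubit) :
    blochVector σ 1 = 2 * (starRingEnd ℂ (σ 0) * σ 1).im := by simp [blochVector]

theorem blochVector_apply_two (σ : Qubit) :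
    blochVector σ 2 = ‖σ 0‖ ^ 2 - ‖σ 1‖ ^ 2 := by simp [blochVector]

theorem norm_sq_quadratic_form {σ : Qubit} (hσ : ‖σ‖ = 1) (t : ℝ) {ω : ℂ} (hω : ‖ω‖ = 1) :
    ‖σ 0 ^ 2 - t * ω * (σ 0 * σ 1) - ω ^ 2 * σ 1 ^ 2‖ ^ 2 = (4 + t ^ 2) / 4 -
      (t / 2 * blochVector σ 2 + (blochVector σ 0 * ω.re - blochVector σ 1 * ω.im)) ^ 2 := by
  have h1 := norm_sq_qubit σ
  have h2 : ‖ω * σ 1‖ ^ 2 = ‖σ 1‖ ^ 2 := by rw [norm_mul, hω, one_mul]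
  have h3 : blochVector σ 0 * ω.re - blochVector σ 1 * ω.im =
      2 * (starRingEnd ℂ (σ 0) * (ω * σ 1)).re := by
    simp [blochVector_apply_zero, blochVector_apply_one]; ring
  rw [hσ, ← h2] at h1
  rw [h3, blochVector_apply_two, ← h2]
  have h4 : σ 0 ^ 2 - t * ω * (σ 0 * σ 1) - ω ^ 2 * σ 1 ^ 2 =
      σ 0 ^ 2 - t * (σ 0 * (ω * σ 1)) - (ω * σ 1) ^ 2 := by ring
  rw [h4]
  generalize ω * σ 1 = b at *
  generalize σ 0 = a at *
  simp only [← Complex.normSq_eq_norm_sq, Complex.normSq_apply] at *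
  simp [pow_two] at *
  linear_combination (-(4 + t ^ 2) / 4) *
    (1 + (a.re * a.re + a.im * a.im + (b.re * b.re + b.im * b.im))) * h1

theorem norm_sq_mul_eq {σ : Qubit} (hσ : ‖σ‖ = 1) :
    ‖σ 0 * σ 1‖ ^ 2 = (1 - blochVector σ 2 ^ 2) / 4 := by
  have h1 := norm_sq_qubit σ
  rw [hσ] at h1
  rw [blochVector_apply_two, norm_mul, mul_pow]
  have : ‖σ 1‖ ^ 2 = 1 - ‖σ 0‖ ^ 2 := by linarith
  rw [this]; ring

/-- The primitive fifth root of unity in the first quadrant. -/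
noncomputable def ζ₁ : ℂ := ⟨(goldenRatio - 1) / 2, √(goldenRatio + 2) / 2⟩

/-- The primitive fifth root of unity in the second quadrant. -/
noncomputable def ζ₂ : ℂ := ⟨-goldenRatio / 2, √(goldenRatio + 2) * (goldenRatio - 1) / 2⟩

theorem sq_sqrt_golden : √(goldenRatio + 2) ^ 2 = goldenRatio + 2 :=
  Real.sq_sqrt (by have := goldenRatio_pos; linarith)

theorem sqrt_golden_pos : 0 < √(goldenRatio + 2) :=
  Real.sqrt_pos.2 (by have := goldenRatio_pos; linarith)

theorem normSq_ζ₁ : Complex.normSq ζ₁ = 1 := by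
  rw [ζ₁, Complex.normSq_mk]
  have h1 := sq_sqrt_golden
  have h2 := goldenRatio_sq
  generalize √(goldenRatio + 2) = N at *
  generalize goldenRatio = φ at *
  linear_combination (1 / 4) * h1 + (1 / 4) * h2

theorem normSq_ζ₂ : Complex.normSq ζ₂ = 1 := by
  rw [ζ₂, Complex.normSq_mk]
  have h1 := sq_sqrt_golden
  have h2 := goldenRatio_sq
  generalize √(goldenRatio + 2) = N at *
  generalize goldenRatio = φ at *
  linear_combination (φ - 1) ^ 2 / 4 * h1 + (φ + 2) / 4 * h2

theorem norm_ζ₁ : ‖ζ₁‖ = 1 := by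
  rw [← sq_eq_sq₀ (norm_nonneg _) zero_le_one, ← Complex.normSq_eq_norm_sq, normSq_ζ₁, one_pow]

theorem norm_ζ₂ : ‖ζ₂‖ = 1 := by
  rw [← sq_eq_sq₀ (norm_nonneg _) zero_le_one, ← Complex.normSq_eq_norm_sq, normSq_ζ₂, one_pow]

theorem ζ₁_add_conj : ζ₁ + starRingEnd ℂ ζ₁ = (goldenRatio : ℂ) - 1 := by
  rw [Complex.add_conj, ζ₁]; push_cast; ring

theorem ζ₂_add_conj : ζ₂ + starRingEnd ℂ ζ₂ = -(goldenRatio : ℂ) := by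
  rw [Complex.add_conj, ζ₂]; push_cast; ring

theorem ζ₁_mul_conj : ζ₁ * starRingEnd ℂ ζ₁ = 1 := by
  rw [Complex.mul_conj, normSq_ζ₁]; simp

theorem ζ₂_mul_conj : ζ₂ * starRingEnd ℂ ζ₂ = 1 := by
  rw [Complex.mul_conj, normSq_ζ₂]; simp

theorem goldenRatio_sq_complex : (goldenRatio : ℂ) ^ 2 = goldenRatio + 1 := by
  exact_mod_cast congrArg (fun x : ℝ => (x : ℂ)) goldenRatio_sq

theorem prod_sub_fifth_roots (u v : ℂ) :
    (u - v) * ((u - ζ₁ * v) * (u - starRingEnd ℂ ζ₁ * v)) *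
      ((u - ζ₂ * v) * (u - starRingEnd ℂ ζ₂ * v)) = u ^ 5 - v ^ 5 := by
  have h1 : (u - ζ₁ * v) * (u - starRingEnd ℂ ζ₁ * v) =
      u ^ 2 - ((goldenRatio : ℂ) - 1) * u * v + v ^ 2 := by
    linear_combination (-u * v) * ζ₁_add_conj + v ^ 2 * ζ₁_mul_conj
  have h2 : (u - ζ₂ * v) * (u - starRingEnd ℂ ζ₂ * v) =
      u ^ 2 + (goldenRatio : ℂ) * u * v + v ^ 2 := by
    linear_combination (-u * v) * ζ₂_add_conj + v ^ 2 * ζ₂_mul_conj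
  rw [h1, h2]
  linear_combination (-u ^ 2 * v ^ 2 * (u - v)) * goldenRatio_sq_complex

theorem exists_sub_inv_eq (t : ℝ) : ∃ κ κ' : ℂ, κ * κ' = 1 ∧ κ - κ' = t := by
  have h : √(t ^ 2 + 4) ^ 2 = t ^ 2 + 4 := Real.sq_sqrt (by positivity)
  have h' : (√(t ^ 2 + 4) : ℂ) ^ 2 = t ^ 2 + 4 := by exact_mod_cast h
  exact ⟨((√(t ^ 2 + 4) : ℂ) + t) / 2, ((√(t ^ 2 + 4) : ℂ) - t) / 2,
    by linear_combination h' / 4, by ring⟩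

theorem degree_ten_form_eq_prod (a b : ℂ) (t : ℝ) :
    a ^ 10 - (t ^ 5 + 5 * t ^ 3 + 5 * t) * (a ^ 5 * b ^ 5) - b ^ 10 =
      (a ^ 2 - t * 1 * (a * b) - 1 ^ 2 * b ^ 2) *
      ((a ^ 2 - t * ζ₁ * (a * b) - ζ₁ ^ 2 * b ^ 2) *
        (a ^ 2 - t * starRingEnd ℂ ζ₁ * (a * b) - starRingEnd ℂ ζ₁ ^ 2 * b ^ 2)) *
      ((a ^ 2 - t * ζ₂ * (a * b) - ζ₂ ^ 2 * b ^ 2) *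
        (a ^ 2 - t * starRingEnd ℂ ζ₂ * (a * b) - starRingEnd ℂ ζ₂ ^ 2 * b ^ 2)) := by
  obtain ⟨κ, κ', h1, h2⟩ := exists_sub_inv_eq t
  have h : ∀ ω : ℂ, a ^ 2 - t * ω * (a * b) - ω ^ 2 * b ^ 2 =
      (a - ω * (κ * b)) * (a - ω * (-κ' * b)) := fun ω => by
    linear_combination (ω * a * b) * h2 + (ω ^ 2 * b ^ 2) * h1
  have h3 := prod_sub_fifth_roots a (κ * b)
  have h4 := prod_sub_fifth_roots a (-κ' * b)
  have h5 : (t : ℂ) ^ 5 + 5 * t ^ 3 + 5 * t = κ ^ 5 - κ' ^ 5 := by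
    have h6 : κ ^ 5 - κ' ^ 5 = (κ - κ') ^ 5 + 5 * (κ * κ') * (κ - κ') ^ 3 +
      5 * (κ * κ') ^ 2 * (κ - κ') := by ring
    rw [h6, h1, h2]; ring
  have h7 : (κ * κ') ^ 5 = 1 := by rw [h1, one_pow]
  rw [h, h, h, h, h, h5]
  calc _ = (a ^ 5 - (κ * b) ^ 5) * (a ^ 5 - (-κ' * b) ^ 5) := by
        linear_combination b ^ 10 * h7
    _ = _ := by rw [← h3, ← h4]; ring

theorem norm_sq_degree_ten_form {σ : Qubit} (hσ : ‖σ‖ = 1) (t : ℝ) {X Y Z φ N : ℝ}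
    (hX : blochVector σ 0 = X) (hY : blochVector σ 1 = Y) (hZ : blochVector σ 2 = Z)
    (hφ : φ = goldenRatio) (hN : N = √(goldenRatio + 2)) :
    ‖σ 0 ^ 10 - (t ^ 5 + 5 * t ^ 3 + 5 * t) * (σ 0 ^ 5 * σ 1 ^ 5) - σ 1 ^ 10‖ ^ 2 =
      ((4 + t ^ 2) / 4 - (t / 2 * Z + X) ^ 2) *
      (((4 + t ^ 2) / 4 - (t / 2 * Z + (X * ((φ - 1) / 2) - Y * (N / 2))) ^ 2) *
        ((4 + t ^ 2) / 4 - (t / 2 * Z + (X * ((φ - 1) / 2) + Y * (N / 2))) ^ 2)) *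
      (((4 + t ^ 2) / 4 - (t / 2 * Z + (-X * (φ / 2) - Y * (N * (φ - 1) / 2))) ^ 2) *
        ((4 + t ^ 2) / 4 - (t / 2 * Z + (-X * (φ / 2) + Y * (N * (φ - 1) / 2))) ^ 2)) := by
  have n1 : ‖starRingEnd ℂ ζ₁‖ = 1 := by rw [RCLike.norm_conj, norm_ζ₁]
  have n2 : ‖starRingEnd ℂ ζ₂‖ = 1 := by rw [RCLike.norm_conj, norm_ζ₂]
  rw [degree_ten_form_eq_prod]
  simp only [norm_mul, mul_pow]
  rw [norm_sq_quadratic_form hσ t norm_one, norm_sq_quadratic_form hσ t norm_ζ₁,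
    norm_sq_quadratic_form hσ t n1, norm_sq_quadratic_form hσ t norm_ζ₂,
    norm_sq_quadratic_form hσ t n2, hX, hY, hZ]
  rw [← hφ] at hN
  simp only [Complex.conj_re, Complex.conj_im, ζ₁, ζ₂, Complex.one_re, Complex.one_im, ← hφ, ← hN]
  congr 2 <;> ring

/-! ### Vertices of the Platonic solids -/

/-- The vertices `(0, ±1, ±φ)`, cyclically permuted, of an icosahedron. -/
noncomputable def icosaVec (k : Fin 3 × Bool × Bool) : Space :=
  cycVec k.1 0 (sgn k.2.1) (sgn k.2.2 * goldenRatio)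

/-- The vertices `(±1, ±1, ±1)` of a cube. -/
noncomputable def cubeVec (k : Bool × Bool × Bool) : Space :=
  cycVec 0 (sgn k.1) (sgn k.2.1) (sgn k.2.2)

/-- The vertices `(±1, ±1, ±1)` and `(0, ±φ, ±φ⁻¹)`, the latter cyclically permuted, of a
dodecahedron. -/
noncomputable def dodecaVec : (Bool × Bool × Bool) ⊕ (Fin 3 × Bool × Bool) → Space :=
  Sum.elim cubeVec fun k =>
    cycVec k.1 0 (sgn k.2.1 * goldenRatio) (sgn k.2.2 * (goldenRatio - 1))

/-- The vertices `(0, 0, ±1)`, cyclically permuted, of an octahedron. -/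
noncomputable def octaVec (k : Fin 3 × Bool) : Space := cycVec k.1 0 0 (sgn k.2)

/-- The vertices `(1, 1, 1)`, `(1, -1, -1)`, `(-1, 1, -1)`, `(-1, -1, 1)` of a tetrahedron. -/
noncomputable def tetraVec (k : Bool × Bool) : Space :=
  cycVec 0 (sgn k.1) (sgn k.2) (sgn k.1 * sgn k.2)

theorem prod_sgn_two (s u v : ℝ) : ∏ k : Bool × Bool, (1 + s * (u * sgn k.1 + v * sgn k.2)) =
    (1 - (s * (u + v)) ^ 2) * (1 - (s * (u - v)) ^ 2) := by
  simp [Fintype.prod_prod_type]; ring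

theorem prod_sgn_three (s x y z : ℝ) :
    ∏ k : Bool × Bool × Bool, (1 + s * (x * sgn k.1 + y * sgn k.2.1 + z * sgn k.2.2)) =
      (1 - (s * (x + y + z)) ^ 2) * (1 - (s * (-x + y + z)) ^ 2) *
        ((1 - (s * (x - y + z)) ^ 2) * (1 - (s * (x + y - z)) ^ 2)) := by
  simp only [Fintype.prod_prod_type, Fintype.prod_bool, sgn_true, sgn_false]
  have h : ∀ a b c d e f g i : ℝ, a * b * (c * d) * (e * f * (g * i)) =
    (a * i) * (d * e) * ((c * f) * (b * g)) := by intros; ring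
  rw [h]
  congr 2 <;> ring

theorem prod_icosaVec (s : ℝ) (q : Space) : ∏ k, (1 + s * inner ℝ q (icosaVec k)) =
    ((1 - (s * (q 1 + q 2 * goldenRatio)) ^ 2) * (1 - (s * (q 1 - q 2 * goldenRatio)) ^ 2)) *
    ((1 - (s * (q 2 + q 0 * goldenRatio)) ^ 2) * (1 - (s * (q 2 - q 0 * goldenRatio)) ^ 2)) *
    ((1 - (s * (q 0 + q 1 * goldenRatio)) ^ 2) * (1 - (s * (q 0 - q 1 * goldenRatio)) ^ 2)) := by
  have h : ∀ k, inner ℝ q (icosaVec k) = q (k.1 + 1) * sgn k.2.1 +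
      (q (k.1 + 2) * goldenRatio) * sgn k.2.2 := fun k => by
    rw [icosaVec, inner_cycVec]; ring
  simp only [h]
  rw [Fintype.prod_prod_type, Fin.prod_univ_three]
  simp only [prod_sgn_two]
  rfl

theorem prod_cubeVec (s : ℝ) (q : Space) : ∏ k, (1 + s * inner ℝ q (cubeVec k)) =
    (1 - (s * (q 0 + q 1 + q 2)) ^ 2) * (1 - (s * (-q 0 + q 1 + q 2)) ^ 2) *
      ((1 - (s * (q 0 - q 1 + q 2)) ^ 2) * (1 - (s * (q 0 + q 1 - q 2)) ^ 2)) := by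
  simp only [cubeVec, inner_cycVec]
  exact prod_sgn_three s (q 0) (q 1) (q 2)

theorem prod_dodecaVec (s : ℝ) (q : Space) : ∏ k, (1 + s * inner ℝ q (dodecaVec k)) =
    ((1 - (s * (q 0 + q 1 + q 2)) ^ 2) * (1 - (s * (-q 0 + q 1 + q 2)) ^ 2) *
      ((1 - (s * (q 0 - q 1 + q 2)) ^ 2) * (1 - (s * (q 0 + q 1 - q 2)) ^ 2))) *
    (((1 - (s * (q 1 * goldenRatio + q 2 * (goldenRatio - 1))) ^ 2) *
      (1 - (s * (q 1 * goldenRatio - q 2 * (goldenRatio - 1))) ^ 2)) *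
    ((1 - (s * (q 2 * goldenRatio + q 0 * (goldenRatio - 1))) ^ 2) *
      (1 - (s * (q 2 * goldenRatio - q 0 * (goldenRatio - 1))) ^ 2)) *
    ((1 - (s * (q 0 * goldenRatio + q 1 * (goldenRatio - 1))) ^ 2) *
      (1 - (s * (q 0 * goldenRatio - q 1 * (goldenRatio - 1))) ^ 2))) := by
  rw [Fintype.prod_sum_type]
  simp only [dodecaVec, Sum.elim_inl, Sum.elim_inr]
  rw [prod_cubeVec]
  congr 1
  have h : ∀ k : Fin 3 × Bool × Bool, inner ℝ q
      (cycVec k.1 0 (sgn k.2.1 * goldenRatio) (sgn k.2.2 * (goldenRatio - 1))) =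
      (q (k.1 + 1) * goldenRatio) * sgn k.2.1 + (q (k.1 + 2) * (goldenRatio - 1)) * sgn k.2.2 :=
    fun k => by rw [inner_cycVec]; ring
  simp only [h]
  rw [Fintype.prod_prod_type, Fin.prod_univ_three]
  simp only [prod_sgn_two]
  rfl

theorem prod_octaVec (q : Space) : ∏ k, (1 + 1 * inner ℝ q (octaVec k)) =
    (1 - q 2 ^ 2) * (1 - q 0 ^ 2) * (1 - q 1 ^ 2) := by
  simp only [octaVec, inner_cycVec, Fintype.prod_prod_type, Fin.prod_univ_three, Fintype.prod_bool,
    sgn_true, sgn_false]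
  simp only [show (1 : Fin 3) + 2 = 0 from rfl, show (2 : Fin 3) + 2 = 1 from rfl,
    show (0 : Fin 3) + 2 = 2 from rfl]
  congr 2 <;> ring

theorem prod_tetraVec (s : ℝ) (q : Space) : ∏ k, (1 + s * inner ℝ q (tetraVec k)) =
    (1 + s * (q 0 + q 1 + q 2)) * (1 + s * (q 0 - q 1 - q 2)) *
      ((1 + s * (-q 0 + q 1 - q 2)) * (1 + s * (-q 0 - q 1 + q 2))) := by
  simp only [tetraVec, inner_cycVec, Fintype.prod_prod_type, Fintype.prod_bool,
    sgn_true, sgn_false]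
  simp only [show (0 : Fin 3) + 2 = 2 from rfl, show (0 : Fin 3) + 1 = 1 from rfl]
  congr 2 <;> congr 1 <;> ring

/-! ### Frames -/

/-- The rows of the rotation by `π / 4` about the third axis, combined with a reflection. -/
noncomputable def octaRows : Fin 3 → Space :=
  ![!₂[1 / √2, 1 / √2, 0], !₂[1 / √2, -1 / √2, 0], !₂[0, 0, 1]]

/-- The rows of a rotation that takes `(0, 1, φ)` to the third axis. -/
noncomputable def icosaRows : Fin 3 → Space :=
  ![!₂[0, -goldenRatio / √(goldenRatio + 2), 1 / √(goldenRatio + 2)], !₂[1, 0, 0],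
    !₂[0, 1 / √(goldenRatio + 2), goldenRatio / √(goldenRatio + 2)]]

/-- The rows of a rotation that takes `(1, 1, 1)` to the third axis. -/
noncomputable def tetraRows : Fin 3 → Space :=
  ![!₂[2 / (√2 * √3), -1 / (√2 * √3), -1 / (√2 * √3)], !₂[0, 1 / √2, -1 / √2],
    !₂[1 / √3, 1 / √3, 1 / √3]]

theorem orthonormal_octaRows : Orthonormal ℝ octaRows := by
  have h2 : √2 ^ 2 = 2 := Real.sq_sqrt (by norm_num)
  apply orthonormal_triple <;> simp only [octaRows, inner_space] <;> simp <;> field_simp <;>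
    norm_num [h2]

theorem orthonormal_icosaRows : Orthonormal ℝ icosaRows := by
  have h1 := sq_sqrt_golden
  have h2 := goldenRatio_sq
  have h3 := sqrt_golden_pos
  apply orthonormal_triple <;> simp only [icosaRows, inner_space] <;>
    generalize √(goldenRatio + 2) = N at * <;> generalize goldenRatio = φ at * <;> simp <;>
    field_simp <;> linarith

theorem orthonormal_tetraRows : Orthonormal ℝ tetraRows := by
  have h2 : √2 ^ 2 = 2 := Real.sq_sqrt (by norm_num)
  have h3 : √3 ^ 2 = 3 := Real.sq_sqrt (by norm_num)
  apply orthonormal_triple <;> simp only [tetraRows, inner_space] <;> simp <;> field_simp <;>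
    norm_num [h2, h3]

/-- The frame of the octahedron and cube states. -/
noncomputable def octaFrame : Space ≃ₗᵢ[ℝ] Space := frame octaRows orthonormal_octaRows

/-- The frame of the icosahedron and dodecahedron states. -/
noncomputable def icosaFrame : Space ≃ₗᵢ[ℝ] Space := frame icosaRows orthonormal_icosaRows

/-- The frame of the tetrahedron state. -/
noncomputable def tetraFrame : Space ≃ₗᵢ[ℝ] Space := frame tetraRows orthonormal_tetraRows

/-! ### Overlaps of the Platonic states -/

theorem sqrt_mul_sqrt_eq {a b c d m : ℝ} (ha : 0 ≤ a) (hm : 0 ≤ m) (hc : 0 ≤ c)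
    (h : a * b = m ^ 2 * (c * d)) : √a * √b = m * (√c * √d) := by
  rw [← Real.sqrt_mul ha, ← Real.sqrt_mul hc, h, Real.sqrt_mul (sq_nonneg m), Real.sqrt_sq hm]

theorem norm_sq_ofReal_mul (r : ℝ) (z : ℂ) : ‖(r : ℂ) * z‖ ^ 2 = r ^ 2 * ‖z‖ ^ 2 := by
  rw [norm_mul, mul_pow, Complex.norm_real, Real.norm_eq_abs, sq_abs]

theorem amplitude_icosahedronState (σ : Qubit) : amplitude icosahedronState σ =
    ((√7 * √12 : ℝ) : ℂ) * ((σ 0 * σ 1) *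
      (σ 0 ^ 10 - (((1 : ℝ) : ℂ) ^ 5 + 5 * ((1 : ℝ) : ℂ) ^ 3 + 5 * ((1 : ℝ) : ℂ)) *
        (σ 0 ^ 5 * σ 1 ^ 5) - σ 1 ^ 10)) := by
  have h : √11 * √924 = 11 * (√7 * √12) := by apply sqrt_mul_sqrt_eq <;> norm_num
  have h' : (√11 : ℂ) * (√924 : ℂ) = 11 * ((√7 : ℂ) * (√12 : ℂ)) := by exact_mod_cast h
  rw [icosahedronState, amplitude_sub, amplitude_sub, amplitude_smul, amplitude_smul,
    amplitude_smul, amplitude_dicke, amplitude_dicke, amplitude_dicke,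
    show Nat.choose 12 1 = 12 from rfl, show Nat.choose 12 6 = 924 from rfl,
    show Nat.choose 12 11 = 12 from rfl]
  push_cast
  linear_combination (-(σ 0 ^ 6 * σ 1 ^ 6)) * h'

theorem amplitude_dodecahedronState (σ : Qubit) : amplitude dodecahedronState σ =
    ((√187 : ℝ) : ℂ) *
      ((σ 0 ^ 10 - (((-(goldenRatio + 1) : ℝ) : ℂ) ^ 5 + 5 * ((-(goldenRatio + 1) : ℝ) : ℂ) ^ 3 +
        5 * ((-(goldenRatio + 1) : ℝ) : ℂ)) * (σ 0 ^ 5 * σ 1 ^ 5) - σ 1 ^ 10) *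
      (σ 0 ^ 10 - (((goldenRatio - 2 : ℝ) : ℂ) ^ 5 + 5 * ((goldenRatio - 2 : ℝ) : ℂ) ^ 3 +
        5 * ((goldenRatio - 2 : ℝ) : ℂ)) * (σ 0 ^ 5 * σ 1 ^ 5) - σ 1 ^ 10)) := by
  have h1 : √627 * √15504 = 228 * (√187 * √1) := by apply sqrt_mul_sqrt_eq <;> norm_num
  have h2 : √247 * √184756 = 494 * (√187 * √1) := by apply sqrt_mul_sqrt_eq <;> norm_num
  rw [Real.sqrt_one, mul_one] at h1 h2
  have h1' : (√627 : ℂ) * (√15504 : ℂ) = 228 * (√187 : ℂ) := by exact_mod_cast h1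
  have h2' : (√247 : ℂ) * (√184756 : ℂ) = 494 * (√187 : ℂ) := by exact_mod_cast h2
  rw [dodecahedronState, amplitude_add, amplitude_sub, amplitude_add, amplitude_add]
  simp only [amplitude_smul, amplitude_dicke]
  rw [show Nat.choose 20 0 = 1 from rfl, show Nat.choose 20 5 = 15504 from rfl,
    show Nat.choose 20 10 = 184756 from rfl, show Nat.choose 20 15 = 15504 from rfl,
    show Nat.choose 20 20 = 1 from rfl]
  have hg := goldenRatio_sq_complex
  generalize goldenRatio = g at *
  push_cast
  rw [Real.sqrt_one]
  push_cast
  generalize (g : ℂ) = φ at *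
  have e1 : (-(φ + 1)) ^ 5 + 5 * (-(φ + 1)) ^ 3 + 5 * (-(φ + 1)) = -100 * φ - 64 := by
    have h3 : φ ^ 3 = 2 * φ + 1 := by linear_combination (φ + 1) * hg
    have h4 : φ ^ 4 = 3 * φ + 2 := by linear_combination φ * h3 + 2 * hg
    have h5 : φ ^ 5 = 5 * φ + 3 := by linear_combination φ * h4 + 3 * hg
    linear_combination -h5 - 5 * h4 - 15 * h3 - 25 * hg
  have e2 : (φ - 2) ^ 5 + 5 * (φ - 2) ^ 3 + 5 * (φ - 2) = 100 * φ - 164 := by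
    have h3 : φ ^ 3 = 2 * φ + 1 := by linear_combination (φ + 1) * hg
    have h4 : φ ^ 4 = 3 * φ + 2 := by linear_combination φ * h3 + 2 * hg
    have h5 : φ ^ 5 = 5 * φ + 3 := by linear_combination φ * h4 + 3 * hg
    linear_combination h5 - 10 * h4 + 45 * h3 - 110 * hg
  rw [e1, e2]
  linear_combination (σ 0 ^ 15 * σ 1 ^ 5 - σ 0 ^ 5 * σ 1 ^ 15) * h1' +
    (σ 0 ^ 10 * σ 1 ^ 10) * h2' + (√187 : ℂ) * 10000 * σ 0 ^ 10 * σ 1 ^ 10 * hg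

theorem amplitude_octahedronState (σ : Qubit) : amplitude octahedronState σ =
    ((√3 : ℝ) : ℂ) * ((σ 0 * σ 1) * (σ 0 ^ 4 + σ 1 ^ 4)) := by
  have h : √6 = √2 * √3 := by rw [← Real.sqrt_mul (by norm_num)]; norm_num
  have h2 : (√2 : ℂ) ≠ 0 := by
    exact_mod_cast (Real.sqrt_pos.2 (by norm_num : (0 : ℝ) < 2)).ne'
  rw [octahedronState, amplitude_smul, amplitude_add, amplitude_dicke, amplitude_dicke,
    show Nat.choose 6 1 = 6 from rfl, show Nat.choose 6 5 = 6 from rfl]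
  push_cast
  rw [h]
  push_cast
  field_simp

theorem amplitude_cubeState (σ : Qubit) : amplitude cubeState σ =
    ((√5 : ℝ) : ℂ) * (σ 0 ^ 8 - 14 * (σ 0 ^ 4 * σ 1 ^ 4) + σ 1 ^ 8) := by
  have h : √14 * √70 = 14 * (√5 * √1) := by apply sqrt_mul_sqrt_eq <;> norm_num
  rw [Real.sqrt_one, mul_one] at h
  have h' : (√14 : ℂ) * (√70 : ℂ) = 14 * (√5 : ℂ) := by exact_mod_cast h
  rw [cubeState, amplitude_add, amplitude_sub]
  simp only [amplitude_smul, amplitude_dicke]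
  rw [show Nat.choose 8 0 = 1 from rfl, show Nat.choose 8 4 = 70 from rfl,
    show Nat.choose 8 8 = 1 from rfl]
  push_cast
  rw [Real.sqrt_one]
  push_cast
  linear_combination (-(σ 0 ^ 4 * σ 1 ^ 4)) * h'

theorem amplitude_tetrahedronState (σ : Qubit) : amplitude tetrahedronState σ =
    ((1 / √3 : ℝ) : ℂ) * (σ 0 * (σ 0 ^ 3 + ((√2 : ℝ) * σ 1) ^ 3)) := by
  have h : √(2 / 3) * √4 = 1 / √3 * (√2) ^ 3 := by
    have h2 : √2 ^ 2 = 2 := Real.sq_sqrt (by norm_num)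
    have h4 : √4 = 2 := by rw [show (4 : ℝ) = 2 ^ 2 by norm_num]; exact Real.sqrt_sq (by norm_num)
    rw [Real.sqrt_div (by norm_num), h4, pow_succ, h2]
    ring
  have h' : (√(2 / 3) : ℂ) * (√4 : ℂ) = ((1 / √3 : ℝ) : ℂ) * (√2 : ℂ) ^ 3 := by exact_mod_cast h
  rw [tetrahedronState, amplitude_add]
  simp only [amplitude_smul, amplitude_dicke]
  rw [show Nat.choose 4 0 = 1 from rfl, show Nat.choose 4 3 = 4 from rfl]
  push_cast at h' ⊢
  rw [Real.sqrt_one]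
  push_cast
  linear_combination (σ 0 * σ 1 ^ 3) * h'

theorem octaFrame_apply (q : Space) : octaFrame q 0 = (q 0 + q 1) / √2 ∧
    octaFrame q 1 = (q 0 - q 1) / √2 ∧ octaFrame q 2 = q 2 := by
  simp only [octaFrame, frame_apply, inner_space, octaRows]
  simp
  constructor <;> ring

theorem icosaFrame_apply (q : Space) :
    icosaFrame q 0 = (q 2 - goldenRatio * q 1) / √(goldenRatio + 2) ∧ icosaFrame q 1 = q 0 ∧
    icosaFrame q 2 = (q 1 + goldenRatio * q 2) / √(goldenRatio + 2) := by
  simp only [icosaFrame, frame_apply, inner_space, icosaRows]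
  generalize √(goldenRatio + 2) = N
  generalize goldenRatio = φ
  simp
  constructor <;> ring

theorem tetraFrame_apply (q : Space) :
    tetraFrame q 0 = (2 * q 0 - q 1 - q 2) / (√2 * √3) ∧ tetraFrame q 1 = (q 1 - q 2) / √2 ∧
    tetraFrame q 2 = (q 0 + q 1 + q 2) / √3 := by
  simp only [tetraFrame, frame_apply, inner_space, tetraRows]
  simp
  refine ⟨?_, ?_, ?_⟩ <;> ring

theorem norm_sq_amplitude_octahedronState {σ : Qubit} (hσ : ‖σ‖ = 1) {q : Space}
    (hq : blochVector σ = octaFrame q) :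
    ‖amplitude octahedronState σ‖ ^ 2 = 3 / 4 * ∏ k, (1 + 1 * inner ℝ q (octaVec k)) := by
  obtain ⟨hX, hY, hZ⟩ := octaFrame_apply q
  rw [← hq] at hX hY hZ
  have h2 : √2 ^ 2 = 2 := Real.sq_sqrt (by norm_num)
  have h2' : √2 ≠ 0 := by positivity
  set ω : ℂ := ⟨1 / √2, 1 / √2⟩ with hω
  have hn : ‖ω‖ = 1 := by
    rw [← sq_eq_sq₀ (norm_nonneg _) zero_le_one, ← Complex.normSq_eq_norm_sq, hω,
      Complex.normSq_mk]
    field_simp; norm_num [h2]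
  have hn' : ‖starRingEnd ℂ ω‖ = 1 := by rw [RCLike.norm_conj, hn]
  have hsq : ω ^ 2 = Complex.I := by
    apply Complex.ext
    · simp [pow_two, hω]
    · simp [pow_two, hω]; field_simp; norm_num [h2]
  have hsq' : (starRingEnd ℂ ω) ^ 2 = -Complex.I := by
    rw [← map_pow, hsq, Complex.conj_I]
  have hfac : σ 0 ^ 4 + σ 1 ^ 4 = (σ 0 ^ 2 - (0 : ℝ) * ω * (σ 0 * σ 1) - ω ^ 2 * σ 1 ^ 2) *
      (σ 0 ^ 2 - (0 : ℝ) * starRingEnd ℂ ω * (σ 0 * σ 1) - (starRingEnd ℂ ω) ^ 2 * σ 1 ^ 2) := by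
    rw [hsq, hsq']
    push_cast
    linear_combination (σ 1 ^ 4) * Complex.I_sq
  rw [amplitude_octahedronState, norm_sq_ofReal_mul, hfac, norm_mul (σ 0 * σ 1), mul_pow,
    norm_mul (_ - _), mul_pow, norm_sq_mul_eq hσ, norm_sq_quadratic_form hσ _ hn, norm_sq_quadratic_form hσ _ hn',
    prod_octaVec, hX, hY, hZ, Real.sq_sqrt (by norm_num)]
  simp only [Complex.conj_re, Complex.conj_im, hω]
  have e1 : (q 0 + q 1) / √2 * (1 / √2) - (q 0 - q 1) / √2 * (1 / √2) = q 1 := by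
    field_simp; rw [h2]; ring
  have e2 : (q 0 + q 1) / √2 * (1 / √2) - (q 0 - q 1) / √2 * -(1 / √2) = q 0 := by
    field_simp; rw [h2]; ring
  rw [e1, e2]
  ring

theorem norm_sq_amplitude_cubeState {σ : Qubit} (hσ : ‖σ‖ = 1) {q : Space}
    (hq : blochVector σ = octaFrame q) :
    ‖amplitude cubeState σ‖ ^ 2 = 405 / 16 * ∏ k, (1 + 1 / √3 * inner ℝ q (cubeVec k)) := by
  obtain ⟨hX, hY, hZ⟩ := octaFrame_apply q
  rw [← hq] at hX hY hZ
  have h2 : √2 ^ 2 = 2 := Real.sq_sqrt (by norm_num)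
  have h2c : (√2 : ℂ) ^ 2 = 2 := by exact_mod_cast h2
  have h3 : √3 ^ 2 = 3 := Real.sq_sqrt (by norm_num)
  have hfac : σ 0 ^ 8 - 14 * (σ 0 ^ 4 * σ 1 ^ 4) + σ 1 ^ 8 =
      ((σ 0 ^ 2 - (√2 : ℝ) * 1 * (σ 0 * σ 1) - 1 ^ 2 * σ 1 ^ 2) *
      (σ 0 ^ 2 - (√2 : ℝ) * (-1) * (σ 0 * σ 1) - (-1) ^ 2 * σ 1 ^ 2)) *
      ((σ 0 ^ 2 - (√2 : ℝ) * Complex.I * (σ 0 * σ 1) - Complex.I ^ 2 * σ 1 ^ 2) *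
      (σ 0 ^ 2 - (√2 : ℝ) * (-Complex.I) * (σ 0 * σ 1) - (-Complex.I) ^ 2 * σ 1 ^ 2)) := by
    have e1 : (σ 0 ^ 2 - (√2 : ℝ) * 1 * (σ 0 * σ 1) - 1 ^ 2 * σ 1 ^ 2) *
      (σ 0 ^ 2 - (√2 : ℝ) * (-1) * (σ 0 * σ 1) - (-1) ^ 2 * σ 1 ^ 2) =
        σ 0 ^ 4 - 4 * (σ 0 ^ 2 * σ 1 ^ 2) + σ 1 ^ 4 := by
      linear_combination (-(σ 0 * σ 1) ^ 2) * h2c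
    have e2 : (σ 0 ^ 2 - (√2 : ℝ) * Complex.I * (σ 0 * σ 1) - Complex.I ^ 2 * σ 1 ^ 2) *
      (σ 0 ^ 2 - (√2 : ℝ) * (-Complex.I) * (σ 0 * σ 1) - (-Complex.I) ^ 2 * σ 1 ^ 2) =
        σ 0 ^ 4 + 4 * (σ 0 ^ 2 * σ 1 ^ 2) + σ 1 ^ 4 := by
      rw [neg_sq, Complex.I_sq]
      linear_combination (σ 0 * σ 1) ^ 2 * h2c - (σ 0 * σ 1) ^ 2 * (√2 : ℂ) ^ 2 * Complex.I_sq
    rw [e1, e2]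
    ring
  have n2 : ‖(-1 : ℂ)‖ = 1 := by simp
  have n3 : ‖(-Complex.I : ℂ)‖ = 1 := by simp
  rw [amplitude_cubeState, norm_sq_ofReal_mul, hfac]
  simp only [norm_mul _ (_ * _ : ℂ), norm_mul (_ - _ : ℂ), mul_pow]
  rw [norm_sq_quadratic_form hσ _ norm_one, norm_sq_quadratic_form hσ _ n2,
    norm_sq_quadratic_form hσ _ Complex.norm_I, norm_sq_quadratic_form hσ _ n3,
    prod_cubeVec, hX, hY, hZ, Real.sq_sqrt (by norm_num)]
  simp only [Complex.I_re, Complex.I_im, Complex.one_re, Complex.one_im, Complex.neg_re,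
    Complex.neg_im]
  have e : ∀ u v : ℝ, v = u / √2 →
      (4 + √2 ^ 2) / 4 - v ^ 2 = 3 / 2 * (1 - (1 / √3 * u) ^ 2) := by
    rintro u v rfl
    rw [mul_pow, div_pow, div_pow, h2, h3]; ring
  have hh : √2 / 2 = 1 / √2 := by field_simp; exact h2
  rw [e (q 0 + q 1 + q 2) _ (by rw [hh]; ring), e (-q 0 - q 1 + q 2) _ (by rw [hh]; ring),
    e (-q 0 + q 1 + q 2) _ (by rw [hh]; ring), e (q 0 - q 1 + q 2) _ (by rw [hh]; ring)]
  ring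

theorem norm_sq_add_cube_eq (a b : ℂ) : ‖a ^ 3 + b ^ 3‖ ^ 2 =
    (‖a‖ ^ 2 + ‖b‖ ^ 2 + 2 * (starRingEnd ℂ a * b).re) *
      ((‖a‖ ^ 2 + ‖b‖ ^ 2 - (starRingEnd ℂ a * b).re) ^ 2 -
        3 * (starRingEnd ℂ a * b).im ^ 2) := by
  simp only [← Complex.normSq_eq_norm_sq, Complex.normSq_apply]
  simp [pow_succ]
  ring

theorem norm_sq_amplitude_tetrahedronState {σ : Qubit} (hσ : ‖σ‖ = 1) {q : Space}
    (hq : blochVector σ = tetraFrame q) :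
    ‖amplitude tetrahedronState σ‖ ^ 2 = 9 / 16 * ∏ k, (1 + 1 / √3 * inner ℝ q (tetraVec k)) := by
  obtain ⟨hX, hY, hZ⟩ := tetraFrame_apply q
  rw [← hq, blochVector_apply_zero] at hX
  rw [← hq, blochVector_apply_one] at hY
  rw [← hq, blochVector_apply_two] at hZ
  have h1 := norm_sq_qubit σ
  rw [hσ] at h1
  have h2 : √2 ^ 2 = 2 := Real.sq_sqrt (by norm_num)
  have h3 : √3 ^ 2 = 3 := Real.sq_sqrt (by norm_num)
  have h2' : √2 ≠ 0 := by positivity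
  have h3' : √3 ≠ 0 := by positivity
  have hA : ‖σ 0‖ ^ 2 = (1 + 1 / √3 * (q 0 + q 1 + q 2)) / 2 := by
    linear_combination (1 / 2) * hZ - (1 / 2) * h1
  have hB : ‖σ 1‖ ^ 2 = (1 - 1 / √3 * (q 0 + q 1 + q 2)) / 2 := by
    linear_combination (-1 / 2) * hZ - (1 / 2) * h1
  have hre : (starRingEnd ℂ (σ 0) * ((√2 : ℝ) * σ 1)).re = (2 * q 0 - q 1 - q 2) / (2 * √3) := by
    rw [mul_left_comm, Complex.re_ofReal_mul]
    have : (starRingEnd ℂ (σ 0) * σ 1).re = (2 * q 0 - q 1 - q 2) / (√2 * √3) / 2 := by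
      rw [← hX]; ring
    rw [this]; field_simp
  have him : (starRingEnd ℂ (σ 0) * ((√2 : ℝ) * σ 1)).im = (q 1 - q 2) / 2 := by
    rw [mul_left_comm, Complex.im_ofReal_mul]
    have : (starRingEnd ℂ (σ 0) * σ 1).im = (q 1 - q 2) / √2 / 2 := by
      rw [← hY]; ring
    rw [this]; field_simp
  rw [amplitude_tetrahedronState, norm_sq_ofReal_mul, norm_mul, mul_pow, norm_sq_add_cube_eq,
    hre, him, norm_sq_ofReal_mul, hA, hB, h2, div_pow, h3, prod_tetraVec]
  have e : 1 / √3 = √3 / 3 := by field_simp; exact h3.symm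
  have e' : ∀ u : ℝ, u / (2 * √3) = u / 2 * (1 / √3) := fun u => by field_simp
  rw [e', e]
  generalize √3 = w at *
  linear_combination ((1 + w / 3 * (q 0 + q 1 + q 2)) * (3 / 2 + w / 2 * (q 0 - q 1 - q 2)) *
    (q 1 - q 2) ^ 2 / 24) * h3

theorem norm_sq_amplitude_icosahedronState {σ : Qubit} (hσ : ‖σ‖ = 1) {q : Space}
    (hq : blochVector σ = icosaFrame q) :
    ‖amplitude icosahedronState σ‖ ^ 2 =
      21 * (5 / 4) ^ 5 * ∏ k, (1 + 1 / √(goldenRatio + 2) * inner ℝ q (icosaVec k)) := by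
  obtain ⟨hX, hY, hZ⟩ := icosaFrame_apply q
  rw [← hq] at hX hY hZ
  rw [amplitude_icosahedronState, norm_sq_ofReal_mul, mul_pow, norm_mul (σ 0 * σ 1), mul_pow, norm_sq_mul_eq hσ,
    norm_sq_degree_ten_form hσ 1 hX hY hZ rfl rfl, prod_icosaVec, hZ,
    Real.sq_sqrt (by norm_num), Real.sq_sqrt (by norm_num)]
  have hN := sq_sqrt_golden
  have hφ := goldenRatio_sq
  have hpos := sqrt_golden_pos
  generalize √(goldenRatio + 2) = N at *
  generalize goldenRatio = φ at *
  generalize q 0 = x at *; generalize q 1 = y at *; generalize q 2 = z at *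
  have e : ∀ u v : ℝ, 2 * (N * v) = (2 * φ - 1) * u →
      (4 + 1 ^ 2) / 4 - v ^ 2 = 5 / 4 * (1 - (1 / N * u) ^ 2) := by
    intro u v h
    have h5 : 4 * (N ^ 2 * v ^ 2) = 5 * u ^ 2 := by
      linear_combination (2 * (N * v) + (2 * φ - 1) * u) * h + 4 * u ^ 2 * hφ
    field_simp
    linear_combination -h5
  rw [e (-(y - z * φ)) _ (by field_simp; grind), e (z - x * φ) _ (by field_simp; grind),
    e (z + x * φ) _ (by field_simp; grind), e (-(x - y * φ)) _ (by field_simp; grind),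
    e (x + y * φ) _ (by field_simp; grind), show (y + φ * z) / N = 1 / N * (y + z * φ) by ring]
  simp only [mul_neg, neg_sq]
  have key : ∀ a b c d e f : ℝ, 7 * 12 * ((1 - a) / 4 * (5 / 4 * b * (5 / 4 * c * (5 / 4 * d)) *
      (5 / 4 * e * (5 / 4 * f)))) = 21 * (5 / 4) ^ 5 * ((1 - a) * b * (d * c) * (f * e)) := by
    intros; ring
  exact key _ _ _ _ _ _

theorem norm_sq_amplitude_dodecahedronState {σ : Qubit} (hσ : ‖σ‖ = 1) {q : Space}
    (hq : blochVector σ = icosaFrame q) :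
    ‖amplitude dodecahedronState σ‖ ^ 2 =
      187 * (45 / 16) ^ 5 * ∏ k, (1 + 1 / √3 * inner ℝ q (dodecaVec k)) := by
  obtain ⟨hX, hY, hZ⟩ := icosaFrame_apply q
  rw [← hq] at hX hY hZ
  rw [amplitude_dodecahedronState, norm_sq_ofReal_mul, norm_mul, mul_pow,
    norm_sq_degree_ten_form hσ _ hX hY hZ rfl rfl, norm_sq_degree_ten_form hσ _ hX hY hZ rfl rfl,
    prod_dodecaVec, Real.sq_sqrt (by norm_num)]
  have hN := sq_sqrt_golden
  have hφ := goldenRatio_sq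
  have hpos := sqrt_golden_pos
  have h3 : √3 ^ 2 = 3 := Real.sq_sqrt (by norm_num)
  have h3' : √3 ≠ 0 := by positivity
  generalize √(goldenRatio + 2) = N at *
  generalize goldenRatio = φ at *
  generalize q 0 = x at *; generalize q 1 = y at *; generalize q 2 = z at *
  have e1 : ∀ u v : ℝ, 2 * (N * v) = -(φ + 2) * u → (4 + (-(φ + 1)) ^ 2) / 4 - v ^ 2 =
      3 * (φ + 2) / 4 * (1 - (1 / √3 * u) ^ 2) := by
    intro u v h
    have h5 : 4 * (N ^ 2 * v ^ 2) = (φ + 2) ^ 2 * u ^ 2 := by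
      linear_combination (2 * (N * v) - (φ + 2) * u) * h
    rw [hN] at h5
    have h6 : 4 * v ^ 2 = (φ + 2) * u ^ 2 := by
      have : φ + 2 ≠ 0 := by rw [← hN]; positivity
      apply mul_left_cancel₀ this
      linear_combination h5
    rw [mul_pow, div_pow, h3]
    linear_combination (1 / 4) * hφ - (1 / 4) * h6
  have e2 : ∀ u v : ℝ, 2 * (N * v) = -(2 * φ - 1) * u → (4 + (φ - 2) ^ 2) / 4 - v ^ 2 =
      3 * (3 - φ) / 4 * (1 - (1 / √3 * u) ^ 2) := by
    intro u v h
    have h5 : 4 * (N ^ 2 * v ^ 2) = (2 * φ - 1) ^ 2 * u ^ 2 := by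
      linear_combination (2 * (N * v) - (2 * φ - 1) * u) * h
    rw [hN] at h5
    have h6 : 4 * v ^ 2 = (3 - φ) * u ^ 2 := by
      have : φ + 2 ≠ 0 := by rw [← hN]; positivity
      apply mul_left_cancel₀ this
      linear_combination h5 + 5 * u ^ 2 * hφ
    rw [mul_pow, div_pow, h3]
    linear_combination (1 / 4) * hφ - (1 / 4) * h6
  rw [e1 (y * φ + z * (φ - 1)) _ (by field_simp; grind),
    e1 (x + y + z) _ (by field_simp; grind), e1 (-x + y + z) _ (by field_simp; grind),
    e1 (z * φ + x * (φ - 1)) _ (by field_simp; grind),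
    e1 (z * φ - x * (φ - 1)) _ (by field_simp; grind),
    e2 (y * φ - z * (φ - 1)) _ (by field_simp; grind),
    e2 (x * φ + y * (φ - 1)) _ (by field_simp; grind),
    e2 (-(x * φ - y * (φ - 1))) _ (by field_simp; grind),
    e2 (x - y + z) _ (by field_simp; grind), e2 (-(x + y - z)) _ (by field_simp; grind)]
  simp only [mul_neg, neg_sq]
  have key : ∀ A B a b c d e a' b' c' d' e' : ℝ, A * B = 45 / 16 →
      187 * (A * a * (A * b * (A * c)) * (A * d * (A * e)) *
        (B * a' * (B * b' * (B * c')) * (B * d' * (B * e')))) =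
      187 * (45 / 16) ^ 5 * (b * c * (d' * e') * (a * a' * (d * e) * (b' * c'))) := by
    intro A B a b c d e a' b' c' d' e' h
    rw [← h]; ring
  exact key _ _ _ _ _ _ _ _ _ _ _ _ (by linear_combination (-9 / 16) * hφ)

/-! ### Products with prescribed power sums -/

/-- The cubic polynomial that touches the logarithm at `a` and `b` lies above it. -/
theorem exists_cubic_majorant {a b : ℝ} (hb : 0 < b) (hab : b < a) :
    ∃ c₀ c₁ c₂ c₃ : ℝ, 0 < c₃ ∧
      (∀ w, 0 < w → log w ≤ c₀ + c₁ * w + c₂ * w ^ 2 + c₃ * w ^ 3) ∧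
      log a = c₀ + c₁ * a + c₂ * a ^ 2 + c₃ * a ^ 3 ∧
      log b = c₀ + c₁ * b + c₂ * b ^ 2 + c₃ * b ^ 3 := by
  have ha : 0 < a := hb.trans hab
  have hd : a - b ≠ 0 := (sub_pos.2 hab).ne'
  set k := 6 * ((a ^ 2 - b ^ 2) / (2 * (a * b)) - (log a - log b)) / (a - b) ^ 3 with hk
  set G : ℝ → ℝ := fun w => log w - ((a + b) * w - w ^ 2 / 2) / (a * b) -
    k * (w ^ 3 / 3 - (a + b) * w ^ 2 / 2 + a * b * w) with hG
  have hGab : G b = G a := by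
    have h1 : k * (a - b) ^ 3 = 6 * ((a ^ 2 - b ^ 2) / (2 * (a * b)) - (log a - log b)) := by
      rw [hk]; field_simp
    have h2 : ((a + b) * a - a ^ 2 / 2) / (a * b) - ((a + b) * b - b ^ 2 / 2) / (a * b) =
      (a ^ 2 - b ^ 2) / (2 * (a * b)) := by field_simp; ring
    simp only [hG]
    linear_combination (-1 / 6) * h1 + h2
  have hderiv : ∀ w, 0 < w → HasDerivAt G ((w - a) * (w - b) * (1 / (a * b * w) - k)) w := by
    intro w hw
    have h1 : HasDerivAt (fun w : ℝ => w ^ 2) (2 * w) w := by simpa using hasDerivAt_pow 2 w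
    have h2 : HasDerivAt (fun w : ℝ => w ^ 3) (3 * w ^ 2) w := by simpa using hasDerivAt_pow 3 w
    have h3 := ((hasDerivAt_log hw.ne').sub
      ((((hasDerivAt_id w).const_mul (a + b)).sub (h1.div_const 2)).div_const (a * b))).sub
      ((((h2.div_const 3).sub ((h1.const_mul (a + b)).div_const 2)).add
        ((hasDerivAt_id w).const_mul (a * b))).const_mul k)
    refine h3.congr_deriv ?_
    field_simp
    ring
  have hcont : ∀ s : Set ℝ, (∀ w ∈ s, 0 < w) → ContinuousOn G s := fun s hs w hw =>
    (hderiv w (hs w hw)).continuousAt.continuousWithinAt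
  obtain ⟨w₀, hw₀, hz⟩ := exists_hasDerivAt_eq_zero hab
    (hcont _ fun w hw => hb.trans_le hw.1) hGab fun w hw => hderiv w (hb.trans hw.1)
  have hw₀pos : 0 < w₀ := hb.trans hw₀.1
  have hkw : k = 1 / (a * b * w₀) := by
    rcases mul_eq_zero.1 hz with h | h
    · rcases mul_eq_zero.1 h with h | h
      · linarith [hw₀.2]
      · linarith [hw₀.1]
    · linarith
  have hkpos : 0 < k := by rw [hkw]; positivity
  have hd' : ∀ w, 0 < w → deriv G w = (w - a) * (w - b) * (w₀ - w) / (a * b * w * w₀) := by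
    intro w hw
    rw [(hderiv w hw).deriv, hkw]
    field_simp
  have hmono : ∀ x y, 0 < x → x ≤ y →
      (∀ w, x < w → w < y → 0 ≤ (w - a) * (w - b) * (w₀ - w)) → G x ≤ G y := by
    intro x y hx hxy h
    refine monotoneOn_of_deriv_nonneg (convex_Icc x y) (hcont _ fun w hw => hx.trans_le hw.1)
      (fun w hw => ?_) (fun w hw => ?_) (Set.left_mem_Icc.2 hxy) (Set.right_mem_Icc.2 hxy) hxy
    · rw [interior_Icc] at hw
      exact (hderiv w (hx.trans hw.1)).differentiableAt.differentiableWithinAt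
    · rw [interior_Icc] at hw
      have := hx.trans hw.1
      rw [hd' w this]
      exact div_nonneg (h w hw.1 hw.2) (by positivity)
  have hanti : ∀ x y, 0 < x → x ≤ y →
      (∀ w, x < w → w < y → (w - a) * (w - b) * (w₀ - w) ≤ 0) → G y ≤ G x := by
    intro x y hx hxy h
    refine antitoneOn_of_deriv_nonpos (convex_Icc x y) (hcont _ fun w hw => hx.trans_le hw.1)
      (fun w hw => ?_) (fun w hw => ?_) (Set.left_mem_Icc.2 hxy) (Set.right_mem_Icc.2 hxy) hxy
    · rw [interior_Icc] at hw
      exact (hderiv w (hx.trans hw.1)).differentiableAt.differentiableWithinAt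
    · rw [interior_Icc] at hw
      have := hx.trans hw.1
      rw [hd' w this]
      exact div_nonpos_of_nonpos_of_nonneg (h w hw.1 hw.2) (by positivity)
  have hle : ∀ w, 0 < w → G w ≤ G a := by
    intro w hw
    rcases le_total w b with h | h
    · rw [← hGab]
      refine hmono w b hw h fun v _ h2 => ?_
      exact mul_nonneg (mul_nonneg_of_nonpos_of_nonpos (by linarith) (by linarith))
        (by linarith [hw₀.1])
    rcases le_total w w₀ with h' | h'
    · rw [← hGab]
      refine hanti b w hb h fun v h1 h2 => ?_
      exact mul_nonpos_of_nonpos_of_nonneg (mul_nonpos_of_nonpos_of_nonneg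
        (by linarith [hw₀.2]) (by linarith)) (by linarith)
    rcases le_total w a with h'' | h''
    · refine hmono w a hw h'' fun v h1 h2 => ?_
      exact mul_nonneg_of_nonpos_of_nonpos (mul_nonpos_of_nonpos_of_nonneg
        (by linarith) (by linarith)) (by linarith)
    · refine hanti a w ha h'' fun v h1 h2 => ?_
      exact mul_nonpos_of_nonneg_of_nonpos (mul_nonneg (by linarith) (by linarith))
        (by linarith [hw₀.2])
  refine ⟨G a, (a + b) / (a * b) + k * (a * b), -1 / (2 * (a * b)) - k * (a + b) / 2, k / 3,
    by positivity, fun w hw => ?_, ?_, ?_⟩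
  · have := hle w hw
    have h1 : G w = log w - ((a + b) * w - w ^ 2 / 2) / (a * b) -
      k * (w ^ 3 / 3 - (a + b) * w ^ 2 / 2 + a * b * w) := rfl
    have h2 : ((a + b) * w - w ^ 2 / 2) / (a * b) = (a + b) / (a * b) * w +
      -1 / (2 * (a * b)) * w ^ 2 := by field_simp; ring
    linarith
  · have h1 : G a = log a - ((a + b) * a - a ^ 2 / 2) / (a * b) -
      k * (a ^ 3 / 3 - (a + b) * a ^ 2 / 2 + a * b * a) := rfl
    have h2 : ((a + b) * a - a ^ 2 / 2) / (a * b) = (a + b) / (a * b) * a +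
      -1 / (2 * (a * b)) * a ^ 2 := by field_simp; ring
    linarith
  · rw [← hGab]
    have h1 : G b = log b - ((a + b) * b - b ^ 2 / 2) / (a * b) -
      k * (b ^ 3 / 3 - (a + b) * b ^ 2 / 2 + a * b * b) := rfl
    have h2 : ((a + b) * b - b ^ 2 / 2) / (a * b) = (a + b) / (a * b) * b +
      -1 / (2 * (a * b)) * b ^ 2 := by field_simp; ring
    linarith

/-- Among nonnegative families with the power sums of first and second order of the family that
consists of `m` copies of `a` and `m` copies of `b`, and with at most its third power sum, the
latter has the largest product. -/
theorem prod_le_of_power_sums {ι : Type*} [Fintype ι] {a b : ℝ} (hb : 0 < b) (hab : b < a) {m : ℕ}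
    (hι : Fintype.card ι = 2 * m) {w : ι → ℝ} (hw : ∀ i, 0 ≤ w i)
    (h1 : ∑ i, w i = m * (a + b)) (h2 : ∑ i, w i ^ 2 = m * (a ^ 2 + b ^ 2))
    (h3 : ∑ i, w i ^ 3 ≤ m * (a ^ 3 + b ^ 3)) :
    ∏ i, w i ≤ (a * b) ^ m ∧ (∏ i, w i = (a * b) ^ m → ∑ i, w i ^ 3 = m * (a ^ 3 + b ^ 3)) := by
  have ha : 0 < a := hb.trans hab
  have hpos : 0 < (a * b) ^ m := by positivity
  by_cases h0 : ∃ i, w i = 0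
  · obtain ⟨i, hi⟩ := h0
    rw [Finset.prod_eq_zero (Finset.mem_univ i) hi]
    exact ⟨hpos.le, fun h => absurd h hpos.ne⟩
  push Not at h0
  have hwpos : ∀ i, 0 < w i := fun i => lt_of_le_of_ne (hw i) (h0 i).symm
  obtain ⟨c₀, c₁, c₂, c₃, hc₃, hc, hca, hcb⟩ := exists_cubic_majorant hb hab
  have hprod : 0 < ∏ i, w i := Finset.prod_pos fun i _ => hwpos i
  have hlog : log (∏ i, w i) ≤ m * (log a + log b) -
      c₃ * (m * (a ^ 3 + b ^ 3) - ∑ i, w i ^ 3) := by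
    rw [log_prod fun i _ => h0 i]
    calc ∑ i, log (w i) ≤ ∑ i, (c₀ + c₁ * w i + c₂ * w i ^ 2 + c₃ * w i ^ 3) :=
          Finset.sum_le_sum fun i _ => hc _ (hwpos i)
      _ = (2 * m : ℕ) * c₀ + c₁ * ∑ i, w i + c₂ * ∑ i, w i ^ 2 + c₃ * ∑ i, w i ^ 3 := by
          simp only [Finset.sum_add_distrib, Finset.mul_sum, Finset.sum_const, Finset.card_univ, hι,
            nsmul_eq_mul]
      _ = _ := by rw [h1, h2, hca, hcb]; push_cast; ring
  have hlog' : log ((a * b) ^ m) = m * (log a + log b) := by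
    rw [log_pow, log_mul ha.ne' hb.ne']
  rw [← hlog'] at hlog
  have hnn : 0 ≤ c₃ * (m * (a ^ 3 + b ^ 3) - ∑ i, w i ^ 3) :=
    mul_nonneg hc₃.le (by linarith)
  refine ⟨(log_le_log_iff hprod hpos).1 (by linarith), fun h => ?_⟩
  rw [h] at hlog
  have : c₃ * (m * (a ^ 3 + b ^ 3) - ∑ i, w i ^ 3) = 0 := by linarith
  rcases mul_eq_zero.1 this with h | h
  · exact absurd h hc₃.ne'
  · linarith

/-! ### Cubic inequalities -/

theorem amgm_three {a b c : ℝ} (ha : 0 ≤ a) (hb : 0 ≤ b) (hc : 0 ≤ c) :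
    27 * (a * b * c) ≤ (a + b + c) ^ 3 := by
  nlinarith [mul_nonneg ha (sq_nonneg (b - c)), mul_nonneg hb (sq_nonneg (c - a)),
    mul_nonneg hc (sq_nonneg (a - b)), mul_nonneg ha (sq_nonneg (a - b)),
    mul_nonneg ha (sq_nonneg (a - c)), mul_nonneg hb (sq_nonneg (b - a)),
    mul_nonneg hb (sq_nonneg (b - c)), mul_nonneg hc (sq_nonneg (c - a)),
    mul_nonneg hc (sq_nonneg (c - b))]

theorem eq_of_amgm_three_eq {a b c : ℝ} (ha : 0 ≤ a) (hb : 0 ≤ b) (hc : 0 ≤ c)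
    (h : 27 * (a * b * c) = (a + b + c) ^ 3) : a = b ∧ b = c := by
  have h1 : (a + b + c) * ((a - b) ^ 2 + (b - c) ^ 2 + (c - a) ^ 2) ≤ 0 := by
    nlinarith [mul_nonneg ha (sq_nonneg (b - c)), mul_nonneg hb (sq_nonneg (c - a)),
      mul_nonneg hc (sq_nonneg (a - b))]
  rcases (add_nonneg (add_nonneg ha hb) hc).eq_or_lt with h0 | h0
  · constructor <;> linarith
  · have h2 : (a - b) ^ 2 + (b - c) ^ 2 + (c - a) ^ 2 ≤ 0 := by
      by_contra hcon
      push Not at hcon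
      linarith [mul_pos h0 hcon]
    constructor <;> nlinarith [sq_nonneg (a - b), sq_nonneg (b - c), sq_nonneg (c - a)]

/-- The cubic form whose values at squared coordinates are those of the icosahedral invariant of
degree six. -/
def icosaCubic (φ X Y Z : ℝ) : ℝ := ((φ + 1) * Z - Y) * ((φ + 1) * X - Z) * ((φ + 1) * Y - X)

theorem icosaCubic_rotate (φ X Y Z : ℝ) : icosaCubic φ Y Z X = icosaCubic φ X Y Z := by
  unfold icosaCubic; ring

theorem icosaCubic_le_aux {φ X Y Z : ℝ} (hφ : φ ^ 2 = φ + 1) (h1 : 1 < φ) (hX : 0 ≤ X)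
    (hS : 0 < X + Y + Z) (hq : (φ + 1) * X ≤ Z) (hp : (φ + 1) * Z ≤ Y) :
    27 * icosaCubic φ X Y Z ≤ φ ^ 3 * (X + Y + Z) ^ 3 ∧
      (27 * icosaCubic φ X Y Z = φ ^ 3 * (X + Y + Z) ^ 3 → X = 0 ∧ Y = (3 * φ + 2) * Z) := by
  have hZ : 0 ≤ Z := le_trans (by positivity) hq
  have hY : 0 ≤ Y := le_trans (by positivity) hp
  have hY' : 0 < Y := by
    rcases hY.eq_or_lt with h | h
    · have : Z ≤ 0 := by nlinarith
      have : X ≤ 0 := by nlinarith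
      linarith
    · exact h
  have hφ5 : φ ^ 5 = 5 * φ + 3 := by grind
  have e1 : icosaCubic φ X Y Z ≤ (φ + 1) * (Z * Y * (Y - (φ + 1) * Z)) := by
    have h2 : (Z - (φ + 1) * X) * ((φ + 1) * Y - X) ≤ Z * ((φ + 1) * Y) :=
      mul_le_mul (by nlinarith) (by linarith) (by nlinarith) hZ
    have h3 := mul_le_mul_of_nonneg_left h2 (sub_nonneg.2 hp)
    unfold icosaCubic
    linarith
  have hA : 0 ≤ (3 * φ + 2) * Z := by positivity
  have hB : 0 ≤ φ * (Y - (φ + 1) * Z) := mul_nonneg (by linarith) (by linarith)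
  have e2 := amgm_three hA hY hB
  have hs : (3 * φ + 2) * Z + Y + φ * (Y - (φ + 1) * Z) = (φ + 1) * (Y + Z) := by
    linear_combination (-Z) * hφ
  rw [hs] at e2
  have e3 : φ ^ 5 * (27 * (Z * Y * (Y - (φ + 1) * Z))) ≤ φ ^ 5 * (φ * (Y + Z) ^ 3) := by
    have h4 : (3 * φ + 2) * Z * Y * (φ * (Y - (φ + 1) * Z)) =
        φ ^ 5 * (Z * Y * (Y - (φ + 1) * Z)) := by grind
    have h5 : ((φ + 1) * (Y + Z)) ^ 3 = φ ^ 5 * (φ * (Y + Z) ^ 3) := by rw [← hφ]; ring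
    rw [h4, h5] at e2
    linarith
  have e3' := le_of_mul_le_mul_left e3 (by positivity)
  have e4 : (φ + 1) * (27 * (Z * Y * (Y - (φ + 1) * Z))) ≤ φ ^ 3 * (Y + Z) ^ 3 := by
    have := mul_le_mul_of_nonneg_left e3' (by linarith : 0 ≤ φ + 1)
    calc _ ≤ _ := this
      _ = _ := by rw [← hφ]; ring
  have e5 : (Y + Z) ^ 3 ≤ (X + Y + Z) ^ 3 := by gcongr; linarith
  have hφ3 : 0 < φ ^ 3 := by positivity
  refine ⟨by nlinarith, fun h => ?_⟩
  have h6 : (X + Y + Z) ^ 3 ≤ (Y + Z) ^ 3 := by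
    by_contra hcon
    push Not at hcon
    nlinarith
  have h7 : X + Y + Z ≤ Y + Z := le_of_pow_le_pow_left₀ three_ne_zero (by linarith) h6
  have hX0 : X = 0 := by linarith
  refine ⟨hX0, ?_⟩
  have h8 : 27 * ((3 * φ + 2) * Z * Y * (φ * (Y - (φ + 1) * Z))) =
      ((3 * φ + 2) * Z + Y + φ * (Y - (φ + 1) * Z)) ^ 3 := by
    rw [hs]
    rw [hX0] at h
    unfold icosaCubic at h
    grind
  exact (eq_of_amgm_three_eq hA hY hB h8).1.symm

theorem icosaCubic_le {φ X Y Z : ℝ} (hφ : φ ^ 2 = φ + 1) (h1 : 1 < φ) (hX : 0 ≤ X) (hY : 0 ≤ Y)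
    (hZ : 0 ≤ Z) (hS : 0 < X + Y + Z) :
    27 * icosaCubic φ X Y Z ≤ φ ^ 3 * (X + Y + Z) ^ 3 ∧
      (27 * icosaCubic φ X Y Z = φ ^ 3 * (X + Y + Z) ^ 3 → (X = Y ∧ Y = Z) ∨
        (X = 0 ∧ Y = (3 * φ + 2) * Z) ∨ (Y = 0 ∧ Z = (3 * φ + 2) * X) ∨
        (Z = 0 ∧ X = (3 * φ + 2) * Y)) := by
  have r1 := icosaCubic_rotate φ X Y Z
  have r2 := icosaCubic_rotate φ Y Z X
  have hpos : 0 < φ ^ 3 * (X + Y + Z) ^ 3 := by positivity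
  rcases le_total ((φ + 1) * Z) Y with hp | hp <;> rcases le_total ((φ + 1) * X) Z with hq | hq <;>
    rcases le_total ((φ + 1) * Y) X with hr | hr
  · exfalso; nlinarith
  · have h := icosaCubic_le_aux hφ h1 hX hS hq hp
    exact ⟨h.1, fun e => Or.inr (Or.inl (h.2 e))⟩
  · have h := icosaCubic_le_aux (X := Z) (Y := X) (Z := Y) hφ h1 hZ (by linarith) hp hr
    rw [r2, r1, show Z + X + Y = X + Y + Z by ring] at h
    exact ⟨h.1, fun e => Or.inr (Or.inr (Or.inr (h.2 e)))⟩
  · have : icosaCubic φ X Y Z ≤ 0 :=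
      mul_nonpos_of_nonpos_of_nonneg (mul_nonpos_of_nonpos_of_nonneg (by linarith) (by linarith))
        (by linarith)
    exact ⟨by linarith, fun e => by linarith⟩
  · have h := icosaCubic_le_aux (X := Y) (Y := Z) (Z := X) hφ h1 hY (by linarith) hr hq
    rw [r1, show Y + Z + X = X + Y + Z by ring] at h
    exact ⟨h.1, fun e => Or.inr (Or.inr (Or.inl (h.2 e)))⟩
  · have : icosaCubic φ X Y Z ≤ 0 :=
      mul_nonpos_of_nonpos_of_nonneg (mul_nonpos_of_nonneg_of_nonpos (by linarith) (by linarith))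
        (by linarith)
    exact ⟨by linarith, fun e => by linarith⟩
  · have : icosaCubic φ X Y Z ≤ 0 :=
      mul_nonpos_of_nonneg_of_nonpos (mul_nonneg (by linarith) (by linarith)) (by linarith)
    exact ⟨by linarith, fun e => by linarith⟩
  · have hp' := sub_nonneg.2 hp
    have hq' := sub_nonneg.2 hq
    have hr' := sub_nonneg.2 hr
    have hs : ((φ + 1) * Z - Y) + ((φ + 1) * X - Z) + ((φ + 1) * Y - X) = φ * (X + Y + Z) := by
      ring
    have h2 := amgm_three hp' hq' hr'
    rw [hs, mul_pow] at h2
    refine ⟨h2, fun e => Or.inl ?_⟩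
    have h3 := eq_of_amgm_three_eq hp' hq' hr' (by rw [hs, mul_pow]; exact e)
    have h4 : (1 + (φ + 1) + (φ + 1) ^ 2) * (X - Z) = 0 := by
      linear_combination h3.2 - (φ + 1) * h3.1
    have h5 : X - Z = 0 := (mul_eq_zero.1 h4).resolve_left (by positivity)
    have hXZ : X = Z := by linarith
    subst hXZ
    constructor <;> linarith [h3.1]

theorem le_icosaCubic_aux {φ X Y Z : ℝ} (hφ : φ ^ 2 = φ + 1) (h1 : 1 < φ) (hX : 0 ≤ X)
    (hq : (φ + 1) * X ≤ Z) (hp : Y ≤ (φ + 1) * Z) (hr : X ≤ (φ + 1) * Y) :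
    0 ≤ 5 * icosaCubic φ X Y Z + φ ^ 3 * (X + Y + Z) ^ 3 ∧
      (5 * icosaCubic φ X Y Z + φ ^ 3 * (X + Y + Z) ^ 3 = 0 → X = 0 ∧ Z = (φ + 1) * Y) := by
  have hZ : 0 ≤ Z := le_trans (by positivity) hq
  have hY : 0 ≤ Y := by nlinarith
  have e1 : -icosaCubic φ X Y Z ≤ (φ + 1) * (Z * Y * ((φ + 1) * Z - Y)) := by
    have h2 : (Z - (φ + 1) * X) * ((φ + 1) * Y - X) ≤ Z * ((φ + 1) * Y) :=
      mul_le_mul (by nlinarith) (by linarith) (by linarith) hZ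
    have h3 := mul_le_mul_of_nonneg_left h2 (sub_nonneg.2 hp)
    unfold icosaCubic
    linarith
  have h5 : (2 * φ - 1) ^ 2 = 5 := by linear_combination 4 * hφ
  have hA : 0 ≤ (2 * φ - 1) * Z := mul_nonneg (by linarith) hZ
  have hB : 0 ≤ (3 * φ + 1) * Y := by positivity
  have hC : 0 ≤ (φ + 1) * Z - Y := by linarith
  have e2 := amgm_three hA hB hC
  have hs : (2 * φ - 1) * Z + (3 * φ + 1) * Y + ((φ + 1) * Z - Y) = 3 * φ * (Y + Z) := by ring
  rw [hs] at e2
  have e3 : 5 * ((φ + 1) * (Z * Y * ((φ + 1) * Z - Y))) ≤ φ ^ 3 * (Y + Z) ^ 3 := by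
    have h6 : (2 * φ - 1) * Z * ((3 * φ + 1) * Y) * ((φ + 1) * Z - Y) =
      5 * ((φ + 1) * (Z * Y * ((φ + 1) * Z - Y))) := by grind
    rw [h6] at e2
    nlinarith
  have e5 : (Y + Z) ^ 3 ≤ (X + Y + Z) ^ 3 := by gcongr; linarith
  have hφ3 : 0 < φ ^ 3 := by positivity
  refine ⟨by nlinarith, fun h => ?_⟩
  have h6 : (X + Y + Z) ^ 3 ≤ (Y + Z) ^ 3 := by
    by_contra hcon
    push Not at hcon
    nlinarith
  have h7 : X + Y + Z ≤ Y + Z := le_of_pow_le_pow_left₀ three_ne_zero (by linarith) h6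
  have hX0 : X = 0 := by linarith
  refine ⟨hX0, ?_⟩
  have h8 : 27 * ((2 * φ - 1) * Z * ((3 * φ + 1) * Y) * ((φ + 1) * Z - Y)) =
      ((2 * φ - 1) * Z + (3 * φ + 1) * Y + ((φ + 1) * Z - Y)) ^ 3 := by
    rw [hs]
    rw [hX0] at h
    unfold icosaCubic at h
    grind
  have h9 := (eq_of_amgm_three_eq hA hB hC h8).1
  have h10 : (2 * φ - 1) * (Z - (φ + 1) * Y) = 0 := by linear_combination h9 - 2 * Y * hφ
  rcases mul_eq_zero.1 h10 with h | h <;> linarith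

theorem le_icosaCubic {φ X Y Z : ℝ} (hφ : φ ^ 2 = φ + 1) (h1 : 1 < φ) (hX : 0 ≤ X) (hY : 0 ≤ Y)
    (hZ : 0 ≤ Z) (hS : 0 < X + Y + Z) :
    0 ≤ 5 * icosaCubic φ X Y Z + φ ^ 3 * (X + Y + Z) ^ 3 ∧
      (5 * icosaCubic φ X Y Z + φ ^ 3 * (X + Y + Z) ^ 3 = 0 →
        (X = 0 ∧ Z = (φ + 1) * Y) ∨ (Y = 0 ∧ X = (φ + 1) * Z) ∨ (Z = 0 ∧ Y = (φ + 1) * X)) := by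
  have r1 := icosaCubic_rotate φ X Y Z
  have r2 := icosaCubic_rotate φ Y Z X
  have hpos : 0 < φ ^ 3 * (X + Y + Z) ^ 3 := by positivity
  rcases le_total ((φ + 1) * Z) Y with hp | hp <;> rcases le_total ((φ + 1) * X) Z with hq | hq <;>
    rcases le_total ((φ + 1) * Y) X with hr | hr
  · exfalso; nlinarith
  · have : 0 ≤ icosaCubic φ X Y Z :=
      mul_nonneg (mul_nonneg_of_nonpos_of_nonpos (by linarith) (by linarith)) (by linarith)
    exact ⟨by linarith, fun e => by linarith⟩
  · have : 0 ≤ icosaCubic φ X Y Z := mul_nonneg_of_nonpos_of_nonpos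
      (mul_nonpos_of_nonpos_of_nonneg (by linarith) (by linarith)) (by linarith)
    exact ⟨by linarith, fun e => by linarith⟩
  · have h := le_icosaCubic_aux (X := Z) (Y := X) (Z := Y) hφ h1 hZ hp hr hq
    rw [r2, r1, show Z + X + Y = X + Y + Z by ring] at h
    exact ⟨h.1, fun e => Or.inr (Or.inr (h.2 e))⟩
  · have : 0 ≤ icosaCubic φ X Y Z := mul_nonneg_of_nonpos_of_nonpos
      (mul_nonpos_of_nonneg_of_nonpos (by linarith) (by linarith)) (by linarith)
    exact ⟨by linarith, fun e => by linarith⟩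
  · have h := le_icosaCubic_aux hφ h1 hX hq hp hr
    exact ⟨h.1, fun e => Or.inl (h.2 e)⟩
  · have h := le_icosaCubic_aux (X := Y) (Y := Z) (Z := X) hφ h1 hY hr hq hp
    rw [r1, show Y + Z + X = X + Y + Z by ring] at h
    exact ⟨h.1, fun e => Or.inr (Or.inl (h.2 e))⟩
  · have : 0 ≤ icosaCubic φ X Y Z :=
      mul_nonneg (mul_nonneg (by linarith) (by linarith)) (by linarith)
    exact ⟨by linarith, fun e => by linarith⟩

/-! ### Moments of the vertices of icosahedron and dodecahedron -/

theorem icosa_moment_six {φ : ℝ} (hφ : φ ^ 2 = φ + 1) (x y z : ℝ) :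
    ((y + z * φ) ^ 6 + (y - z * φ) ^ 6) + ((z + x * φ) ^ 6 + (z - x * φ) ^ 6) +
      ((x + y * φ) ^ 6 + (x - y * φ) ^ 6) =
    (16 * φ + 12) * (x ^ 2 + y ^ 2 + z ^ 2) ^ 3 - (12 * φ - 6) * icosaCubic φ (x ^ 2) (y ^ 2) (z ^ 2) := by
  unfold icosaCubic
  grind

theorem dodeca_moment_six {φ : ℝ} (hφ : φ ^ 2 = φ + 1) (x y z : ℝ) :
    (x + y + z) ^ 6 + (-x + y + z) ^ 6 + ((x - y + z) ^ 6 + (x + y - z) ^ 6) +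
    (((y * φ + z * (φ - 1)) ^ 6 + (y * φ - z * (φ - 1)) ^ 6) +
    ((z * φ + x * (φ - 1)) ^ 6 + (z * φ - x * (φ - 1)) ^ 6) +
    ((x * φ + y * (φ - 1)) ^ 6 + (x * φ - y * (φ - 1)) ^ 6)) =
    40 * (x ^ 2 + y ^ 2 + z ^ 2) ^ 3 + (60 * φ - 90) * icosaCubic φ (x ^ 2) (y ^ 2) (z ^ 2) := by
  unfold icosaCubic
  grind

theorem icosa_moment_four {φ : ℝ} (hφ : φ ^ 2 = φ + 1) (x y z : ℝ) :
    ((y + z * φ) ^ 4 + (y - z * φ) ^ 4) + ((z + x * φ) ^ 4 + (z - x * φ) ^ 4) +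
      ((x + y * φ) ^ 4 + (x - y * φ) ^ 4) =
    (6 * φ + 6) * (x ^ 2 + y ^ 2 + z ^ 2) ^ 2 := by
  grind

theorem dodeca_moment_four {φ : ℝ} (hφ : φ ^ 2 = φ + 1) (x y z : ℝ) :
    (x + y + z) ^ 4 + (-x + y + z) ^ 4 + ((x - y + z) ^ 4 + (x + y - z) ^ 4) +
    (((y * φ + z * (φ - 1)) ^ 4 + (y * φ - z * (φ - 1)) ^ 4) +
    ((z * φ + x * (φ - 1)) ^ 4 + (z * φ - x * (φ - 1)) ^ 4) +
    ((x * φ + y * (φ - 1)) ^ 4 + (x * φ - y * (φ - 1)) ^ 4)) =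
    18 * (x ^ 2 + y ^ 2 + z ^ 2) ^ 2 := by
  grind

theorem icosa_moment_two {φ : ℝ} (hφ : φ ^ 2 = φ + 1) (x y z : ℝ) :
    ((y + z * φ) ^ 2 + (y - z * φ) ^ 2) + ((z + x * φ) ^ 2 + (z - x * φ) ^ 2) +
      ((x + y * φ) ^ 2 + (x - y * φ) ^ 2) =
    (2 * φ + 4) * (x ^ 2 + y ^ 2 + z ^ 2) := by
  grind

theorem dodeca_moment_two {φ : ℝ} (hφ : φ ^ 2 = φ + 1) (x y z : ℝ) :
    (x + y + z) ^ 2 + (-x + y + z) ^ 2 + ((x - y + z) ^ 2 + (x + y - z) ^ 2) +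
    (((y * φ + z * (φ - 1)) ^ 2 + (y * φ - z * (φ - 1)) ^ 2) +
    ((z * φ + x * (φ - 1)) ^ 2 + (z * φ - x * (φ - 1)) ^ 2) +
    ((x * φ + y * (φ - 1)) ^ 2 + (x * φ - y * (φ - 1)) ^ 2)) =
    10 * (x ^ 2 + y ^ 2 + z ^ 2) := by
  grind

theorem prod_one_sub_sq_le {ι : Type*} [Fintype ι] {m : ℕ} (hι : Fintype.card ι = 2 * m)
    {u : ι → ℝ} (hu : ∀ i, u i ^ 2 ≤ 1) (h2 : ∑ i, u i ^ 2 = 2 * m / 3)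
    (h4 : ∑ i, u i ^ 4 = 2 * m / 5) (h6 : 34 * m / 135 ≤ ∑ i, u i ^ 6) :
    ∏ i, (1 - u i ^ 2) ≤ (16 / 45) ^ m ∧
      (∏ i, (1 - u i ^ 2) = (16 / 45) ^ m → ∑ i, u i ^ 6 = 34 * m / 135) := by
  have h5 : √5 ^ 2 = 5 := Real.sq_sqrt (by norm_num)
  have h5' : 0 < √5 := by positivity
  set δ := 2 * √5 / 15 with hδ
  have hδ2 : δ ^ 2 = 4 / 45 := by rw [hδ, div_pow, mul_pow, h5]; norm_num
  have hδ0 : 0 < δ := by positivity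
  have hlt : δ < 2 / 3 := by nlinarith
  have hab : (2 / 3 + δ) * (2 / 3 - δ) = 16 / 45 := by linear_combination -hδ2
  have hcard : ∑ _i : ι, (1 : ℝ) = 2 * m := by simp [hι]
  have e2 : ∑ i, (1 - u i ^ 2) ^ 2 = 2 * m - 2 * ∑ i, u i ^ 2 + ∑ i, u i ^ 4 := by
    rw [← hcard, Finset.mul_sum, ← Finset.sum_sub_distrib, ← Finset.sum_add_distrib]
    exact Finset.sum_congr rfl fun i _ => by ring
  have e3 : ∑ i, (1 - u i ^ 2) ^ 3 = 2 * m - 3 * ∑ i, u i ^ 2 + 3 * ∑ i, u i ^ 4 -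
      ∑ i, u i ^ 6 := by
    rw [← hcard, Finset.mul_sum, Finset.mul_sum, ← Finset.sum_sub_distrib,
      ← Finset.sum_add_distrib, ← Finset.sum_sub_distrib]
    exact Finset.sum_congr rfl fun i _ => by ring
  rw [h2, h4] at e2 e3
  have hcube : (2 / 3 + δ) ^ 3 + (2 / 3 - δ) ^ 3 = 128 / 135 := by linear_combination 4 * hδ2
  have key := prod_le_of_power_sums (w := fun i => 1 - u i ^ 2) (a := 2 / 3 + δ) (b := 2 / 3 - δ)
    (by linarith) (by linarith) hι (fun i => sub_nonneg.2 (hu i))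
    (by rw [Finset.sum_sub_distrib, hcard, h2]; ring)
    (by rw [e2]; linear_combination (-2 * (m : ℝ)) * hδ2)
    (by rw [e3, hcube]; linarith)
  rw [hab, e3, hcube] at key
  exact ⟨key.1, fun h => by linarith [key.2 h]⟩

/-! ### Vertices in terms of squared coordinates -/

theorem mem_range_smul {κ : Type*} {w : κ → Space} {s : ℝ} (hs : s ≠ 0) (q : Space) :
    q ∈ Set.range (fun k => s • w k) ↔ s⁻¹ • q ∈ Set.range w := by
  constructor
  · rintro ⟨k, rfl⟩
    exact ⟨k, by simp [smul_smul, hs]⟩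
  · rintro ⟨k, hk⟩
    exact ⟨k, by simp [hk, smul_smul, hs]⟩

theorem range_icosaVec : Set.range icosaVec =
    {v | ∃ i : Fin 3, v i = 0 ∧ |v (i + 1)| = 1 ∧ |v (i + 2)| = goldenRatio} := by
  ext v
  constructor
  · rintro ⟨⟨i, b, c⟩, rfl⟩
    refine ⟨i, ?_, ?_, ?_⟩
    · exact cycVec_apply_zero ..
    · rw [icosaVec, cycVec_apply_one, abs_sgn]
    · rw [icosaVec, cycVec_apply_two, abs_mul, abs_sgn, one_mul, abs_of_pos goldenRatio_pos]
  · rintro ⟨i, h0, h1, h2⟩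
    obtain ⟨b, hb⟩ := exists_sgn_mul h1
    obtain ⟨c, hc⟩ := exists_sgn_mul h2
    rw [mul_one] at hb
    exact ⟨⟨i, b, c⟩, by rw [icosaVec, ← hc, ← hb, ← h0, cycVec_eq]⟩

theorem range_cubeVec : Set.range cubeVec = {v | ∀ i : Fin 3, |v i| = 1} := by
  ext v
  constructor
  · rintro ⟨⟨a, b, c⟩, rfl⟩ i
    fin_cases i
    · exact (congrArg _ (cycVec_apply_zero 0 _ _ _)).trans (abs_sgn a)
    · exact (congrArg _ (cycVec_apply_one 0 _ _ _)).trans (abs_sgn b)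
    · exact (congrArg _ (cycVec_apply_two 0 _ _ _)).trans (abs_sgn c)
  · intro h
    obtain ⟨a, ha⟩ := exists_sgn_mul (h 0)
    obtain ⟨b, hb⟩ := exists_sgn_mul (h 1)
    obtain ⟨c, hc⟩ := exists_sgn_mul (h 2)
    rw [mul_one] at ha hb hc
    refine ⟨⟨a, b, c⟩, ?_⟩
    rw [cubeVec, ← ha, ← hb, ← hc]
    exact cycVec_eq 0 v

theorem range_octaVec : Set.range octaVec =
    {v | ∃ i : Fin 3, v i = 0 ∧ v (i + 1) = 0 ∧ |v (i + 2)| = 1} := by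
  ext v
  constructor
  · rintro ⟨⟨i, b⟩, rfl⟩
    exact ⟨i, cycVec_apply_zero .., cycVec_apply_one .., by rw [octaVec, cycVec_apply_two, abs_sgn]⟩
  · rintro ⟨i, h0, h1, h2⟩
    obtain ⟨b, hb⟩ := exists_sgn_mul h2
    rw [mul_one] at hb
    refine ⟨⟨i, b⟩, ?_⟩
    rw [octaVec, ← hb]
    nth_rw 1 [← h0]
    rw [← h1, cycVec_eq]

theorem range_dodecaVec : Set.range dodecaVec = {v | ∀ i : Fin 3, |v i| = 1} ∪
    {v | ∃ i : Fin 3, v i = 0 ∧ |v (i + 1)| = goldenRatio ∧ |v (i + 2)| = goldenRatio - 1} := by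
  rw [dodecaVec, Set.Sum.elim_range, range_cubeVec]
  congr 1
  have hpos : 0 < goldenRatio - 1 := sub_pos.2 one_lt_goldenRatio
  ext v
  constructor
  · rintro ⟨⟨i, b, c⟩, rfl⟩
    refine ⟨i, ?_, ?_, ?_⟩
    · exact cycVec_apply_zero ..
    · rw [cycVec_apply_one, abs_mul, abs_sgn, one_mul, abs_of_pos goldenRatio_pos]
    · rw [cycVec_apply_two, abs_mul, abs_sgn, one_mul, abs_of_pos hpos]
  · rintro ⟨i, h0, h1, h2⟩
    obtain ⟨b, hb⟩ := exists_sgn_mul h1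
    obtain ⟨c, hc⟩ := exists_sgn_mul h2
    exact ⟨⟨i, b, c⟩, by simp only; rw [← hc, ← hb, ← h0, cycVec_eq]⟩

theorem range_tetraVec : Set.range tetraVec =
    {!₂[1, 1, 1], !₂[1, -1, -1], !₂[-1, 1, -1], !₂[-1, -1, 1]} := by
  have h : ∀ x y z : ℝ, cycVec 0 x y z = !₂[x, y, z] := fun x y z => by
    ext i; fin_cases i <;> rfl
  ext v
  constructor
  · rintro ⟨⟨a, b⟩, rfl⟩
    rw [tetraVec, h]
    cases a <;> cases b <;> simp
  · rintro (rfl | rfl | rfl | rfl)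
    · exact ⟨⟨true, true⟩, by rw [tetraVec, h]; simp⟩
    · exact ⟨⟨true, false⟩, by rw [tetraVec, h]; simp⟩
    · exact ⟨⟨false, true⟩, by rw [tetraVec, h]; simp⟩
    · exact ⟨⟨false, false⟩, by rw [tetraVec, h]; simp⟩

theorem abs_inv_mul_eq_iff {s r x : ℝ} (hs : 0 < s) (hr : 0 ≤ r) :
    |s⁻¹ * x| = r ↔ x ^ 2 = s ^ 2 * r ^ 2 := by
  rw [← mul_pow, sq_eq_sq_iff_abs_eq_abs, abs_of_nonneg (mul_nonneg hs.le hr), abs_mul,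
    abs_of_pos (inv_pos.2 hs)]
  field_simp

theorem inv_sqrt_golden_sq : (1 / √(goldenRatio + 2)) ^ 2 = (3 - goldenRatio) / 5 := by
  have h1 := sq_sqrt_golden
  have h2 := goldenRatio_sq
  have h3 := goldenRatio_pos
  rw [div_pow, h1]
  generalize goldenRatio = φ at *
  field_simp
  linarith

theorem inv_sqrt_three_sq : (1 / √3) ^ 2 = 1 / 3 := by
  rw [div_pow, Real.sq_sqrt (by norm_num)]; norm_num

theorem mem_range_smul_icosaVec (q : Space) :
    q ∈ Set.range (fun k => (1 / √(goldenRatio + 2)) • icosaVec k) ↔ ∃ i : Fin 3, q i = 0 ∧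
      q (i + 1) ^ 2 = (3 - goldenRatio) / 5 ∧ q (i + 2) ^ 2 = (goldenRatio + 2) / 5 := by
  have hs : 0 < 1 / √(goldenRatio + 2) := one_div_pos.2 sqrt_golden_pos
  have e : (3 - goldenRatio) / 5 * goldenRatio ^ 2 = (goldenRatio + 2) / 5 := by
    have h2 := goldenRatio_sq
    generalize goldenRatio = φ at *
    grind
  rw [mem_range_smul hs.ne', range_icosaVec]
  simp only [Set.mem_ofPred_eq, PiLp.smul_apply, smul_eq_mul, abs_inv_mul_eq_iff hs zero_le_one,
    abs_inv_mul_eq_iff hs goldenRatio_pos.le, inv_sqrt_golden_sq, e, mul_eq_zero,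
    inv_eq_zero, hs.ne', false_or, one_pow, mul_one]

theorem mem_range_smul_cubeVec (q : Space) :
    q ∈ Set.range (fun k => (1 / √3) • cubeVec k) ↔ ∀ i : Fin 3, q i ^ 2 = 1 / 3 := by
  have hs : 0 < 1 / √3 := by positivity
  rw [mem_range_smul hs.ne', range_cubeVec]
  simp only [Set.mem_ofPred_eq, PiLp.smul_apply, smul_eq_mul, abs_inv_mul_eq_iff hs zero_le_one,
    inv_sqrt_three_sq, one_pow, mul_one]

theorem mem_range_smul_dodecaVec (q : Space) :
    q ∈ Set.range (fun k => (1 / √3) • dodecaVec k) ↔ (∀ i : Fin 3, q i ^ 2 = 1 / 3) ∨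
      ∃ i : Fin 3, q i = 0 ∧ q (i + 1) ^ 2 = (goldenRatio + 1) / 3 ∧
        q (i + 2) ^ 2 = (2 - goldenRatio) / 3 := by
  have hs : 0 < 1 / √3 := by positivity
  have e1 : 1 / 3 * goldenRatio ^ 2 = (goldenRatio + 1) / 3 := by rw [goldenRatio_sq]; ring
  have e2 : 1 / 3 * (goldenRatio - 1) ^ 2 = (2 - goldenRatio) / 3 := by
    have h2 := goldenRatio_sq
    generalize goldenRatio = φ at *
    linear_combination (1 / 3) * h2
  rw [mem_range_smul hs.ne', range_dodecaVec]
  simp only [Set.mem_union, Set.mem_ofPred_eq, PiLp.smul_apply, smul_eq_mul,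
    abs_inv_mul_eq_iff hs zero_le_one, abs_inv_mul_eq_iff hs goldenRatio_pos.le,
    abs_inv_mul_eq_iff hs (sub_nonneg.2 one_lt_goldenRatio.le),
    inv_sqrt_three_sq, e1, e2, mul_eq_zero, inv_eq_zero, hs.ne', false_or, one_pow, mul_one]

theorem mem_range_smul_octaVec (q : Space) : q ∈ Set.range (fun k => (1 : ℝ) • octaVec k) ↔
    ∃ i : Fin 3, q i = 0 ∧ q (i + 1) = 0 ∧ q (i + 2) ^ 2 = 1 := by
  have h : ∀ x : ℝ, |x| = 1 ↔ x ^ 2 = 1 := fun x => by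
    rw [← one_pow 2, sq_eq_sq_iff_abs_eq_abs, abs_one, one_pow]
  simp only [one_smul]
  rw [range_octaVec]
  simp only [Set.mem_ofPred_eq, h]

/-! ### Maxima of the overlaps -/

theorem amgm_four {a b c d : ℝ} (ha : 0 ≤ a) (hb : 0 ≤ b) (hc : 0 ≤ c) (hd : 0 ≤ d) :
    256 * (a * b * (c * d)) ≤ (a + b + c + d) ^ 4 ∧
      (256 * (a * b * (c * d)) = (a + b + c + d) ^ 4 → a + b + c + d = 0 ∨
        (a = b ∧ c = d ∧ b = c)) := by
  have h1 : 4 * (a * b) ≤ (a + b) ^ 2 := by nlinarith [sq_nonneg (a - b)]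
  have h2 : 4 * (c * d) ≤ (c + d) ^ 2 := by nlinarith [sq_nonneg (c - d)]
  have h3 : 4 * ((a + b) * (c + d)) ≤ (a + b + c + d) ^ 2 := by
    nlinarith [sq_nonneg (a + b - (c + d))]
  have hab := mul_nonneg ha hb
  have hcd := mul_nonneg hc hd
  have h4 : 16 * (a * b * (c * d)) ≤ ((a + b) * (c + d)) ^ 2 := by
    rw [mul_pow]
    calc 16 * (a * b * (c * d)) = 4 * (a * b) * (4 * (c * d)) := by ring
      _ ≤ _ := mul_le_mul h1 h2 (by positivity) (by positivity)
  have h5 : 16 * ((a + b) * (c + d)) ^ 2 ≤ (a + b + c + d) ^ 4 := by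
    have := pow_le_pow_left₀ (by positivity) h3 2
    calc 16 * ((a + b) * (c + d)) ^ 2 = (4 * ((a + b) * (c + d))) ^ 2 := by ring
      _ ≤ ((a + b + c + d) ^ 2) ^ 2 := this
      _ = _ := by ring
  refine ⟨by linarith, fun h => ?_⟩
  by_cases h0 : a + b + c + d = 0
  · exact Or.inl h0
  right
  have hS : 0 < a + b + c + d := lt_of_le_of_ne (by positivity) (Ne.symm h0)
  have h6 : ((a + b + c + d) ^ 2 - 4 * ((a + b) * (c + d))) *
      ((a + b + c + d) ^ 2 + 4 * ((a + b) * (c + d))) = 0 := by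
    have e : (a + b + c + d) ^ 4 = 16 * ((a + b) * (c + d)) ^ 2 := by linarith
    linear_combination e
  have h7 : (a + b - (c + d)) ^ 2 = 0 := by
    rcases mul_eq_zero.1 h6 with h | h
    · linarith
    · have : 0 < (a + b + c + d) ^ 2 := by positivity
      have : 0 ≤ (a + b) * (c + d) := by positivity
      linarith
  have h8 : a + b = c + d := sub_eq_zero.1 (pow_eq_zero_iff two_ne_zero |>.1 h7)
  have h9 : 16 * (a * b * (c * d)) = ((a + b) * (c + d)) ^ 2 := by linarith
  have hp : 0 < c + d := by linarith
  have h10 : ((a + b) ^ 2 - 4 * (a * b)) * (c + d) ^ 2 +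
      4 * (a * b) * ((c + d) ^ 2 - 4 * (c * d)) = 0 := by linear_combination -h9
  have h11 : 0 ≤ ((a + b) ^ 2 - 4 * (a * b)) * (c + d) ^ 2 :=
    mul_nonneg (by linarith) (by positivity)
  have h12 : 0 ≤ 4 * (a * b) * ((c + d) ^ 2 - 4 * (c * d)) :=
    mul_nonneg (by positivity) (by linarith)
  have h13 : (a + b) ^ 2 - 4 * (a * b) = 0 := by
    have h14 : ((a + b) ^ 2 - 4 * (a * b)) * (c + d) ^ 2 = 0 := by linarith
    exact (mul_eq_zero.1 h14).resolve_right (by positivity)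
  have hab' : a = b := by
    have : (a - b) ^ 2 = 0 := by linarith
    exact sub_eq_zero.1 (pow_eq_zero_iff two_ne_zero |>.1 this)
  have hap : 0 < a * b := by
    have : 0 < a := by linarith
    rw [← hab']
    positivity
  have hcd' : c = d := by
    have h14 : 4 * (a * b) * ((c + d) ^ 2 - 4 * (c * d)) = 0 := by linarith
    have h15 := (mul_eq_zero.1 h14).resolve_left (by positivity)
    have : (c - d) ^ 2 = 0 := by linarith
    exact sub_eq_zero.1 (pow_eq_zero_iff two_ne_zero |>.1 this)
  exact ⟨hab', hcd', by linarith⟩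

theorem space_sq_sum {q : Space} (hq : ‖q‖ = 1) : q 0 ^ 2 + q 1 ^ 2 + q 2 ^ 2 = 1 := by
  rw [← norm_sq_space, hq, one_pow]

theorem prod_octaVec_max {q : Space} (hq : ‖q‖ = 1) :
    ∏ k, (1 + 1 * inner ℝ q (octaVec k)) ≤ 8 / 27 ∧
      (∏ k, (1 + 1 * inner ℝ q (octaVec k)) = 8 / 27 ↔
        q ∈ Set.range fun k => (1 / √3) • cubeVec k) := by
  have hS := space_sq_sum hq
  rw [prod_octaVec, mem_range_smul_cubeVec]
  have hx : 0 ≤ 1 - q 0 ^ 2 := by nlinarith [sq_nonneg (q 1), sq_nonneg (q 2)]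
  have hy : 0 ≤ 1 - q 1 ^ 2 := by nlinarith [sq_nonneg (q 0), sq_nonneg (q 2)]
  have hz : 0 ≤ 1 - q 2 ^ 2 := by nlinarith [sq_nonneg (q 1), sq_nonneg (q 0)]
  have h1 := amgm_three hz hx hy
  have hs : 1 - q 2 ^ 2 + (1 - q 0 ^ 2) + (1 - q 1 ^ 2) = 2 := by linarith
  rw [hs] at h1
  refine ⟨by linarith, fun h => ?_, fun h => ?_⟩
  · have h2 := eq_of_amgm_three_eq hz hx hy (by rw [hs, h]; norm_num)
    intro i
    fin_cases i
    · change q 0 ^ 2 = _; linarith [h2.1, h2.2]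
    · change q 1 ^ 2 = _; linarith [h2.1, h2.2]
    · change q 2 ^ 2 = _; linarith [h2.1, h2.2]
  · rw [h 0, h 1, h 2]; norm_num

theorem prod_cubeVec_max {q : Space} (hq : ‖q‖ = 1) :
    ∏ k, (1 + 1 / √3 * inner ℝ q (cubeVec k)) ≤ 16 / 81 ∧
      (∏ k, (1 + 1 / √3 * inner ℝ q (cubeVec k)) = 16 / 81 ↔
        q ∈ Set.range fun k => (1 : ℝ) • octaVec k) := by
  have hS := space_sq_sum hq
  rw [prod_cubeVec, mem_range_smul_octaVec]
  simp only [mul_pow _ (_ + _ : ℝ), mul_pow _ (_ - _ : ℝ), inv_sqrt_three_sq]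
  have hex : (∃ i : Fin 3, q i = 0 ∧ q (i + 1) = 0 ∧ q (i + 2) ^ 2 = 1) ↔
      (q 0 = 0 ∧ q 1 = 0 ∧ q 2 ^ 2 = 1) ∨ (q 1 = 0 ∧ q 2 = 0 ∧ q 0 ^ 2 = 1) ∨
        (q 2 = 0 ∧ q 0 = 0 ∧ q 1 ^ 2 = 1) := by
    constructor
    · rintro ⟨i, h⟩
      fin_cases i
      exacts [Or.inl h, Or.inr (Or.inl h), Or.inr (Or.inr h)]
    · rintro (h | h | h)
      exacts [⟨0, h⟩, ⟨1, h⟩, ⟨2, h⟩]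
  rw [hex]
  generalize q 0 = x at *; generalize q 1 = y at *; generalize q 2 = z at *
  have ha : 0 ≤ 1 - 1 / 3 * (x + y + z) ^ 2 := by
    nlinarith [sq_nonneg (x - y), sq_nonneg (y - z), sq_nonneg (z - x)]
  have hb : 0 ≤ 1 - 1 / 3 * (-x + y + z) ^ 2 := by
    nlinarith [sq_nonneg (x + y), sq_nonneg (y - z), sq_nonneg (z + x)]
  have hc : 0 ≤ 1 - 1 / 3 * (x - y + z) ^ 2 := by
    nlinarith [sq_nonneg (x + y), sq_nonneg (y + z), sq_nonneg (z - x)]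
  have hd : 0 ≤ 1 - 1 / 3 * (x + y - z) ^ 2 := by
    nlinarith [sq_nonneg (x - y), sq_nonneg (y + z), sq_nonneg (z + x)]
  have h1 := amgm_four ha hb hc hd
  have hs : 1 - 1 / 3 * (x + y + z) ^ 2 + (1 - 1 / 3 * (-x + y + z) ^ 2) +
      (1 - 1 / 3 * (x - y + z) ^ 2) + (1 - 1 / 3 * (x + y - z) ^ 2) = 8 / 3 := by
    linear_combination (-4 / 3) * hS
  rw [hs] at h1
  refine ⟨by linarith [h1.1], fun h => ?_, ?_⟩
  · obtain h2 | ⟨h2, h3, h4⟩ := h1.2 (by rw [h]; norm_num)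
    · norm_num at h2
    · have e1 : x * (y + z) = 0 := by linarith
      have e2 : y * (x + z) = 0 := by linarith
      have e3 : z * (x + y) = 0 := by linarith
      have f1 : x * y = 0 := by linarith
      have f2 : x * z = 0 := by linarith
      have f3 : y * z = 0 := by linarith
      rcases mul_eq_zero.1 f1 with hx | hy
      · subst hx
        rcases mul_eq_zero.1 f3 with hy | hz
        · exact Or.inl ⟨rfl, hy, by rw [hy] at hS; linarith⟩
        · exact Or.inr (Or.inr ⟨hz, rfl, by rw [hz] at hS; linarith⟩)
      · subst hy
        rcases mul_eq_zero.1 f2 with hx | hz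
        · exact Or.inl ⟨hx, rfl, by rw [hx] at hS; linarith⟩
        · exact Or.inr (Or.inl ⟨rfl, hz, by rw [hz] at hS; linarith⟩)
  · rintro (⟨rfl, rfl, h⟩ | ⟨rfl, rfl, h⟩ | ⟨rfl, rfl, h⟩) <;> ring_nf <;> grind

theorem prod_tetraVec_max {q : Space} (hq : ‖q‖ = 1) :
    ∏ k, (1 + 1 / √3 * inner ℝ q (tetraVec k)) ≤ 16 / 27 ∧
      (∏ k, (1 + 1 / √3 * inner ℝ q (tetraVec k)) = 16 / 27 ↔
        q ∈ Set.range fun k => (1 / √3) • tetraVec k) := by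
  have hS := space_sq_sum hq
  have hs := inv_sqrt_three_sq
  have hs0 : 0 < 1 / √3 := by positivity
  have hmem : q ∈ (Set.range fun k => (1 / √3) • tetraVec k) ↔
      ∃ a b : Bool, q 0 = sgn a * (1 / √3) ∧ q 1 = sgn b * (1 / √3) ∧
        q 2 = sgn a * sgn b * (1 / √3) := by
    constructor
    · rintro ⟨⟨a, b⟩, rfl⟩
      exact ⟨a, b, mul_comm _ _, mul_comm _ _, mul_comm _ _⟩
    · rintro ⟨a, b, h0, h1, h2⟩
      refine ⟨⟨a, b⟩, ?_⟩
      ext i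
      fin_cases i
      · exact (mul_comm _ _).trans h0.symm
      · exact (mul_comm _ _).trans h1.symm
      · exact (mul_comm _ _).trans h2.symm
  rw [prod_tetraVec, hmem]
  generalize 1 / √3 = s at *
  generalize q 0 = x at *; generalize q 1 = y at *; generalize q 2 = z at *
  have hP : (1 + s * (x + y + z)) * (1 + s * (x - y - z)) *
      ((1 + s * (-x + y - z)) * (1 + s * (-x - y + z))) =
      4 / 9 + 8 / 3 * (s * (x * y * z)) - 4 / 9 * (x ^ 2 * y ^ 2 + y ^ 2 * z ^ 2 + z ^ 2 * x ^ 2) := by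
    linear_combination (- 2 * s ^ 2 + s ^ 4 * (x ^ 2 + y ^ 2 + z ^ 2 + 1)) * hS +
      (8 * s * x * y * z - 2 + (s ^ 2 + 1 / 3) *
        (1 - 4 * (x ^ 2 * y ^ 2 + y ^ 2 * z ^ 2 + z ^ 2 * x ^ 2))) * hs
  rw [hP]
  set p := x * y * z with hp
  have hp2 : p ^ 2 = x ^ 2 * y ^ 2 * z ^ 2 := by rw [hp]; ring
  have h1 := amgm_three (sq_nonneg x) (sq_nonneg y) (sq_nonneg z)
  rw [hS, one_pow, ← hp2] at h1
  have h2 : (3 * (s * p)) ^ 2 ≤ (x ^ 2 * y ^ 2 + y ^ 2 * z ^ 2 + z ^ 2 * x ^ 2) ^ 2 := by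
    have e : (3 * (s * p)) ^ 2 = 3 * (x ^ 2 * y ^ 2 * z ^ 2) * (x ^ 2 + y ^ 2 + z ^ 2) := by
      rw [hS, ← hp2, mul_pow, mul_pow, hs]; ring
    rw [e]
    nlinarith [sq_nonneg (x ^ 2 * y ^ 2 - y ^ 2 * z ^ 2), sq_nonneg (y ^ 2 * z ^ 2 - z ^ 2 * x ^ 2),
      sq_nonneg (z ^ 2 * x ^ 2 - x ^ 2 * y ^ 2)]
  have h3 : 3 * (s * p) ≤ x ^ 2 * y ^ 2 + y ^ 2 * z ^ 2 + z ^ 2 * x ^ 2 :=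
    le_of_sq_le_sq h2 (by positivity)
  have hsp2 : (s * p) ^ 2 = p ^ 2 / 3 := by rw [mul_pow, hs]; ring
  have h4 : s * p ≤ 1 / 9 := by nlinarith
  refine ⟨by linarith, fun h => ?_, ?_⟩
  · have h5 : s * p = 1 / 9 := by linarith
    have h6 : 27 * (x ^ 2 * y ^ 2 * z ^ 2) = (x ^ 2 + y ^ 2 + z ^ 2) ^ 3 := by
      rw [h5] at hsp2
      rw [hS, ← hp2]; linarith
    obtain ⟨h7, h8⟩ := eq_of_amgm_three_eq (sq_nonneg x) (sq_nonneg y) (sq_nonneg z) h6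
    have habs : ∀ t : ℝ, t ^ 2 = 1 / 3 → ∃ b, t = sgn b * s := fun t ht => by
      refine exists_sgn_mul ?_
      rw [← hs, sq_eq_sq_iff_abs_eq_abs, abs_of_pos hs0] at ht
      exact ht
    obtain ⟨a, ha⟩ := habs x (by linarith)
    obtain ⟨b, hb⟩ := habs y (by linarith)
    refine ⟨a, b, ha, hb, ?_⟩
    have h9 : s * (s * s * (sgn a * sgn b)) * z = 1 / 9 := by
      rw [← h5, hp, ha, hb]; ring
    have h10 := sgn_sq a
    have h11 := sgn_sq b
    have h12 : s * s = 1 / 3 := by rw [← hs]; ring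
    rw [h12] at h9
    have h13 : s * (sgn a * sgn b) * z = 1 / 3 := by linarith
    calc z = (s * (sgn a * sgn b) * z) * (3 * (s * (sgn a * sgn b))) := by
          linear_combination (-3 * s ^ 2 * sgn b ^ 2 * z) * h10 - (3 * s ^ 2 * z) * h11 - 3 * z * hs
      _ = _ := by rw [h13]; ring
  · rintro ⟨a, b, ha, hb, hc⟩
    have h10 := sgn_sq a
    have h11 := sgn_sq b
    rw [hp, ha, hb, hc]
    have e1 : s * (sgn a * s * (sgn b * s) * (sgn a * sgn b * s)) = 1 / 9 := by grind
    rw [e1, mul_pow, mul_pow, mul_pow, mul_pow, h10, h11, hs]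
    norm_num

theorem sq_golden_form_le {φ s : ℝ} (hφ : φ ^ 2 = φ + 1) (hφ2 : φ < 2) (hs : s ^ 2 = (3 - φ) / 5)
    {a b c : ℝ} (h : a ^ 2 + b ^ 2 + c ^ 2 = 1) : (s * (a + b * φ)) ^ 2 ≤ 1 := by
  rw [mul_pow, hs]
  have h0 : 0 ≤ (3 - φ) / 5 := by linarith
  have hφ0 : 0 ≤ φ + 2 := by nlinarith
  have h1 : (a + b * φ) ^ 2 ≤ φ + 2 := by
    have e : φ + 2 - (a + b * φ) ^ 2 = (a * φ - b) ^ 2 + (φ + 2) * c ^ 2 := by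
      linear_combination (-(φ + 2)) * h - (a ^ 2 + b ^ 2) * hφ
    have := mul_nonneg hφ0 (sq_nonneg c)
    linarith [sq_nonneg (a * φ - b)]
  calc (3 - φ) / 5 * (a + b * φ) ^ 2 ≤ (3 - φ) / 5 * (φ + 2) := by gcongr
    _ = 1 := by linear_combination -hφ / 5

theorem exists_icosa_forms {φ s x y z : ℝ} (hφ : φ ^ 2 = φ + 1) (hφ2 : φ < 2)
    (hs : s ^ 2 = (3 - φ) / 5) (hS : x ^ 2 + y ^ 2 + z ^ 2 = 1) :
    ∃ u : Fin 6 → ℝ, (∀ i, u i ^ 2 ≤ 1) ∧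
      (∀ n : ℕ, ∑ i, u i ^ n = s ^ n * (((y + z * φ) ^ n + (y - z * φ) ^ n) +
        ((z + x * φ) ^ n + (z - x * φ) ^ n) + ((x + y * φ) ^ n + (x - y * φ) ^ n))) ∧
      ∏ i, (1 - u i ^ 2) =
        ((1 - (s * (y + z * φ)) ^ 2) * (1 - (s * (y - z * φ)) ^ 2)) *
        ((1 - (s * (z + x * φ)) ^ 2) * (1 - (s * (z - x * φ)) ^ 2)) *
        ((1 - (s * (x + y * φ)) ^ 2) * (1 - (s * (x - y * φ)) ^ 2)) := by
  refine ⟨![s * (y + z * φ), s * (y - z * φ), s * (z + x * φ), s * (z - x * φ),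
    s * (x + y * φ), s * (x - y * φ)], fun i => ?_, fun n => ?_, ?_⟩
  · have hcs : ∀ {a b c : ℝ}, a ^ 2 + b ^ 2 + c ^ 2 = 1 → (s * (a - b * φ)) ^ 2 ≤ 1 := by
      intro a b c h
      have := sq_golden_form_le hφ hφ2 hs (a := a) (b := -b) (c := c) (by rwa [neg_sq])
      rwa [neg_mul, ← sub_eq_add_neg] at this
    fin_cases i
    · exact sq_golden_form_le hφ hφ2 hs (c := x) (by linarith)
    · exact hcs (c := x) (by linarith)
    · exact sq_golden_form_le hφ hφ2 hs (c := y) (by linarith)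
    · exact hcs (c := y) (by linarith)
    · exact sq_golden_form_le hφ hφ2 hs (c := z) (by linarith)
    · exact hcs (c := z) (by linarith)
  · rw [Fin.sum_univ_six]
    change (s * (y + z * φ)) ^ n + (s * (y - z * φ)) ^ n + (s * (z + x * φ)) ^ n +
      (s * (z - x * φ)) ^ n + (s * (x + y * φ)) ^ n + (s * (x - y * φ)) ^ n = _
    simp only [mul_pow s]
    ring
  · rw [Fin.prod_univ_six]
    change (1 - (s * (y + z * φ)) ^ 2) * (1 - (s * (y - z * φ)) ^ 2) *
      (1 - (s * (z + x * φ)) ^ 2) * (1 - (s * (z - x * φ)) ^ 2) *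
      (1 - (s * (x + y * φ)) ^ 2) * (1 - (s * (x - y * φ)) ^ 2) = _
    simp only [mul_assoc]

theorem icosa_forms_prod_le {φ s x y z : ℝ} (hφ : φ ^ 2 = φ + 1) (hφ1 : 1 < φ) (hφ2 : φ < 2)
    (hs : s ^ 2 = (3 - φ) / 5) (hS : x ^ 2 + y ^ 2 + z ^ 2 = 1) {P : ℝ}
    (hP : P = ((1 - (s * (y + z * φ)) ^ 2) * (1 - (s * (y - z * φ)) ^ 2)) *
        ((1 - (s * (z + x * φ)) ^ 2) * (1 - (s * (z - x * φ)) ^ 2)) *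
        ((1 - (s * (x + y * φ)) ^ 2) * (1 - (s * (x - y * φ)) ^ 2))) :
    P ≤ (16 / 45) ^ 3 ∧ (P = (16 / 45) ^ 3 →
      27 * icosaCubic φ (x ^ 2) (y ^ 2) (z ^ 2) = φ ^ 3) := by
  obtain ⟨u, hule, hsum, hprod⟩ := exists_icosa_forms hφ hφ2 hs hS
  rw [← hprod] at hP
  rw [hP]
  clear hprod hP P
  have hI := (icosaCubic_le hφ hφ1 (sq_nonneg x) (sq_nonneg y) (sq_nonneg z) (by linarith)).1
  rw [hS, one_pow, mul_one] at hI
  have hs4 : s ^ 4 = (2 - φ) / 5 := by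
    rw [show s ^ 4 = (s ^ 2) ^ 2 by ring, hs]; linear_combination hφ / 25
  have hs6 : s ^ 6 = (7 - 4 * φ) / 25 := by
    rw [show s ^ 6 = s ^ 2 * s ^ 4 by ring, hs, hs4]; linear_combination hφ / 25
  have m2 : ∑ i, u i ^ 2 = 2 * ((3 : ℕ) : ℝ) / 3 := by
    rw [hsum, icosa_moment_two hφ, hS, hs]; push_cast; linear_combination (-2 / 5) * hφ
  have m4 : ∑ i, u i ^ 4 = 2 * ((3 : ℕ) : ℝ) / 5 := by
    rw [hsum, icosa_moment_four hφ, hS, hs4]; push_cast; linear_combination (-6 / 5) * hφ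
  have m6 : ∑ i, u i ^ 6 = 34 * ((3 : ℕ) : ℝ) / 135 +
      (4 * φ - 2) * (7 - 4 * φ) / 225 * (φ ^ 3 - 27 * icosaCubic φ (x ^ 2) (y ^ 2) (z ^ 2)) := by
    rw [hsum, icosa_moment_six hφ, hS, hs6]
    clear hI hsum hS m2 m4 hule hs hs4 hs6
    generalize icosaCubic φ (x ^ 2) (y ^ 2) (z ^ 2) = J
    push_cast
    grind
  have hco : 0 < (4 * φ - 2) * (7 - 4 * φ) / 225 :=
    div_pos (mul_pos (by linarith) (by nlinarith)) (by norm_num)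
  have key := prod_one_sub_sq_le (m := 3) (by simp) hule m2 m4 (by
    rw [m6]
    linarith [mul_nonneg hco.le (sub_nonneg.2 hI)])
  refine ⟨key.1, fun h => ?_⟩
  have h1 := key.2 h
  rw [m6] at h1
  have h2 := (mul_eq_zero.1 (add_eq_left.1 h1)).resolve_left hco.ne'
  linarith

theorem icosa_forms_prod_eval {φ s x y z : ℝ} (hφ : φ ^ 2 = φ + 1) (hs : s ^ 2 = (3 - φ) / 5)
    (h : (x ^ 2 = 1 / 3 ∧ y ^ 2 = 1 / 3 ∧ z ^ 2 = 1 / 3) ∨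
      (x = 0 ∧ y ^ 2 = (φ + 1) / 3 ∧ z ^ 2 = (2 - φ) / 3) ∨
      (y = 0 ∧ z ^ 2 = (φ + 1) / 3 ∧ x ^ 2 = (2 - φ) / 3) ∨
      (z = 0 ∧ x ^ 2 = (φ + 1) / 3 ∧ y ^ 2 = (2 - φ) / 3)) :
    ((1 - (s * (y + z * φ)) ^ 2) * (1 - (s * (y - z * φ)) ^ 2)) *
      ((1 - (s * (z + x * φ)) ^ 2) * (1 - (s * (z - x * φ)) ^ 2)) *
      ((1 - (s * (x + y * φ)) ^ 2) * (1 - (s * (x - y * φ)) ^ 2)) = (16 / 45) ^ 3 := by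
  have hs4 : s ^ 4 = (2 - φ) / 5 := by
    rw [show s ^ 4 = (s ^ 2) ^ 2 by ring, hs]; linear_combination hφ / 25
  have hpair : ∀ {a b A B : ℝ}, a ^ 2 = A → b ^ 2 = B →
      (1 - (s * (a + b * φ)) ^ 2) * (1 - (s * (a - b * φ)) ^ 2) =
      1 - 2 * ((3 - φ) / 5 * A + (φ + 2) / 5 * B) + ((3 - φ) / 5 * A - (φ + 2) / 5 * B) ^ 2 := by
    rintro a b _ _ rfl rfl
    rw [show (φ + 2) / 5 = s ^ 2 * φ ^ 2 by rw [hs, hφ]; linear_combination hφ / 5, ← hs]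
    ring
  have key : ∀ {x y z : ℝ}, x = 0 → y ^ 2 = (φ + 1) / 3 → z ^ 2 = (2 - φ) / 3 →
    ((1 - (s * (y + z * φ)) ^ 2) * (1 - (s * (y - z * φ)) ^ 2)) *
      ((1 - (s * (z + x * φ)) ^ 2) * (1 - (s * (z - x * φ)) ^ 2)) *
      ((1 - (s * (x + y * φ)) ^ 2) * (1 - (s * (x - y * φ)) ^ 2)) = (16 / 45) ^ 3 := by
    intro x y z h0 h1 h2
    have h0' : x ^ 2 = 0 := by rw [h0]; norm_num
    rw [hpair h1 h2, hpair h2 h0', hpair h0' h1]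
    clear hpair hs hs4 h0 h1 h2 h0'
    grind
  rcases h with ⟨h0, h1, h2⟩ | ⟨h0, h1, h2⟩ | ⟨h0, h1, h2⟩ | ⟨h0, h1, h2⟩
  · rw [hpair h1 h2, hpair h2 h0, hpair h0 h1]
    clear hpair key hs hs4 h0 h1 h2
    grind
  · exact key h0 h1 h2
  · rw [← key h0 h1 h2]; ring
  · rw [← key h0 h1 h2]; ring

theorem forall_fin_three_iff {p : Fin 3 → Prop} : (∀ i, p i) ↔ p 0 ∧ p 1 ∧ p 2 := by
  rw [Fin.forall_fin_succ, Fin.forall_fin_two]; rfl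

theorem exists_fin_three_iff {p : Fin 3 → Fin 3 → Fin 3 → Prop} :
    (∃ i, p i (i + 1) (i + 2)) ↔ p 0 1 2 ∨ p 1 2 0 ∨ p 2 0 1 := by
  constructor
  · rintro ⟨i, h⟩
    fin_cases i
    exacts [Or.inl h, Or.inr (Or.inl h), Or.inr (Or.inr h)]
  · rintro (h | h | h)
    exacts [⟨0, h⟩, ⟨1, h⟩, ⟨2, h⟩]

theorem icosaCubic_maximizer {φ x y z : ℝ} (hφ : φ ^ 2 = φ + 1) (hφ1 : 1 < φ)
    (hS : x ^ 2 + y ^ 2 + z ^ 2 = 1)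
    (h : 27 * icosaCubic φ (x ^ 2) (y ^ 2) (z ^ 2) = φ ^ 3) :
    (x ^ 2 = 1 / 3 ∧ y ^ 2 = 1 / 3 ∧ z ^ 2 = 1 / 3) ∨
      (x = 0 ∧ y ^ 2 = (φ + 1) / 3 ∧ z ^ 2 = (2 - φ) / 3) ∨
      (y = 0 ∧ z ^ 2 = (φ + 1) / 3 ∧ x ^ 2 = (2 - φ) / 3) ∨
      (z = 0 ∧ x ^ 2 = (φ + 1) / 3 ∧ y ^ 2 = (2 - φ) / 3) := by
  have hI := icosaCubic_le hφ hφ1 (sq_nonneg x) (sq_nonneg y) (sq_nonneg z) (by linarith)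
  rw [hS, one_pow, mul_one] at hI
  have e : ∀ a b : ℝ, a = (3 * φ + 2) * b → a + b = 1 → a = (φ + 1) / 3 ∧ b = (2 - φ) / 3 := by
    intro a b h4 h5
    have h6 : b = (2 - φ) / 3 := by
      have : 3 * (φ + 1) * b = 1 := by linarith
      linear_combination (2 - φ) / 3 * this + b * hφ
    exact ⟨by linarith, h6⟩
  rcases hI.2 h with ⟨h4, h5⟩ | ⟨h4, h5⟩ | ⟨h4, h5⟩ | ⟨h4, h5⟩
  · exact Or.inl ⟨by linarith, by linarith, by linarith⟩
  · exact Or.inr (Or.inl ⟨pow_eq_zero_iff two_ne_zero |>.1 h4, e _ _ h5 (by linarith)⟩)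
  · exact Or.inr (Or.inr (Or.inl ⟨pow_eq_zero_iff two_ne_zero |>.1 h4, e _ _ h5 (by linarith)⟩))
  · exact Or.inr (Or.inr (Or.inr ⟨pow_eq_zero_iff two_ne_zero |>.1 h4, e _ _ h5 (by linarith)⟩))

theorem prod_icosaVec_max {q : Space} (hq : ‖q‖ = 1) :
    ∏ k, (1 + 1 / √(goldenRatio + 2) * inner ℝ q (icosaVec k)) ≤ (16 / 45) ^ 3 ∧
      (∏ k, (1 + 1 / √(goldenRatio + 2) * inner ℝ q (icosaVec k)) = (16 / 45) ^ 3 ↔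
        q ∈ Set.range fun k => (1 / √3) • dodecaVec k) := by
  have hS := space_sq_sum hq
  rw [mem_range_smul_dodecaVec, forall_fin_three_iff, exists_fin_three_iff (p := fun i j k =>
    q i = 0 ∧ q j ^ 2 = (goldenRatio + 1) / 3 ∧ q k ^ 2 = (2 - goldenRatio) / 3)]
  have key := icosa_forms_prod_le goldenRatio_sq one_lt_goldenRatio goldenRatio_lt_two
    inv_sqrt_golden_sq hS (prod_icosaVec _ q)
  refine ⟨key.1, fun h => icosaCubic_maximizer goldenRatio_sq one_lt_goldenRatio hS (key.2 h),
    fun h => ?_⟩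
  rw [prod_icosaVec]
  exact icosa_forms_prod_eval goldenRatio_sq inv_sqrt_golden_sq h

theorem sq_dodeca_form_le {φ s : ℝ} (hφ : φ ^ 2 = φ + 1) (hs : s ^ 2 = 1 / 3)
    {a b c : ℝ} (h : a ^ 2 + b ^ 2 + c ^ 2 = 1) : (s * (a * φ + b * (φ - 1))) ^ 2 ≤ 1 := by
  have e : 3 - (a * φ + b * (φ - 1)) ^ 2 = (a * (φ - 1) - b * φ) ^ 2 + 3 * c ^ 2 := by
    linear_combination (-3) * h - 2 * (a ^ 2 + b ^ 2) * hφ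
  rw [mul_pow, hs]
  nlinarith [sq_nonneg (a * (φ - 1) - b * φ), sq_nonneg c]

theorem sq_cube_form_le {s : ℝ} (hs : s ^ 2 = 1 / 3) {a b c : ℝ}
    (h : a ^ 2 + b ^ 2 + c ^ 2 = 1) : (s * (a + b + c)) ^ 2 ≤ 1 := by
  rw [mul_pow, hs]
  nlinarith [sq_nonneg (a - b), sq_nonneg (b - c), sq_nonneg (c - a)]

theorem exists_dodeca_forms {φ s x y z : ℝ} (hφ : φ ^ 2 = φ + 1)
    (hs : s ^ 2 = 1 / 3) (hS : x ^ 2 + y ^ 2 + z ^ 2 = 1) :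
    ∃ u : Fin 10 → ℝ, (∀ i, u i ^ 2 ≤ 1) ∧
      (∀ n : ℕ, ∑ i, u i ^ n = s ^ n *
        ((x + y + z) ^ n + (-x + y + z) ^ n + ((x - y + z) ^ n + (x + y - z) ^ n) +
        (((y * φ + z * (φ - 1)) ^ n + (y * φ - z * (φ - 1)) ^ n) +
        ((z * φ + x * (φ - 1)) ^ n + (z * φ - x * (φ - 1)) ^ n) +
        ((x * φ + y * (φ - 1)) ^ n + (x * φ - y * (φ - 1)) ^ n)))) ∧
      ∏ i, (1 - u i ^ 2) =
        ((1 - (s * (x + y + z)) ^ 2) * (1 - (s * (-x + y + z)) ^ 2) *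
          ((1 - (s * (x - y + z)) ^ 2) * (1 - (s * (x + y - z)) ^ 2))) *
        (((1 - (s * (y * φ + z * (φ - 1))) ^ 2) * (1 - (s * (y * φ - z * (φ - 1))) ^ 2)) *
        ((1 - (s * (z * φ + x * (φ - 1))) ^ 2) * (1 - (s * (z * φ - x * (φ - 1))) ^ 2)) *
        ((1 - (s * (x * φ + y * (φ - 1))) ^ 2) * (1 - (s * (x * φ - y * (φ - 1))) ^ 2))) := by
  refine ⟨![s * (x + y + z), s * (-x + y + z), s * (x - y + z), s * (x + y - z),
    s * (y * φ + z * (φ - 1)), s * (y * φ - z * (φ - 1)),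
    s * (z * φ + x * (φ - 1)), s * (z * φ - x * (φ - 1)),
    s * (x * φ + y * (φ - 1)), s * (x * φ - y * (φ - 1))], fun i => ?_, fun n => ?_, ?_⟩
  · have hcs : ∀ {a b c : ℝ}, a ^ 2 + b ^ 2 + c ^ 2 = 1 →
        (s * (a * φ - b * (φ - 1))) ^ 2 ≤ 1 := by
      intro a b c h
      have := sq_dodeca_form_le hφ hs (a := a) (b := -b) (c := c) (by rwa [neg_sq])
      rwa [neg_mul, ← sub_eq_add_neg] at this
    fin_cases i
    · exact sq_cube_form_le hs hS
    · exact sq_cube_form_le hs (by rwa [neg_sq])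
    · have := sq_cube_form_le hs (a := x) (b := -y) (c := z) (by rwa [neg_sq])
      rwa [← sub_eq_add_neg] at this
    · have := sq_cube_form_le hs (a := x) (b := y) (c := -z) (by rwa [neg_sq])
      rwa [← sub_eq_add_neg] at this
    · exact sq_dodeca_form_le hφ hs (c := x) (by linarith)
    · exact hcs (c := x) (by linarith)
    · exact sq_dodeca_form_le hφ hs (c := y) (by linarith)
    · exact hcs (c := y) (by linarith)
    · exact sq_dodeca_form_le hφ hs (c := z) (by linarith)
    · exact hcs (c := z) (by linarith)
  · rw [Fin.sum_univ_castSucc, Fin.sum_univ_castSucc, Fin.sum_univ_eight]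
    change (s * (x + y + z)) ^ n + (s * (-x + y + z)) ^ n + (s * (x - y + z)) ^ n +
      (s * (x + y - z)) ^ n + (s * (y * φ + z * (φ - 1))) ^ n + (s * (y * φ - z * (φ - 1))) ^ n +
      (s * (z * φ + x * (φ - 1))) ^ n + (s * (z * φ - x * (φ - 1))) ^ n +
      (s * (x * φ + y * (φ - 1))) ^ n + (s * (x * φ - y * (φ - 1))) ^ n = _
    simp only [mul_pow s, mul_add (s ^ n)]
    simp only [add_assoc]
  · rw [Fin.prod_univ_castSucc, Fin.prod_univ_castSucc, Fin.prod_univ_eight]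
    change (1 - (s * (x + y + z)) ^ 2) * (1 - (s * (-x + y + z)) ^ 2) *
      (1 - (s * (x - y + z)) ^ 2) * (1 - (s * (x + y - z)) ^ 2) *
      (1 - (s * (y * φ + z * (φ - 1))) ^ 2) * (1 - (s * (y * φ - z * (φ - 1))) ^ 2) *
      (1 - (s * (z * φ + x * (φ - 1))) ^ 2) * (1 - (s * (z * φ - x * (φ - 1))) ^ 2) *
      (1 - (s * (x * φ + y * (φ - 1))) ^ 2) * (1 - (s * (x * φ - y * (φ - 1))) ^ 2) = _
    simp only [mul_assoc]

theorem dodeca_forms_prod_le {φ s x y z : ℝ} (hφ : φ ^ 2 = φ + 1) (hφ1 : 1 < φ)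
    (hs : s ^ 2 = 1 / 3) (hS : x ^ 2 + y ^ 2 + z ^ 2 = 1) {P : ℝ}
    (hP : P = ((1 - (s * (x + y + z)) ^ 2) * (1 - (s * (-x + y + z)) ^ 2) *
          ((1 - (s * (x - y + z)) ^ 2) * (1 - (s * (x + y - z)) ^ 2))) *
        (((1 - (s * (y * φ + z * (φ - 1))) ^ 2) * (1 - (s * (y * φ - z * (φ - 1))) ^ 2)) *
        ((1 - (s * (z * φ + x * (φ - 1))) ^ 2) * (1 - (s * (z * φ - x * (φ - 1))) ^ 2)) *
        ((1 - (s * (x * φ + y * (φ - 1))) ^ 2) * (1 - (s * (x * φ - y * (φ - 1))) ^ 2)))) :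
    P ≤ (16 / 45) ^ 5 ∧ (P = (16 / 45) ^ 5 →
      5 * icosaCubic φ (x ^ 2) (y ^ 2) (z ^ 2) + φ ^ 3 = 0) := by
  obtain ⟨u, hule, hsum, hprod⟩ := exists_dodeca_forms hφ hs hS
  rw [← hprod] at hP
  rw [hP]
  clear hprod hP P
  have hI := (le_icosaCubic hφ hφ1 (sq_nonneg x) (sq_nonneg y) (sq_nonneg z) (by linarith)).1
  rw [hS, one_pow, mul_one] at hI
  have hs4 : s ^ 4 = 1 / 9 := by
    rw [show s ^ 4 = (s ^ 2) ^ 2 by ring, hs]; norm_num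
  have hs6 : s ^ 6 = 1 / 27 := by
    rw [show s ^ 6 = (s ^ 2) ^ 3 by ring, hs]; norm_num
  have m2 : ∑ i, u i ^ 2 = 2 * ((5 : ℕ) : ℝ) / 3 := by
    rw [hsum, dodeca_moment_two hφ, hS, hs]; norm_num
  have m4 : ∑ i, u i ^ 4 = 2 * ((5 : ℕ) : ℝ) / 5 := by
    rw [hsum, dodeca_moment_four hφ, hS, hs4]; norm_num
  have m6 : ∑ i, u i ^ 6 = 34 * ((5 : ℕ) : ℝ) / 135 +
      (12 * φ - 18) / 27 * (5 * icosaCubic φ (x ^ 2) (y ^ 2) (z ^ 2) + φ ^ 3) := by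
    rw [hsum, dodeca_moment_six hφ, hS, hs6]
    clear hI hsum hS m2 m4 hule hs hs4 hs6
    generalize icosaCubic φ (x ^ 2) (y ^ 2) (z ^ 2) = J
    push_cast
    grind
  have hco : 0 < (12 * φ - 18) / 27 := by
    have : 3 / 2 < φ := by nlinarith
    linarith
  have key := prod_one_sub_sq_le (m := 5) (by simp) hule m2 m4 (by
    rw [m6]
    linarith [mul_nonneg hco.le hI])
  refine ⟨key.1, fun h => ?_⟩
  have h1 := key.2 h
  rw [m6] at h1
  exact (mul_eq_zero.1 (add_eq_left.1 h1)).resolve_left hco.ne'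

theorem dodeca_forms_prod_eval {φ s x y z : ℝ} (hφ : φ ^ 2 = φ + 1) (hs : s ^ 2 = 1 / 3)
    (h : (x = 0 ∧ y ^ 2 = (3 - φ) / 5 ∧ z ^ 2 = (φ + 2) / 5) ∨
      (y = 0 ∧ z ^ 2 = (3 - φ) / 5 ∧ x ^ 2 = (φ + 2) / 5) ∨
      (z = 0 ∧ x ^ 2 = (3 - φ) / 5 ∧ y ^ 2 = (φ + 2) / 5)) :
    ((1 - (s * (x + y + z)) ^ 2) * (1 - (s * (-x + y + z)) ^ 2) *
        ((1 - (s * (x - y + z)) ^ 2) * (1 - (s * (x + y - z)) ^ 2))) *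
      (((1 - (s * (y * φ + z * (φ - 1))) ^ 2) * (1 - (s * (y * φ - z * (φ - 1))) ^ 2)) *
      ((1 - (s * (z * φ + x * (φ - 1))) ^ 2) * (1 - (s * (z * φ - x * (φ - 1))) ^ 2)) *
      ((1 - (s * (x * φ + y * (φ - 1))) ^ 2) * (1 - (s * (x * φ - y * (φ - 1))) ^ 2))) =
      (16 / 45) ^ 5 := by
  have hpair : ∀ {a b A B : ℝ}, a ^ 2 = A → b ^ 2 = B →
      (1 - (s * (a * φ + b * (φ - 1))) ^ 2) * (1 - (s * (a * φ - b * (φ - 1))) ^ 2) =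
      1 - 2 * ((φ + 1) / 3 * A + (2 - φ) / 3 * B) +
        ((φ + 1) / 3 * A - (2 - φ) / 3 * B) ^ 2 := by
    rintro a b _ _ rfl rfl
    rw [show (φ + 1) / 3 = s ^ 2 * φ ^ 2 by rw [hs, hφ]; ring,
      show (2 - φ) / 3 = s ^ 2 * (φ - 1) ^ 2 by rw [hs]; linear_combination -hφ / 3]
    ring
  have hcube : ∀ {a b A B : ℝ}, a ^ 2 = A → b ^ 2 = B →
      (1 - (s * (a + b)) ^ 2) * (1 - (s * (a - b)) ^ 2) =
      1 - 2 * (A / 3 + B / 3) + (A / 3 - B / 3) ^ 2 := by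
    rintro a b _ _ rfl rfl
    rw [show ∀ t : ℝ, t ^ 2 / 3 = s ^ 2 * t ^ 2 from fun t => by rw [hs]; ring,
      show ∀ t : ℝ, t ^ 2 / 3 = s ^ 2 * t ^ 2 from fun t => by rw [hs]; ring]
    ring
  have h00 : (0 : ℝ) ^ 2 = 0 := by norm_num
  have hfin : (1 - 2 * ((3 - φ) / 5 / 3 + (φ + 2) / 5 / 3) +
      ((3 - φ) / 5 / 3 - (φ + 2) / 5 / 3) ^ 2) ^ 2 *
      ((1 - 2 * ((φ + 1) / 3 * ((3 - φ) / 5) + (2 - φ) / 3 * ((φ + 2) / 5)) +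
        ((φ + 1) / 3 * ((3 - φ) / 5) - (2 - φ) / 3 * ((φ + 2) / 5)) ^ 2) *
      (1 - 2 * ((φ + 1) / 3 * ((φ + 2) / 5) + (2 - φ) / 3 * 0) +
        ((φ + 1) / 3 * ((φ + 2) / 5) - (2 - φ) / 3 * 0) ^ 2) *
      (1 - 2 * ((φ + 1) / 3 * 0 + (2 - φ) / 3 * ((3 - φ) / 5)) +
        ((φ + 1) / 3 * 0 - (2 - φ) / 3 * ((3 - φ) / 5)) ^ 2)) = (16 / 45) ^ 5 := by
    clear hpair hcube h hs
    grind
  rcases h with ⟨rfl, h1, h2⟩ | ⟨rfl, h1, h2⟩ | ⟨rfl, h1, h2⟩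
  · rw [hpair h1 h2, hpair h2 h00, hpair h00 h1, neg_zero, zero_add,
      show 0 - y + z = -(y - z) by ring, mul_neg, neg_sq,
      mul_mul_mul_comm (1 - (s * (y + z)) ^ 2), hcube h1 h2, ← sq]
    exact hfin
  · rw [hpair h00 h1, hpair h1 h2, hpair h2 h00, sub_zero, add_zero, add_zero,
      show x - z = -(z - x) by ring, show -x + z = z - x by ring, add_comm x z, mul_neg s (z - x),
      neg_sq, hcube h1 h2, ← sq, ← hfin]
    congr 1
    exact mul_rotate _ _ _
  · rw [hpair h2 h00, hpair h00 h1, hpair h1 h2, sub_zero, add_zero, add_zero, add_zero,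
      show -x + y = -(x - y) by ring, mul_neg, neg_sq, mul_comm (1 - (s * (x - y)) ^ 2),
      hcube h1 h2, ← sq, ← hfin]
    congr 1
    exact (mul_rotate _ _ _).symm

theorem icosaCubic_minimizer {φ x y z : ℝ} (hφ : φ ^ 2 = φ + 1) (hφ1 : 1 < φ)
    (hS : x ^ 2 + y ^ 2 + z ^ 2 = 1)
    (h : 5 * icosaCubic φ (x ^ 2) (y ^ 2) (z ^ 2) + φ ^ 3 = 0) :
    (x = 0 ∧ y ^ 2 = (3 - φ) / 5 ∧ z ^ 2 = (φ + 2) / 5) ∨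
      (y = 0 ∧ z ^ 2 = (3 - φ) / 5 ∧ x ^ 2 = (φ + 2) / 5) ∨
      (z = 0 ∧ x ^ 2 = (3 - φ) / 5 ∧ y ^ 2 = (φ + 2) / 5) := by
  have hI := le_icosaCubic hφ hφ1 (sq_nonneg x) (sq_nonneg y) (sq_nonneg z) (by linarith)
  rw [hS, one_pow, mul_one] at hI
  have e : ∀ a b : ℝ, b = (φ + 1) * a → a + b = 1 → a = (3 - φ) / 5 ∧ b = (φ + 2) / 5 := by
    intro a b h4 h5
    have h6 : a = (3 - φ) / 5 := by
      have : (φ + 2) * a = 1 := by linarith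
      linear_combination (3 - φ) / 5 * this + a / 5 * hφ
    exact ⟨h6, by linarith⟩
  rcases hI.2 h with ⟨h4, h5⟩ | ⟨h4, h5⟩ | ⟨h4, h5⟩
  · exact Or.inl ⟨pow_eq_zero_iff two_ne_zero |>.1 h4, e _ _ h5 (by linarith)⟩
  · exact Or.inr (Or.inl ⟨pow_eq_zero_iff two_ne_zero |>.1 h4, e _ _ h5 (by linarith)⟩)
  · exact Or.inr (Or.inr ⟨pow_eq_zero_iff two_ne_zero |>.1 h4, e _ _ h5 (by linarith)⟩)

theorem prod_dodecaVec_max {q : Space} (hq : ‖q‖ = 1) :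
    ∏ k, (1 + 1 / √3 * inner ℝ q (dodecaVec k)) ≤ (16 / 45) ^ 5 ∧
      (∏ k, (1 + 1 / √3 * inner ℝ q (dodecaVec k)) = (16 / 45) ^ 5 ↔
        q ∈ Set.range fun k => (1 / √(goldenRatio + 2)) • icosaVec k) := by
  have hS := space_sq_sum hq
  rw [mem_range_smul_icosaVec, exists_fin_three_iff (p := fun i j k =>
    q i = 0 ∧ q j ^ 2 = (3 - goldenRatio) / 5 ∧ q k ^ 2 = (goldenRatio + 2) / 5)]
  have key := dodeca_forms_prod_le goldenRatio_sq one_lt_goldenRatio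
    inv_sqrt_three_sq hS (prod_dodecaVec _ q)
  refine ⟨key.1, fun h => icosaCubic_minimizer goldenRatio_sq one_lt_goldenRatio hS (key.2 h),
    fun h => ?_⟩
  rw [prod_dodecaVec]
  exact dodeca_forms_prod_eval goldenRatio_sq inv_sqrt_three_sq h

/-! ### Dual vertices -/

/-- The vertex `w k` of the family `w` is farthest in direction `u`. -/
def Exposed {κ : Type*} (w : κ → Space) (u : Space) (k : κ) : Prop :=
  ∀ m, inner ℝ u (w m) ≤ inner ℝ u (w k)

/-- At least three vertices of the family `w` are farthest in direction `u`. -/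
def ExposesFace {κ : Type*} (w : κ → Space) (u : Space) : Prop :=
  ∃ a b c, a ≠ b ∧ a ≠ c ∧ b ≠ c ∧ Exposed w u a ∧ Exposed w u b ∧ Exposed w u c

theorem finrank_vectorSpan_exposedVertices_le (V : Set Space) {u : Space} (hu : u ≠ 0) :
    Module.finrank ℝ (vectorSpan ℝ (exposedVertices V u)) ≤ 2 := by
  have h1 : vectorSpan ℝ (exposedVertices V u) ≤ (ℝ ∙ u)ᗮ := by
    rw [vectorSpan_def, Submodule.span_le]
    rintro _ ⟨v, hv, w, hw, rfl⟩
    rw [SetLike.mem_coe, Submodule.mem_orthogonal_singleton_iff_inner_right]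
    change inner ℝ u (v - w) = 0
    rw [inner_sub_right, sub_eq_zero]
    exact le_antisymm (hw.2 v hv.1) (hv.2 w hw.1)
  have : Fact (Module.finrank ℝ Space = 2 + 1) := ⟨by simp⟩
  rw [← Submodule.finrank_orthogonal_span_singleton (𝕜 := ℝ) (n := 2) hu]
  exact Submodule.finrank_mono h1

theorem finrank_vectorSpan_eq_two_iff {E : Set Space} {R : ℝ} (hE : ∀ v ∈ E, ‖v‖ = R)
    (h2 : Module.finrank ℝ (vectorSpan ℝ E) ≤ 2) :
    Module.finrank ℝ (vectorSpan ℝ E) = 2 ↔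
      ∃ a ∈ E, ∃ b ∈ E, ∃ c ∈ E, a ≠ b ∧ a ≠ c ∧ b ≠ c := by
  constructor
  · intro h
    by_contra! hcon
    have hcol : Collinear ℝ E := by
      rcases E.eq_empty_or_nonempty with rfl | ⟨a, ha⟩
      · exact collinear_empty ℝ _
      by_cases hb : ∃ b ∈ E, a ≠ b
      · obtain ⟨b, hb, hab⟩ := hb
        refine (collinear_pair ℝ a b).subset fun c hc => ?_
        by_cases hac : a = c
        · exact Or.inl hac.symm
        · exact Or.inr (hcon a ha b hb c hc hab hac).symm
      · push Not at hb
        exact (collinear_singleton ℝ a).subset fun c hc => (hb c hc).symm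
    have := collinear_iff_finrank_le_one.1 hcol
    omega
  · rintro ⟨a, ha, b, hb, c, hc, hab, hac, hbc⟩
    refine le_antisymm h2 ?_
    have hcos : EuclideanGeometry.Cospherical ({a, b, c} : Set Space) :=
      ⟨0, R, by
        rintro p (rfl | rfl | rfl)
        · rw [dist_zero_right, hE _ ha]
        · rw [dist_zero_right, hE _ hb]
        · rw [dist_zero_right, hE _ hc]⟩
    have hind := hcos.affineIndependent_of_ne hab hac hbc
    have hr := hind.finrank_vectorSpan (n := 2) (by simp)
    rw [← hr]
    refine Submodule.finrank_mono (vectorSpan_mono ℝ ?_)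
    rintro _ ⟨i, rfl⟩
    fin_cases i
    exacts [ha, hb, hc]

theorem mem_exposedVertices_iff {κ : Type*} {w : κ → Space} {s : ℝ} (hs : 0 < s)
    (g : Space ≃ₗᵢ[ℝ] Space) (u : Space) (v : Space) :
    v ∈ exposedVertices (Set.range fun k => s • g (w k)) (g u) ↔
      ∃ k, Exposed w u k ∧ s • g (w k) = v := by
  have hin : ∀ k, inner ℝ (g u) (s • g (w k)) = s * inner ℝ u (w k) := fun k => by
    rw [inner_smul_right, g.inner_map_map]
  constructor
  · rintro ⟨⟨k, rfl⟩, h⟩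
    refine ⟨k, fun m => ?_, rfl⟩
    have := h _ ⟨m, rfl⟩
    simp only [hin] at this
    exact le_of_mul_le_mul_left this hs
  · rintro ⟨k, hk, rfl⟩
    refine ⟨⟨k, rfl⟩, ?_⟩
    rintro _ ⟨m, rfl⟩
    simp only [hin]
    exact mul_le_mul_of_nonneg_left (hk m) hs.le

theorem dualVertices_range {κ : Type*} {w : κ → Space} (hw : Function.Injective w) {R s : ℝ}
    (hR : ∀ k, ‖w k‖ = R) (hs : 0 < s) (g : Space ≃ₗᵢ[ℝ] Space) :
    dualVertices (Set.range fun k => s • g (w k)) = g '' {u | ‖u‖ = 1 ∧ ExposesFace w u} := by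
  have hinj : Function.Injective fun k => s • g (w k) := fun a b h =>
    hw (g.injective (smul_right_injective _ hs.ne' h))
  have key : ∀ u, g u ∈ dualVertices (Set.range fun k => s • g (w k)) ↔
      ‖u‖ = 1 ∧ ExposesFace w u := by
    intro u
    rw [dualVertices, Set.mem_ofPred_eq, g.norm_map]
    refine and_congr_right fun hu => ?_
    have hu0 : g u ≠ 0 := by
      rw [← norm_ne_zero_iff, g.norm_map, hu]
      exact one_ne_zero
    rw [finrank_vectorSpan_eq_two_iff (R := s * R) ?_ (finrank_vectorSpan_exposedVertices_le _ hu0)]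
    · simp only [mem_exposedVertices_iff hs]
      constructor
      · rintro ⟨_, ⟨a, ha, rfl⟩, _, ⟨b, hb, rfl⟩, _, ⟨c, hc, rfl⟩, hab, hac, hbc⟩
        exact ⟨a, b, c, fun h => hab (h ▸ rfl), fun h => hac (h ▸ rfl), fun h => hbc (h ▸ rfl),
          ha, hb, hc⟩
      · rintro ⟨a, b, c, hab, hac, hbc, ha, hb, hc⟩
        exact ⟨_, ⟨a, ha, rfl⟩, _, ⟨b, hb, rfl⟩, _, ⟨c, hc, rfl⟩, hinj.ne hab, hinj.ne hac,
          hinj.ne hbc⟩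
    · intro v hv
      obtain ⟨k, -, rfl⟩ := (mem_exposedVertices_iff hs g u v).1 hv
      rw [norm_smul, g.norm_map, hR, Real.norm_of_nonneg hs.le]
  ext p
  obtain ⟨u, rfl⟩ := g.surjective p
  rw [key, g.injective.mem_set_image, Set.mem_ofPred_eq]

theorem sgn_mul_le_abs (b : Bool) (x : ℝ) : sgn b * x ≤ |x| := by
  cases b
  · simpa using neg_le_abs x
  · simpa using le_abs_self x

theorem exists_sgn_mul_eq_abs (x : ℝ) : ∃ b, sgn b * x = |x| := by
  rcases abs_choice x with h | h
  · exact ⟨true, by simp [h]⟩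
  · exact ⟨false, by simp [h]⟩

theorem eq_of_sgn_mul_eq_abs {x : ℝ} (hx : x ≠ 0) {a b : Bool} (ha : sgn a * x = |x|)
    (hb : sgn b * x = |x|) : a = b :=
  sgn_injective (mul_right_cancel₀ hx (ha.trans hb.symm))

theorem exposed_iff {κ τ : Type*} {w : κ → Space} {u : Space} {cls : κ → τ} {A : τ → ℝ}
    (hle : ∀ k, inner ℝ u (w k) ≤ A (cls k))
    (hex : ∀ t, ∃ k, cls k = t ∧ inner ℝ u (w k) = A t) (k : κ) :
    Exposed w u k ↔ inner ℝ u (w k) = A (cls k) ∧ ∀ t, A t ≤ A (cls k) := by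
  constructor
  · intro h
    have h1 : ∀ t, A t ≤ inner ℝ u (w k) := fun t => by
      obtain ⟨m, -, hm⟩ := hex t
      rw [← hm]
      exact h m
    exact ⟨le_antisymm (hle k) (h1 _), fun t => (h1 t).trans (hle k)⟩
  · rintro ⟨h1, h2⟩ m
    rw [h1]
    exact (hle m).trans (h2 _)

theorem not_three_of_range_bool {κ : Type*} (f : Bool → κ) {a b c : κ} (hab : a ≠ b) (hac : a ≠ c)
    (hbc : b ≠ c) (ha : ∃ t, f t = a) (hb : ∃ t, f t = b) (hc : ∃ t, f t = c) : False := by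
  obtain ⟨x, rfl⟩ := ha
  obtain ⟨y, rfl⟩ := hb
  obtain ⟨z, rfl⟩ := hc
  cases x <;> cases y <;> cases z <;> contradiction

theorem eq_or_eq_or_eq_of_ne {a b c : Fin 3} (hab : a ≠ b) (hac : a ≠ c) (hbc : b ≠ c)
    (i : Fin 3) : i = a ∨ i = b ∨ i = c := by omega

theorem add_sgn_forms_eq_iff {p q x y : ℝ} (hp : 0 < p) (hq : 0 < q) (b c : Bool) :
    p * (sgn b * x) + q * (sgn c * y) = p * |x| + q * |y| ↔
      sgn b * x = |x| ∧ sgn c * y = |y| := by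
  constructor
  · intro h
    have h1 := mul_le_mul_of_nonneg_left (sgn_mul_le_abs b x) hp.le
    have h2 := mul_le_mul_of_nonneg_left (sgn_mul_le_abs c y) hq.le
    exact ⟨mul_left_cancel₀ hp.ne' (by linarith), mul_left_cancel₀ hq.ne' (by linarith)⟩
  · rintro ⟨h1, h2⟩
    rw [h1, h2]

theorem add_sgn_forms_le {p q x y : ℝ} (hp : 0 < p) (hq : 0 < q) (b c : Bool) :
    p * (sgn b * x) + q * (sgn c * y) ≤ p * |x| + q * |y| :=
  add_le_add (mul_le_mul_of_nonneg_left (sgn_mul_le_abs b x) hp.le)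
    (mul_le_mul_of_nonneg_left (sgn_mul_le_abs c y) hq.le)

/-! #### The octahedron -/

theorem inner_octaVec (u : Space) (k : Fin 3 × Bool) :
    inner ℝ u (octaVec k) = sgn k.2 * u (k.1 + 2) := by
  rw [octaVec, inner_cycVec]; ring

theorem exposed_octaVec_iff (u : Space) (k : Fin 3 × Bool) : Exposed octaVec u k ↔
    sgn k.2 * u (k.1 + 2) = |u (k.1 + 2)| ∧ ∀ j : Fin 3, |u (j + 2)| ≤ |u (k.1 + 2)| := by
  rw [exposed_iff (cls := Prod.fst) (A := fun j : Fin 3 => |u (j + 2)|), inner_octaVec]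
  · intro k
    rw [inner_octaVec]
    exact sgn_mul_le_abs _ _
  · intro i
    obtain ⟨b, hb⟩ := exists_sgn_mul_eq_abs (u (i + 2))
    exact ⟨(i, b), rfl, by rw [inner_octaVec, hb]⟩

theorem exposesFace_octaVec_iff {u : Space} (hu : ‖u‖ = 1) :
    ExposesFace octaVec u ↔ u ∈ Set.range fun k => (1 / √3) • cubeVec k := by
  have hS := space_sq_sum hu
  rw [mem_range_smul_cubeVec]
  constructor
  · rintro ⟨a, b, c, hab, hac, hbc, ha, hb, hc⟩
    rw [exposed_octaVec_iff] at ha hb hc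
    have hne : ∀ i : Fin 3, (∀ j : Fin 3, |u (j + 2)| ≤ |u (i + 2)|) → u (i + 2) ≠ 0 := by
      intro i hi h0
      have hz : ∀ j : Fin 3, u (j + 2) = 0 := fun j => by
        have := hi j
        rw [h0, abs_zero] at this
        exact abs_eq_zero.1 (le_antisymm this (abs_nonneg _))
      have h1 : u 0 = 0 := hz 1
      have h2 : u 1 = 0 := hz 2
      have h3 : u 2 = 0 := hz 0
      rw [h1, h2, h3] at hS
      norm_num at hS
    have hcl : ∀ {k l : Fin 3 × Bool}, k ≠ l →
        (sgn k.2 * u (k.1 + 2) = |u (k.1 + 2)| ∧ ∀ j : Fin 3, |u (j + 2)| ≤ |u (k.1 + 2)|) →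
        (sgn l.2 * u (l.1 + 2) = |u (l.1 + 2)| ∧ ∀ j : Fin 3, |u (j + 2)| ≤ |u (l.1 + 2)|) →
        k.1 ≠ l.1 := by
      rintro ⟨i, x⟩ ⟨j, y⟩ hkl hk hl (rfl : i = j)
      exact hkl (Prod.ext rfl (eq_of_sgn_mul_eq_abs (hne _ hk.2) hk.1 hl.1))
    have hall : ∀ i j : Fin 3, |u (j + 2)| ≤ |u (i + 2)| := fun i => by
      rcases eq_or_eq_or_eq_of_ne (hcl hab ha hb) (hcl hac ha hc) (hcl hbc hb hc) i with
        rfl | rfl | rfl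
      exacts [ha.2, hb.2, hc.2]
    have h1 : u 0 ^ 2 = u 1 ^ 2 := sq_eq_sq_iff_abs_eq_abs _ _ |>.2 (le_antisymm (hall 2 1) (hall 1 2))
    have h2 : u 0 ^ 2 = u 2 ^ 2 := sq_eq_sq_iff_abs_eq_abs _ _ |>.2 (le_antisymm (hall 0 1) (hall 1 0))
    rw [forall_fin_three_iff]
    exact ⟨by linarith, by linarith, by linarith⟩
  · intro h
    have hA : ∀ i j : Fin 3, |u i| ≤ |u j| := fun i j =>
      (sq_eq_sq_iff_abs_eq_abs _ _ |>.1 ((h i).trans (h j).symm)).le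
    choose b hb using fun i : Fin 3 => exists_sgn_mul_eq_abs (u (i + 2))
    have hE : ∀ i, Exposed octaVec u (i, b i) := fun i =>
      (exposed_octaVec_iff u (i, b i)).2 ⟨hb i, fun j => hA _ _⟩
    exact ⟨(0, b 0), (1, b 1), (2, b 2), by simp,
      by simp,
      by simp, hE 0, hE 1, hE 2⟩

/-! #### The cube -/

theorem inner_cubeVec (u : Space) (k : Bool × Bool × Bool) :
    inner ℝ u (cubeVec k) = sgn k.1 * u 0 + sgn k.2.1 * u 1 + sgn k.2.2 * u 2 := by
  rw [cubeVec, inner_cycVec, zero_add, zero_add]; ring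

theorem inner_cubeVec_le (u : Space) (k : Bool × Bool × Bool) :
    inner ℝ u (cubeVec k) ≤ |u 0| + |u 1| + |u 2| := by
  rw [inner_cubeVec]
  exact add_le_add (add_le_add (sgn_mul_le_abs _ _) (sgn_mul_le_abs _ _)) (sgn_mul_le_abs _ _)

theorem inner_cubeVec_eq_iff (u : Space) (k : Bool × Bool × Bool) :
    inner ℝ u (cubeVec k) = |u 0| + |u 1| + |u 2| ↔
      sgn k.1 * u 0 = |u 0| ∧ sgn k.2.1 * u 1 = |u 1| ∧ sgn k.2.2 * u 2 = |u 2| := by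
  rw [inner_cubeVec]
  constructor
  · intro h
    have h1 := sgn_mul_le_abs k.1 (u 0)
    have h2 := sgn_mul_le_abs k.2.1 (u 1)
    have h3 := sgn_mul_le_abs k.2.2 (u 2)
    exact ⟨by linarith, by linarith, by linarith⟩
  · rintro ⟨h1, h2, h3⟩
    rw [h1, h2, h3]

theorem exists_inner_cubeVec_eq (u : Space) :
    ∃ k, inner ℝ u (cubeVec k) = |u 0| + |u 1| + |u 2| := by
  obtain ⟨a, ha⟩ := exists_sgn_mul_eq_abs (u 0)
  obtain ⟨b, hb⟩ := exists_sgn_mul_eq_abs (u 1)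
  obtain ⟨c, hc⟩ := exists_sgn_mul_eq_abs (u 2)
  exact ⟨(a, b, c), (inner_cubeVec_eq_iff u _).2 ⟨ha, hb, hc⟩⟩

theorem exposed_cubeVec_iff (u : Space) (k : Bool × Bool × Bool) : Exposed cubeVec u k ↔
    sgn k.1 * u 0 = |u 0| ∧ sgn k.2.1 * u 1 = |u 1| ∧ sgn k.2.2 * u 2 = |u 2| := by
  rw [exposed_iff (cls := fun _ => ()) (A := fun _ => |u 0| + |u 1| + |u 2|) (inner_cubeVec_le u),
    inner_cubeVec_eq_iff, and_iff_left fun _ => le_rfl]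
  intro _
  obtain ⟨k, hk⟩ := exists_inner_cubeVec_eq u
  exact ⟨k, rfl, hk⟩

theorem exposesFace_cubeVec_iff {u : Space} (hu : ‖u‖ = 1) :
    ExposesFace cubeVec u ↔ u ∈ Set.range fun k => (1 : ℝ) • octaVec k := by
  have hS := space_sq_sum hu
  rw [mem_range_smul_octaVec, exists_fin_three_iff (p := fun i j k =>
    u i = 0 ∧ u j = 0 ∧ u k ^ 2 = 1)]
  obtain ⟨x, hx⟩ := exists_sgn_mul_eq_abs (u 0)
  obtain ⟨y, hy⟩ := exists_sgn_mul_eq_abs (u 1)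
  obtain ⟨z, hz⟩ := exists_sgn_mul_eq_abs (u 2)
  constructor
  · rintro ⟨a, b, c, hab, hac, hbc, ha, hb, hc⟩
    rw [exposed_cubeVec_iff] at ha hb hc
    have h01 : u 0 = 0 ∨ u 1 = 0 := by
      by_contra! h
      have key : ∀ {k : Bool × Bool × Bool}, sgn k.1 * u 0 = |u 0| ∧ sgn k.2.1 * u 1 = |u 1| ∧
          sgn k.2.2 * u 2 = |u 2| → ∃ t, (x, y, t) = k := fun {k} hk =>
        ⟨k.2.2, Prod.ext (eq_of_sgn_mul_eq_abs h.1 hx hk.1)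
          (Prod.ext (eq_of_sgn_mul_eq_abs h.2 hy hk.2.1) rfl)⟩
      exact not_three_of_range_bool _ hab hac hbc (key ha) (key hb) (key hc)
    have h02 : u 0 = 0 ∨ u 2 = 0 := by
      by_contra! h
      have key : ∀ {k : Bool × Bool × Bool}, sgn k.1 * u 0 = |u 0| ∧ sgn k.2.1 * u 1 = |u 1| ∧
          sgn k.2.2 * u 2 = |u 2| → ∃ t, (x, t, z) = k := fun {k} hk =>
        ⟨k.2.1, Prod.ext (eq_of_sgn_mul_eq_abs h.1 hx hk.1)
          (Prod.ext rfl (eq_of_sgn_mul_eq_abs h.2 hz hk.2.2))⟩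
      exact not_three_of_range_bool _ hab hac hbc (key ha) (key hb) (key hc)
    have h12 : u 1 = 0 ∨ u 2 = 0 := by
      by_contra! h
      have key : ∀ {k : Bool × Bool × Bool}, sgn k.1 * u 0 = |u 0| ∧ sgn k.2.1 * u 1 = |u 1| ∧
          sgn k.2.2 * u 2 = |u 2| → ∃ t, (t, y, z) = k := fun {k} hk =>
        ⟨k.1, Prod.ext rfl (Prod.ext (eq_of_sgn_mul_eq_abs h.1 hy hk.2.1)
          (eq_of_sgn_mul_eq_abs h.2 hz hk.2.2))⟩
      exact not_three_of_range_bool _ hab hac hbc (key ha) (key hb) (key hc)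
    rcases h01 with h | h <;> rcases h12 with h' | h' <;> rcases h02 with h'' | h'' <;>
      simp_all
  · simp only [ExposesFace, exposed_cubeVec_iff]
    rintro (⟨h0, h1, -⟩ | ⟨h0, h1, -⟩ | ⟨h0, h1, -⟩)
    · exact ⟨(true, true, z), (true, false, z), (false, true, z), by simp, by simp, by simp,
        by simp [h0, h1, hz], by simp [h0, h1, hz], by simp [h0, h1, hz]⟩
    · exact ⟨(x, true, true), (x, true, false), (x, false, true), by simp, by simp, by simp,
        by simp [h0, h1, hx], by simp [h0, h1, hx], by simp [h0, h1, hx]⟩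
    · exact ⟨(true, y, true), (true, y, false), (false, y, true), by simp, by simp, by simp,
        by simp [h0, h1, hy], by simp [h0, h1, hy], by simp [h0, h1, hy]⟩

/-! #### The tetrahedron -/

theorem inner_tetraVec (u : Space) (k : Bool × Bool) :
    inner ℝ u (tetraVec k) = sgn k.1 * u 0 + sgn k.2 * u 1 + sgn k.1 * sgn k.2 * u 2 := by
  rw [tetraVec, inner_cycVec, zero_add, zero_add]; ring

theorem exposesFace_tetraVec_iff {u : Space} (hu : ‖u‖ = 1) :
    ExposesFace tetraVec u ↔ u ∈ Set.range fun k => -((1 / √3) • tetraVec k) := by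
  have hS := space_sq_sum hu
  have hs := inv_sqrt_three_sq
  have hs0 : 0 < 1 / √3 := by positivity
  generalize 1 / √3 = s at *
  have hmem : u ∈ (Set.range fun k => -(s • tetraVec k)) ↔
      ∃ k : Bool × Bool, u 0 = -(s * sgn k.1) ∧ u 1 = -(s * sgn k.2) ∧
        u 2 = -(s * (sgn k.1 * sgn k.2)) := by
    constructor
    · rintro ⟨k, rfl⟩
      exact ⟨k, rfl, rfl, rfl⟩
    · rintro ⟨k, h0, h1, h2⟩
      refine ⟨k, ?_⟩
      ext i
      fin_cases i
      exacts [h0.symm, h1.symm, h2.symm]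
  rw [hmem]
  constructor
  · rintro ⟨a, b, c, hab, hac, hbc, ha, hb, hc⟩
    have hpig : ∀ a b c : Bool × Bool, a ≠ b → a ≠ c → b ≠ c →
        ∃ m, ∀ k, k ≠ m → k = a ∨ k = b ∨ k = c := fun a b c hab hac hbc => by
      have hcard : ({a, b, c} : Finset (Bool × Bool)).card = 3 :=
        Finset.card_eq_three.2 ⟨a, b, c, hab, hac, hbc, rfl⟩
      have hcompl : ({a, b, c} : Finset (Bool × Bool))ᶜ.card = 1 := by
        rw [Finset.card_compl, hcard]; rfl
      obtain ⟨m, hm⟩ := Finset.card_eq_one.1 hcompl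
      refine ⟨m, fun k hk => ?_⟩
      have : k ∉ ({a, b, c} : Finset (Bool × Bool))ᶜ := by rw [hm]; simpa using hk
      simpa only [Finset.mem_compl, Finset.mem_insert, Finset.mem_singleton, not_not] using this
    obtain ⟨m, hm⟩ := hpig a b c hab hac hbc
    have hE : ∀ k, k ≠ m → Exposed tetraVec u k := fun k hk => by
      rcases hm k hk with rfl | rfl | rfl
      exacts [ha, hb, hc]
    clear ha hb hc hm hpig hab hac hbc
    simp only [Exposed, inner_tetraVec] at hE
    have hfin : ∀ t : ℝ, t ≤ 0 → t ^ 2 = 1 / 3 → t = -s := fun t ht h => by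
      have : t ^ 2 = (-s) ^ 2 := by rw [h, neg_sq, hs]
      rcases sq_eq_sq_iff_eq_or_eq_neg.1 this with h1 | h1
      · exact h1
      · linarith
    refine ⟨m, ?_⟩
    obtain ⟨m1, m2⟩ := m
    have e1 := hE (!m1, m2) (by simp) (m1, !m2)
    have e2 := hE (m1, !m2) (by simp) (!m1, m2)
    have e3 := hE (!m1, m2) (by simp) (!m1, !m2)
    have e4 := hE (!m1, !m2) (by simp) (!m1, m2)
    have e5 := hE (!m1, m2) (by simp) (m1, m2)
    clear hE
    generalize u 0 = x at *; generalize u 1 = y at *; generalize u 2 = z at *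
    cases m1 <;> cases m2 <;> simp at e1 e2 e3 e4 e5 ⊢
    · have h1 : x = y := by linarith
      have h2 : z = -x := by linarith
      subst h1 h2
      have := hfin (-x) (by linarith) (by linarith)
      refine ⟨?_, ?_, ?_⟩ <;> linarith
    · have h1 : y = -x := by linarith
      have h2 : x = z := by linarith
      subst h1 h2
      have := hfin (-x) (by linarith) (by linarith)
      refine ⟨?_, ?_, ?_⟩ <;> linarith
    · have h1 : y = -x := by linarith
      have h2 : z = y := by linarith
      subst h1 h2
      have := hfin x (by linarith) (by linarith)
      refine ⟨?_, ?_, ?_⟩ <;> linarith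
    · have h1 : x = y := by linarith
      have h2 : x = z := by linarith
      subst h1 h2
      have := hfin x (by linarith) (by linarith)
      refine ⟨?_, ?_, ?_⟩ <;> linarith
  · rintro ⟨⟨m1, m2⟩, h0, h1, h2⟩
    refine ⟨(!m1, m2), (m1, !m2), (!m1, !m2), by simp, by simp, by simp, ?_⟩
    simp only [Exposed, inner_tetraVec, h0, h1, h2]
    cases m1 <;> cases m2 <;> simp <;> linarith

/-! #### The icosahedron -/

theorem inner_icosaVec (u : Space) (k : Fin 3 × Bool × Bool) : inner ℝ u (icosaVec k) =
    1 * (sgn k.2.1 * u (k.1 + 1)) + goldenRatio * (sgn k.2.2 * u (k.1 + 2)) := by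
  rw [icosaVec, inner_cycVec]; ring

theorem exposed_icosaVec_iff (u : Space) (k : Fin 3 × Bool × Bool) : Exposed icosaVec u k ↔
    (sgn k.2.1 * u (k.1 + 1) = |u (k.1 + 1)| ∧ sgn k.2.2 * u (k.1 + 2) = |u (k.1 + 2)|) ∧
    ∀ j : Fin 3, 1 * |u (j + 1)| + goldenRatio * |u (j + 2)| ≤
      1 * |u (k.1 + 1)| + goldenRatio * |u (k.1 + 2)| := by
  rw [exposed_iff (cls := Prod.fst)
    (A := fun j : Fin 3 => 1 * |u (j + 1)| + goldenRatio * |u (j + 2)|), inner_icosaVec,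
    add_sgn_forms_eq_iff one_pos goldenRatio_pos]
  · intro k
    rw [inner_icosaVec]
    exact add_sgn_forms_le one_pos goldenRatio_pos _ _
  · intro i
    obtain ⟨b, hb⟩ := exists_sgn_mul_eq_abs (u (i + 1))
    obtain ⟨c, hc⟩ := exists_sgn_mul_eq_abs (u (i + 2))
    exact ⟨(i, b, c), rfl, by rw [inner_icosaVec, hb, hc]⟩

/-- Quantification over `Fin 3` starting from an arbitrary index. -/
theorem forall_fin_three_iff' {p : Fin 3 → Prop} (i : Fin 3) :
    (∀ j, p j) ↔ p i ∧ p (i + 1) ∧ p (i + 2) := by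
  refine ⟨fun h => ⟨h _, h _, h _⟩, fun ⟨h0, h1, h2⟩ j => ?_⟩
  have : j = i ∨ j = i + 1 ∨ j = i + 2 := by omega
  rcases this with rfl | rfl | rfl
  exacts [h0, h1, h2]

theorem space_sq_sum' {u : Space} (hu : ‖u‖ = 1) (i : Fin 3) :
    u i ^ 2 + u (i + 1) ^ 2 + u (i + 2) ^ 2 = 1 := by
  have := space_sq_sum hu
  fin_cases i
  · exact this
  · change u 1 ^ 2 + u 2 ^ 2 + u 0 ^ 2 = 1; linarith
  · change u 2 ^ 2 + u 0 ^ 2 + u 1 ^ 2 = 1; linarith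

theorem add_one_add_one (i : Fin 3) : i + 1 + 1 = i + 2 := by omega
theorem add_one_add_two (i : Fin 3) : i + 1 + 2 = i := by omega
theorem add_two_add_one (i : Fin 3) : i + 2 + 1 = i := by omega
theorem add_two_add_two (i : Fin 3) : i + 2 + 2 = i + 1 := by omega

theorem sq_eq_of_abs_eq_mul {a b r : ℝ} (h : |a| = r * |b|) : a ^ 2 = r ^ 2 * b ^ 2 := by
  rw [← sq_abs a, h, mul_pow, sq_abs]

theorem exposesFace_icosaVec_iff {u : Space} (hu : ‖u‖ = 1) :
    ExposesFace icosaVec u ↔ u ∈ Set.range fun k => (1 / √3) • dodecaVec k := by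
  rw [mem_range_smul_dodecaVec]
  have hφ := goldenRatio_sq
  have hφ1 := one_lt_goldenRatio
  have hE := exposed_icosaVec_iff u
  unfold ExposesFace
  generalize Exposed icosaVec u = E at *
  simp only [one_mul] at hE
  generalize goldenRatio = φ at *
  have hφ0 : 0 < φ := by linarith
  constructor
  · rintro ⟨a, b, c, hab, hac, hbc, ha, hb, hc⟩
    by_cases hne : ∀ i, u i ≠ 0
    · left
      have hcl : ∀ {k l}, k ≠ l → E k → E l → k.1 ≠ l.1 := by
        rintro ⟨i, x, x'⟩ ⟨j, y, y'⟩ hkl hk hl (rfl : i = j)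
        rw [hE] at hk hl
        exact hkl (Prod.ext rfl (Prod.ext (eq_of_sgn_mul_eq_abs (hne _) hk.1.1 hl.1.1)
          (eq_of_sgn_mul_eq_abs (hne _) hk.1.2 hl.1.2)))
      have hall : ∀ i j : Fin 3, |u (j + 1)| + φ * |u (j + 2)| ≤
          |u (i + 1)| + φ * |u (i + 2)| := fun i => by
        rcases eq_or_eq_or_eq_of_ne (hcl hab ha hb) (hcl hac ha hc) (hcl hbc hb hc) i
          with rfl | rfl | rfl
        exacts [((hE _).1 ha).2, ((hE _).1 hb).2, ((hE _).1 hc).2]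
      have e1 : |u 1| + φ * |u 2| = |u 2| + φ * |u 0| := le_antisymm (hall 1 0) (hall 0 1)
      have e2 : |u 1| + φ * |u 2| = |u 0| + φ * |u 1| := le_antisymm (hall 2 0) (hall 0 2)
      have hS := space_sq_sum hu
      rw [forall_fin_three_iff]
      rw [← sq_abs (u 0), ← sq_abs (u 1), ← sq_abs (u 2)] at hS ⊢
      clear hE hall hcl hne
      generalize |u 0| = x at *; generalize |u 1| = y at *; generalize |u 2| = z at *
      have h1 : 2 * (y - z) = 0 := by linear_combination e1 - φ * e2 - (y - z) * hφ
      have hz : y = z := by linarith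
      rw [hz] at e2
      have hx : x = z := by linarith
      rw [hz, hx] at hS ⊢
      exact ⟨by linarith, by linarith, by linarith⟩
    · right
      push Not at hne
      obtain ⟨i, hi⟩ := hne
      refine ⟨i, hi, ?_⟩
      have hS := space_sq_sum' hu i
      have hY := abs_nonneg (u (i + 1))
      have hZ := abs_nonneg (u (i + 2))
      have hpos : 0 < |u (i + 1)| + |u (i + 2)| := by
        refine lt_of_le_of_ne (by positivity) fun h => ?_
        have h1 : u (i + 1) = 0 := abs_eq_zero.1 (by linarith)
        have h2 : u (i + 2) = 0 := abs_eq_zero.1 (by linarith)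
        rw [hi, h1, h2] at hS
        norm_num at hS
      obtain ⟨y, hy⟩ := exists_sgn_mul_eq_abs (u (i + 1))
      obtain ⟨z, hz⟩ := exists_sgn_mul_eq_abs (u (i + 2))
      have hk : ∀ k, E k →
          (k.1 = i ∧ φ * |u (i + 1)| ≤ |u (i + 1)| + φ * |u (i + 2)| ∧
            sgn k.2.2 * u (i + 2) = |u (i + 2)|) ∨
          (k.1 = i + 2 ∧ |u (i + 1)| + φ * |u (i + 2)| ≤ φ * |u (i + 1)| ∧
            sgn k.2.2 * u (i + 1) = |u (i + 1)|) := by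
        rintro ⟨j, x, x'⟩ h
        obtain ⟨⟨-, h1⟩, h2⟩ := (hE _).1 h
        rw [forall_fin_three_iff' i] at h2
        have h3 : j = i ∨ j = i + 1 ∨ j = i + 2 := by omega
        rcases h3 with rfl | rfl | rfl <;>
        simp only [add_one_add_one, add_one_add_two, add_two_add_one, add_two_add_two, hi,
          abs_zero, mul_zero, add_zero, zero_add] at h1 h2
        · exact Or.inl ⟨rfl, h2.2.2, h1⟩
        · exfalso
          nlinarith [h2.1, mul_nonneg (sub_nonneg.2 hφ1.le) hZ]
        · exact Or.inr ⟨rfl, h2.1, h1⟩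
      have heq : φ * |u (i + 1)| = |u (i + 1)| + φ * |u (i + 2)| := by
        rcases lt_trichotomy (φ * |u (i + 1)|) (|u (i + 1)| + φ * |u (i + 2)|) with h | h | h
        · exfalso
          have hne : u (i + 2) ≠ 0 := by
            intro h0
            rw [h0, abs_zero] at h
            nlinarith
          have key : ∀ k, E k → ∃ t, (i, t, z) = k := fun k hk' => by
            rcases hk k hk' with ⟨h1, -, h2⟩ | ⟨-, h1, -⟩
            · exact ⟨k.2.1, Prod.ext h1.symm (Prod.ext rfl (eq_of_sgn_mul_eq_abs hne hz h2))⟩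
            · exact absurd h1 h.not_ge
          exact not_three_of_range_bool _ hab hac hbc (key a ha) (key b hb) (key c hc)
        · exact h
        · exfalso
          have hne : u (i + 1) ≠ 0 := by
            intro h0
            rw [h0, abs_zero] at h
            nlinarith
          have key : ∀ k, E k → ∃ t, (i + 2, t, y) = k := fun k hk' => by
            rcases hk k hk' with ⟨-, h1, -⟩ | ⟨h1, -, h2⟩
            · exact absurd h1 h.not_ge
            · exact ⟨k.2.1, Prod.ext h1.symm (Prod.ext rfl (eq_of_sgn_mul_eq_abs hne hy h2))⟩
          exact not_three_of_range_bool _ hab hac hbc (key a ha) (key b hb) (key c hc)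
      have h1 : |u (i + 1)| = (φ + 1) * |u (i + 2)| := by
        linear_combination φ * heq - (|u (i + 1)| - |u (i + 2)|) * hφ
      have h2 := sq_eq_of_abs_eq_mul h1
      rw [hi, h2] at hS
      have h3 : u (i + 2) ^ 2 = (2 - φ) / 3 := by
        linear_combination (2 - φ) / 3 * hS + (φ + 1) / 3 * u (i + 2) ^ 2 * hφ
      refine ⟨?_, h3⟩
      rw [h2, h3]
      linear_combination (-1 - φ) / 3 * hφ
  · rintro (h | ⟨i, h0, h1, h2⟩)
    · have hA : ∀ i j : Fin 3, |u i| = |u j| := fun i j =>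
        sq_eq_sq_iff_abs_eq_abs _ _ |>.1 ((h i).trans (h j).symm)
      choose b hb using fun i : Fin 3 => exists_sgn_mul_eq_abs (u i)
      have hk : ∀ i : Fin 3, E (i, b (i + 1), b (i + 2)) := fun i =>
        (hE _).2 ⟨⟨hb _, hb _⟩, fun j => by
          rw [hA (j + 1) 0, hA (j + 2) 0, hA ((i, _).1 + 1) 0, hA ((i, _).1 + 2) 0]⟩
      exact ⟨_, _, _, by simp, by simp, by simp, hk 0, hk 1, hk 2⟩
    · obtain ⟨y, hy⟩ := exists_sgn_mul_eq_abs (u (i + 1))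
      obtain ⟨z, hz⟩ := exists_sgn_mul_eq_abs (u (i + 2))
      have hY : |u (i + 1)| = (φ + 1) * |u (i + 2)| := by
        rw [← abs_of_pos (show 0 < φ + 1 by linarith), ← abs_mul, ← sq_eq_sq_iff_abs_eq_abs,
          mul_pow, h1, h2]
        linear_combination (φ + 1) / 3 * hφ
      have hZ := abs_nonneg (u (i + 2))
      have hA : φ * |u (i + 1)| = |u (i + 1)| + φ * |u (i + 2)| := by
        rw [hY]
        linear_combination |u (i + 2)| * hφ
      have hle : ∀ j : Fin 3, |u (j + 1)| + φ * |u (j + 2)| ≤ φ * |u (i + 1)| := by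
        rw [forall_fin_three_iff' i]
        simp only [add_one_add_one, add_one_add_two, add_two_add_one, add_two_add_two, h0,
          abs_zero, mul_zero, add_zero, zero_add]
        refine ⟨hA.ge, ?_, le_rfl⟩
        rw [hY]
        nlinarith [mul_nonneg hφ0.le hZ]
      have hi1 : E (i, y, z) := (hE _).2 ⟨⟨hy, hz⟩, fun j => by rw [← hA]; exact hle j⟩
      have hi2 : ∀ t, E (i + 2, t, y) := fun t => (hE _).2 (by
        simp only [add_two_add_one, add_two_add_two, h0, abs_zero, mul_zero, zero_add]
        exact ⟨⟨trivial, hy⟩, hle⟩)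
      have hne : i ≠ i + 2 := by omega
      exact ⟨_, _, _, by simp [hne], by simp [hne], by simp, hi1, hi2 true, hi2 false⟩

/-! #### The dodecahedron -/

/-- The type of a dodecahedron vertex: a vertex of the cube, or a vertex in the coordinate plane
with the given index. -/
def dodecaClass : (Bool × Bool × Bool) ⊕ (Fin 3 × Bool × Bool) → Option (Fin 3) :=
  Sum.elim (fun _ => none) fun k => some k.1

/-- The largest inner product of `u` with the dodecahedron vertices of a given class. -/
noncomputable def dodecaSupport (u : Space) : Option (Fin 3) → ℝ
  | none => |u 0| + |u 1| + |u 2|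
  | some j => goldenRatio * |u (j + 1)| + (goldenRatio - 1) * |u (j + 2)|

theorem inner_dodecaVec_inr (u : Space) (k : Fin 3 × Bool × Bool) :
    inner ℝ u (dodecaVec (Sum.inr k)) = goldenRatio * (sgn k.2.1 * u (k.1 + 1)) +
      (goldenRatio - 1) * (sgn k.2.2 * u (k.1 + 2)) := by
  rw [dodecaVec, Sum.elim_inr, inner_cycVec]
  generalize goldenRatio = φ
  ring

theorem exposed_dodecaVec_iff (u : Space) (k : (Bool × Bool × Bool) ⊕ (Fin 3 × Bool × Bool)) :
    Exposed dodecaVec u k ↔ inner ℝ u (dodecaVec k) = dodecaSupport u (dodecaClass k) ∧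
      ∀ t, dodecaSupport u t ≤ dodecaSupport u (dodecaClass k) := by
  have hφ : 0 < goldenRatio - 1 := sub_pos.2 one_lt_goldenRatio
  refine exposed_iff ?_ ?_ k
  · rintro (k | k)
    · exact inner_cubeVec_le u k
    · rw [inner_dodecaVec_inr]
      exact add_sgn_forms_le goldenRatio_pos hφ _ _
  · rintro (_ | i)
    · obtain ⟨k, hk⟩ := exists_inner_cubeVec_eq u
      exact ⟨Sum.inl k, rfl, hk⟩
    · obtain ⟨b, hb⟩ := exists_sgn_mul_eq_abs (u (i + 1))
      obtain ⟨c, hc⟩ := exists_sgn_mul_eq_abs (u (i + 2))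
      refine ⟨Sum.inr (i, b, c), rfl, ?_⟩
      rw [inner_dodecaVec_inr, hb, hc]
      rfl

theorem exposed_dodecaVec_inl_iff (u : Space) (k : Bool × Bool × Bool) :
    Exposed dodecaVec u (Sum.inl k) ↔
      (sgn k.1 * u 0 = |u 0| ∧ sgn k.2.1 * u 1 = |u 1| ∧ sgn k.2.2 * u 2 = |u 2|) ∧
      ∀ t, dodecaSupport u t ≤ dodecaSupport u none := by
  rw [exposed_dodecaVec_iff]
  exact and_congr_left' (inner_cubeVec_eq_iff u k)

theorem exposed_dodecaVec_inr_iff (u : Space) (k : Fin 3 × Bool × Bool) :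
    Exposed dodecaVec u (Sum.inr k) ↔
      (sgn k.2.1 * u (k.1 + 1) = |u (k.1 + 1)| ∧ sgn k.2.2 * u (k.1 + 2) = |u (k.1 + 2)|) ∧
      ∀ t, dodecaSupport u t ≤ dodecaSupport u (some k.1) := by
  rw [exposed_dodecaVec_iff, inner_dodecaVec_inr]
  exact and_congr_left'
    (add_sgn_forms_eq_iff goldenRatio_pos (sub_pos.2 one_lt_goldenRatio) _ _)

theorem dodecaSupport_none (u : Space) (i : Fin 3) :
    dodecaSupport u none = |u i| + |u (i + 1)| + |u (i + 2)| := by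
  fin_cases i
  · rfl
  · change |u 0| + |u 1| + |u 2| = |u 1| + |u 2| + |u 0|; ring
  · change |u 0| + |u 1| + |u 2| = |u 2| + |u 0| + |u 1|; ring

theorem option_fin_three_cases {a b c : Option (Fin 3)} (hab : a ≠ b) (hac : a ≠ c) (hbc : b ≠ c) :
    (∀ i : Fin 3, some i = a ∨ some i = b ∨ some i = c) ∨
      ∃ i : Fin 3, (none = a ∨ none = b ∨ none = c) ∧ (some i = a ∨ some i = b ∨ some i = c) ∧
        (some (i + 1) = a ∨ some (i + 1) = b ∨ some (i + 1) = c) := by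
  have key : ∀ i j : Fin 3, i ≠ j → j = i + 1 ∨ i = j + 1 := by decide
  rcases a with _ | a <;> rcases b with _ | b <;> rcases c with _ | c <;>
    simp only [ne_eq, Option.some.injEq, not_true_eq_false, reduceCtorEq, not_false_eq_true,
      false_or, or_false, or_true, true_and] at *
  · rcases key b c hbc with rfl | rfl
    exacts [Or.inr ⟨b, by simp⟩, Or.inr ⟨c, by simp⟩]
  · rcases key a c hac with rfl | rfl
    exacts [Or.inr ⟨a, by simp⟩, Or.inr ⟨c, by simp⟩]
  · rcases key a b hab with rfl | rfl
    exacts [Or.inr ⟨a, by simp⟩, Or.inr ⟨b, by simp⟩]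
  · exact Or.inl (eq_or_eq_or_eq_of_ne hab hac hbc)

/-- A direction with no zero coordinate exposes no face of the dodecahedron. -/
theorem exists_eq_zero_of_dodecaSupport {u : Space} {a b c : Option (Fin 3)} (hab : a ≠ b)
    (hac : a ≠ c) (hbc : b ≠ c) (ha : ∀ t, dodecaSupport u t ≤ dodecaSupport u a)
    (hb : ∀ t, dodecaSupport u t ≤ dodecaSupport u b)
    (hc : ∀ t, dodecaSupport u t ≤ dodecaSupport u c) : ∃ i, u i = 0 := by
  have hφ := goldenRatio_sq
  have hφ1 := one_lt_goldenRatio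
  have hφ2 := goldenRatio_lt_two
  have hmax : ∀ {t}, t = a ∨ t = b ∨ t = c → ∀ s, dodecaSupport u s ≤ dodecaSupport u t := by
    rintro t (rfl | rfl | rfl)
    exacts [ha, hb, hc]
  have heq : ∀ {s t}, (s = a ∨ s = b ∨ s = c) → (t = a ∨ t = b ∨ t = c) →
      dodecaSupport u s = dodecaSupport u t := fun hs ht => le_antisymm (hmax ht _) (hmax hs _)
  rcases option_fin_three_cases hab hac hbc with h | ⟨i, hn, h1, h2⟩
  · have e1 := heq (h 0) (h 1)
    have e2 := heq (h 0) (h 2)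
    have e3 := hmax (h 0) none
    change goldenRatio * |u 1| + (goldenRatio - 1) * |u 2| =
      goldenRatio * |u 2| + (goldenRatio - 1) * |u 0| at e1
    change goldenRatio * |u 1| + (goldenRatio - 1) * |u 2| =
      goldenRatio * |u 0| + (goldenRatio - 1) * |u 1| at e2
    change |u 0| + |u 1| + |u 2| ≤ goldenRatio * |u 1| + (goldenRatio - 1) * |u 2| at e3
    refine ⟨2, abs_eq_zero.1 (le_antisymm ?_ (abs_nonneg _))⟩
    generalize goldenRatio = φ at *
    generalize |u 0| = x at *; generalize |u 1| = y at *; generalize |u 2| = z at *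
    have h1 : 2 * (x - z) = 0 := by linear_combination e1 - φ * e2 - (x - z) * hφ
    have hx : x = z := by linarith
    rw [hx] at e2 e3
    have hy : y = z := by linarith
    rw [hy] at e3
    nlinarith
  · have e1 := heq hn h1
    have e2 := heq hn h2
    rw [dodecaSupport_none u i] at e1 e2
    simp only [dodecaSupport, add_one_add_one, add_one_add_two] at e1 e2
    refine ⟨i, abs_eq_zero.1 ?_⟩
    generalize goldenRatio = φ at *
    generalize |u i| = x at *; generalize |u (i + 1)| = y at *; generalize |u (i + 2)| = z at *
    have h3 : 2 * (φ - 1) * x = 0 := by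
      linear_combination e1 + (φ - 1) * e2 + (x + z) * hφ
    exact (mul_eq_zero.1 h3).resolve_left (by linarith)

theorem dodecaSupport_le_iff {u : Space} {i : Fin 3} (hi : u i = 0) {M : ℝ} :
    (∀ t, dodecaSupport u t ≤ M) ↔ |u (i + 1)| + |u (i + 2)| ≤ M ∧
      goldenRatio * |u (i + 1)| + (goldenRatio - 1) * |u (i + 2)| ≤ M ∧
      goldenRatio * |u (i + 2)| ≤ M ∧ (goldenRatio - 1) * |u (i + 1)| ≤ M := by
  rw [Option.forall, forall_fin_three_iff' i, dodecaSupport_none u i]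
  simp only [dodecaSupport, add_one_add_one, add_one_add_two, add_two_add_one, add_two_add_two, hi,
    abs_zero, mul_zero, add_zero, zero_add]

theorem exposesFace_dodecaVec_iff {u : Space} (hu : ‖u‖ = 1) :
    ExposesFace dodecaVec u ↔ u ∈ Set.range fun k => (1 / √(goldenRatio + 2)) • icosaVec k := by
  rw [mem_range_smul_icosaVec]
  have hφ := goldenRatio_sq
  have hφ1 := one_lt_goldenRatio
  have hφ2 := goldenRatio_lt_two
  constructor
  · rintro ⟨a, b, c, hab, hac, hbc, ha, hb, hc⟩
    obtain ⟨i, hi⟩ : ∃ i, u i = 0 := by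
      by_contra! hne
      have hcl : ∀ {k l}, k ≠ l → Exposed dodecaVec u k → Exposed dodecaVec u l →
          dodecaClass k ≠ dodecaClass l := by
        rintro (k | ⟨i, x, x'⟩) (l | ⟨j, y, y'⟩) hkl hk hl
        · rw [exposed_dodecaVec_inl_iff] at hk hl
          exact absurd (congrArg Sum.inl (Prod.ext (eq_of_sgn_mul_eq_abs (hne _) hk.1.1 hl.1.1)
            (Prod.ext (eq_of_sgn_mul_eq_abs (hne _) hk.1.2.1 hl.1.2.1)
            (eq_of_sgn_mul_eq_abs (hne _) hk.1.2.2 hl.1.2.2)))) hkl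
        · exact (Option.some_ne_none _).symm
        · exact Option.some_ne_none _
        · intro h
          obtain rfl : i = j := Option.some_injective _ h
          rw [exposed_dodecaVec_inr_iff] at hk hl
          exact hkl (congrArg Sum.inr (Prod.ext rfl (Prod.ext
            (eq_of_sgn_mul_eq_abs (hne _) hk.1.1 hl.1.1)
            (eq_of_sgn_mul_eq_abs (hne _) hk.1.2 hl.1.2))))
      obtain ⟨i, hi⟩ := exists_eq_zero_of_dodecaSupport (hcl hab ha hb) (hcl hac ha hc)
        (hcl hbc hb hc) ((exposed_dodecaVec_iff u a).1 ha).2 ((exposed_dodecaVec_iff u b).1 hb).2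
        ((exposed_dodecaVec_iff u c).1 hc).2
      exact hne i hi
    refine ⟨i, hi, ?_⟩
    have hS := space_sq_sum' hu i
    have hY := abs_nonneg (u (i + 1))
    have hZ := abs_nonneg (u (i + 2))
    have hpos : 0 < |u (i + 1)| + |u (i + 2)| := by
      refine lt_of_le_of_ne (by positivity) fun h => ?_
      have h1 : u (i + 1) = 0 := abs_eq_zero.1 (by linarith)
      have h2 : u (i + 2) = 0 := abs_eq_zero.1 (by linarith)
      rw [hi, h1, h2] at hS
      norm_num at hS
    obtain ⟨y, hy⟩ := exists_sgn_mul_eq_abs (u (i + 1))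
    obtain ⟨z, hz⟩ := exists_sgn_mul_eq_abs (u (i + 2))
    have hcases : ∀ k, Exposed dodecaVec u k →
        |u (i + 2)| = goldenRatio * |u (i + 1)| ∨
        (goldenRatio * |u (i + 1)| < |u (i + 2)| ∧ ∃ t, Sum.inr (i + 1, z, t) = k) ∨
        (|u (i + 2)| < goldenRatio * |u (i + 1)| ∧ ∃ t, Sum.inr (i, y, t) = k) := by
      rintro (k | ⟨j, x, x'⟩) hk
      · have h1 := ((exposed_dodecaVec_inl_iff u k).1 hk).2
        rw [dodecaSupport_le_iff hi, dodecaSupport_none u i, hi, abs_zero, zero_add] at h1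
        obtain ⟨-, h2, h3, -⟩ := h1
        left
        generalize |u (i + 1)| = Y at *; generalize |u (i + 2)| = Z at *
        clear hk hS hi hu hy hz ha hb hc
        generalize goldenRatio = φ at *
        have h4 : Z ≤ φ * Y := by nlinarith
        have h5 : (2 - φ) * (φ * Y - Z) ≤ 0 := by
          linear_combination h2 - Y * hφ
        nlinarith
      · obtain ⟨⟨h1, h2⟩, h3⟩ := (exposed_dodecaVec_inr_iff u _).1 hk
        have hj : j = i ∨ j = i + 1 ∨ j = i + 2 := by omega
        rw [dodecaSupport_le_iff hi] at h3
        rcases hj with rfl | rfl | rfl <;>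
          simp only [dodecaSupport, add_one_add_one, add_one_add_two, add_two_add_one,
            add_two_add_two, hi, abs_zero, mul_zero, add_zero, zero_add] at h1 h2 h3
        · rcases lt_trichotomy |u (j + 2)| (goldenRatio * |u (j + 1)|) with h | h | h
          · have hne : u (j + 1) ≠ 0 := by
              intro h0
              rw [h0, abs_zero, mul_zero] at h
              exact h.not_ge hZ
            exact Or.inr (Or.inr ⟨h, x', by rw [eq_of_sgn_mul_eq_abs hne hy h1]⟩)
          · exact Or.inl h
          · exfalso
            obtain ⟨h4, -, -, -⟩ := h3
            generalize goldenRatio = φ at *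
            have h5 : (2 - φ) * (|u (j + 2)| - φ * |u (j + 1)|) ≤ 0 := by
              linear_combination h4 + |u (j + 1)| * hφ
            exact h5.not_gt (mul_pos (by linarith) (by linarith))
        · rcases lt_trichotomy |u (i + 2)| (goldenRatio * |u (i + 1)|) with h | h | h
          · exfalso
            obtain ⟨h4, -, -, -⟩ := h3
            generalize goldenRatio = φ at *
            have h5 : (φ - 1) * (φ * |u (i + 1)| - |u (i + 2)|) ≤ 0 := by
              linear_combination h4 + |u (i + 1)| * hφ
            exact h5.not_gt (mul_pos (by linarith) (by linarith))
          · exact Or.inl h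
          · have hne : u (i + 2) ≠ 0 := by
              intro h0
              rw [h0, abs_zero] at h
              exact h.not_ge (mul_nonneg goldenRatio_pos.le hY)
            exact Or.inr (Or.inl ⟨h, x', by rw [eq_of_sgn_mul_eq_abs hne hz h1]⟩)
        · exfalso
          obtain ⟨h4, -, -, -⟩ := h3
          generalize goldenRatio = φ at *
          have h5 : (2 - φ) * (|u (i + 1)| + |u (i + 2)|) ≤ 0 := by
            linear_combination h4 + mul_nonneg (sub_nonneg.2 hφ1.le) hZ
          exact h5.not_gt (mul_pos (by linarith) hpos)
    have heq : |u (i + 2)| = goldenRatio * |u (i + 1)| := by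
      rcases lt_trichotomy |u (i + 2)| (goldenRatio * |u (i + 1)|) with h | h | h
      · exfalso
        have key : ∀ k, Exposed dodecaVec u k → ∃ t, Sum.inr (i, y, t) = k := fun k hk => by
          rcases hcases k hk with h1 | ⟨h1, -⟩ | ⟨-, h1⟩
          exacts [absurd h1 h.ne, absurd h1 h.not_gt, h1]
        exact not_three_of_range_bool _ hab hac hbc (key a ha) (key b hb) (key c hc)
      · exact h
      · exfalso
        have key : ∀ k, Exposed dodecaVec u k → ∃ t, Sum.inr (i + 1, z, t) = k := fun k hk => by
          rcases hcases k hk with h1 | ⟨-, h1⟩ | ⟨h1, -⟩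
          exacts [absurd h1 h.ne', h1, absurd h1 h.not_gt]
        exact not_three_of_range_bool _ hab hac hbc (key a ha) (key b hb) (key c hc)
    have h2 := sq_eq_of_abs_eq_mul heq
    rw [hi, h2] at hS
    rw [h2]
    clear hcases heq hi h2 ha hb hc hpos
    generalize goldenRatio = φ at *
    have h3 : u (i + 1) ^ 2 = (3 - φ) / 5 := by
      linear_combination (3 - φ) / 5 * hS + (φ - 2) / 5 * u (i + 1) ^ 2 * hφ
    refine ⟨h3, ?_⟩
    rw [h3]
    linear_combination (2 - φ) / 5 * hφ
  · rintro ⟨i, h0, h1, h2⟩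
    obtain ⟨y, hy⟩ := exists_sgn_mul_eq_abs (u (i + 1))
    obtain ⟨z, hz⟩ := exists_sgn_mul_eq_abs (u (i + 2))
    have hY := abs_nonneg (u (i + 1))
    have hZ : |u (i + 2)| = goldenRatio * |u (i + 1)| := by
      rw [← abs_of_pos goldenRatio_pos, ← abs_mul, ← sq_eq_sq_iff_abs_eq_abs,
        mul_pow, h1, h2]
      generalize goldenRatio = φ at *
      linear_combination (φ - 2) / 5 * hφ
    have hle : ∀ t, dodecaSupport u t ≤ (goldenRatio + 1) * |u (i + 1)| := by
      rw [dodecaSupport_le_iff h0, hZ]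
      generalize |u (i + 1)| = Y at *
      clear h0 h1 h2 hy hz hZ hu
      generalize goldenRatio = φ at *
      refine ⟨?_, ?_, ?_, ?_⟩
      · linarith
      · linear_combination Y * hφ
      · linear_combination Y * hφ
      · linarith
    have hi1 : Exposed dodecaVec u (Sum.inr (i, y, z)) :=
      (exposed_dodecaVec_inr_iff u _).2 ⟨⟨hy, hz⟩, fun t => (hle t).trans_eq (by
        simp only [dodecaSupport, hZ]
        clear hle h0 h1 h2 hy hz hZ hu
        generalize goldenRatio = φ at *
        linear_combination (-|u (i + 1)|) * hφ)⟩
    have hi2 : ∀ t, Exposed dodecaVec u (Sum.inr (i + 1, z, t)) := fun t =>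
      (exposed_dodecaVec_inr_iff u _).2 (by
        simp only [dodecaSupport, add_one_add_one, add_one_add_two, h0, abs_zero, mul_zero,
          add_zero]
        refine ⟨⟨hz, trivial⟩, fun t => (hle t).trans_eq ?_⟩
        rw [hZ]
        clear hle h0 h1 h2 hy hz hZ hu
        generalize goldenRatio = φ at *
        linear_combination (-|u (i + 1)|) * hφ)
    have hne : i ≠ i + 1 := by omega
    exact ⟨_, _, _, by simp [hne], by simp [hne], by simp, hi1, hi2 true, hi2 false⟩

/-! ### Vertex families: injectivity, norms, cardinalities -/

theorem cycVec_eq_cycVec {i j : Fin 3} {p q p' q' : ℝ} (hp : p ≠ 0) (hq : q ≠ 0)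
    (h : cycVec i 0 p q = cycVec j 0 p' q') : i = j ∧ p = p' ∧ q = q' := by
  have h0 : cycVec i 0 p q j = 0 := by rw [h, cycVec_apply_zero]
  have hij : i = j := by
    have : j = i ∨ j = i + 1 ∨ j = i + 2 := by omega
    rcases this with rfl | rfl | rfl
    · rfl
    · exact absurd (by rwa [cycVec_apply_one] at h0) hp
    · exact absurd (by rwa [cycVec_apply_two] at h0) hq
  subst hij
  have h1 := congrArg (fun v : Space => v (i + 1)) h
  have h2 := congrArg (fun v : Space => v (i + 2)) h
  simp only [cycVec_apply_one, cycVec_apply_two] at h1 h2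
  exact ⟨rfl, h1, h2⟩

theorem sgn_ne_zero (b : Bool) : sgn b ≠ 0 := by cases b <;> simp

theorem icosaVec_injective : Function.Injective icosaVec := by
  rintro ⟨i, b, c⟩ ⟨j, b', c'⟩ h
  obtain ⟨rfl, h1, h2⟩ := cycVec_eq_cycVec (sgn_ne_zero b)
    (mul_ne_zero (sgn_ne_zero c) goldenRatio_ne_zero) h
  rw [sgn_injective h1, sgn_injective (mul_right_cancel₀ goldenRatio_ne_zero h2)]

theorem cubeVec_injective : Function.Injective cubeVec := by
  rintro ⟨a, b, c⟩ ⟨a', b', c'⟩ h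
  have h0 : sgn a = sgn a' := congrArg (fun v : Space => v 0) h
  have h1 : sgn b = sgn b' := congrArg (fun v : Space => v 1) h
  have h2 : sgn c = sgn c' := congrArg (fun v : Space => v 2) h
  rw [sgn_injective h0, sgn_injective h1, sgn_injective h2]

theorem tetraVec_injective : Function.Injective tetraVec := by
  rintro ⟨a, b⟩ ⟨a', b'⟩ h
  have h0 : sgn a = sgn a' := congrArg (fun v : Space => v 0) h
  have h1 : sgn b = sgn b' := congrArg (fun v : Space => v 1) h
  rw [sgn_injective h0, sgn_injective h1]

theorem octaVec_injective : Function.Injective octaVec := by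
  rintro ⟨i, b⟩ ⟨j, c⟩ h
  have h0 : octaVec (i, b) (j + 2) = sgn c := by rw [h, octaVec, cycVec_apply_two]
  have hij : i = j := by
    have : j + 2 = i ∨ j + 2 = i + 1 ∨ j = i := by omega
    rcases this with h1 | h1 | h1
    · rw [h1, octaVec, cycVec_apply_zero] at h0
      exact absurd h0.symm (sgn_ne_zero c)
    · rw [h1, octaVec, cycVec_apply_one] at h0
      exact absurd h0.symm (sgn_ne_zero c)
    · exact h1.symm
  subst hij
  rw [octaVec, cycVec_apply_two] at h0
  exact congrArg (Prod.mk i) (sgn_injective h0)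

theorem dodecaVec_injective : Function.Injective dodecaVec := by
  have hφ : goldenRatio - 1 ≠ 0 := (sub_pos.2 one_lt_goldenRatio).ne'
  refine cubeVec_injective.sumElim ?_ ?_
  · rintro ⟨i, b, c⟩ ⟨j, b', c'⟩ h
    obtain ⟨rfl, h1, h2⟩ := cycVec_eq_cycVec (mul_ne_zero (sgn_ne_zero b) goldenRatio_ne_zero)
      (mul_ne_zero (sgn_ne_zero c) hφ) h
    rw [sgn_injective (mul_right_cancel₀ goldenRatio_ne_zero h1),
      sgn_injective (mul_right_cancel₀ hφ h2)]
  · rintro k ⟨j, b, c⟩ h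
    have h1 : cubeVec k ∈ Set.range cubeVec := ⟨k, rfl⟩
    rw [range_cubeVec] at h1
    have h2 : |cubeVec k j| = 1 := h1 j
    rw [h, cycVec_apply_zero, abs_zero] at h2
    exact zero_ne_one h2

theorem norm_smul_cycVec_eq_one {s : ℝ} {i : Fin 3} {p q r : ℝ}
    (h : s ^ 2 * (p ^ 2 + q ^ 2 + r ^ 2) = 1) : ‖s • cycVec i p q r‖ = 1 := by
  rw [← sq_eq_sq₀ (norm_nonneg _) zero_le_one, norm_smul, mul_pow, norm_sq_cycVec,
    Real.norm_eq_abs, sq_abs, h, one_pow]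

theorem norm_smul_icosaVec (k) : ‖(1 / √(goldenRatio + 2)) • icosaVec k‖ = 1 := by
  refine norm_smul_cycVec_eq_one ?_
  rw [inv_sqrt_golden_sq, mul_pow, sgn_sq, sgn_sq]
  have := goldenRatio_sq
  generalize goldenRatio = φ at *
  linear_combination (2 - φ) / 5 * this

theorem norm_smul_cubeVec (k) : ‖(1 / √3) • cubeVec k‖ = 1 := by
  refine norm_smul_cycVec_eq_one ?_
  rw [inv_sqrt_three_sq, sgn_sq, sgn_sq, sgn_sq]
  norm_num

theorem norm_smul_octaVec (k) : ‖(1 : ℝ) • octaVec k‖ = 1 := by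
  refine norm_smul_cycVec_eq_one ?_
  rw [sgn_sq]
  norm_num

theorem norm_smul_tetraVec (k) : ‖(1 / √3) • tetraVec k‖ = 1 := by
  refine norm_smul_cycVec_eq_one ?_
  rw [inv_sqrt_three_sq, mul_pow, sgn_sq, sgn_sq]
  norm_num

theorem norm_smul_dodecaVec (k) : ‖(1 / √3) • dodecaVec k‖ = 1 := by
  rcases k with k | k
  · exact norm_smul_cubeVec k
  · refine norm_smul_cycVec_eq_one ?_
    rw [inv_sqrt_three_sq, mul_pow, mul_pow, sgn_sq, sgn_sq]
    have := goldenRatio_sq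
    generalize goldenRatio = φ at *
    linear_combination 2 / 3 * this

theorem ncard_range_smul {κ : Type*} [Fintype κ] {w : κ → Space} (hw : Function.Injective w)
    {s : ℝ} (hs : 0 < s) (g : Space ≃ₗᵢ[ℝ] Space) :
    (Set.range fun k => s • g (w k)).ncard = Fintype.card κ := by
  have hinj : Function.Injective fun k => s • g (w k) := fun a b h =>
    hw (g.injective (smul_right_injective _ hs.ne' h))
  rw [← Set.image_univ, Set.ncard_image_of_injective _ hinj, Set.ncard_univ,
    Nat.card_eq_fintype_card]

theorem isInscribedCopy_range {κ : Type*} {w : κ → Space} {s : ℝ} (hs : 0 < s)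
    (hw : ∀ k, ‖s • w k‖ = 1) (g h : Space ≃ₗᵢ[ℝ] Space) {W : Set Space}
    (hW : W = h '' Set.range w) :
    IsInscribedCopy W (Set.range fun k => s • g (w k)) := by
  refine ⟨?_, h.symm.trans g, s, hs, ?_⟩
  · rintro _ ⟨k, rfl⟩
    rw [mem_sphere_zero_iff_norm]
    change ‖s • g (w k)‖ = 1
    rw [← map_smul, g.norm_map, hw]
  · rw [hW, Set.image_image, ← Set.range_comp]
    congr 1
    ext1 k
    simp

/-- The reflection of space that interchanges the last two coordinates. -/
noncomputable def swapIso : Space ≃ₗᵢ[ℝ] Space :=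
  LinearIsometryEquiv.piLpCongrLeft 2 ℝ ℝ (Equiv.swap (1 : Fin 3) 2)

theorem swapIso_apply (v : Space) : swapIso v 0 = v 0 ∧ swapIso v 1 = v 2 ∧ swapIso v 2 = v 1 :=
  ⟨rfl, rfl, rfl⟩

theorem image_swapIso_range_dodecaVec :
    {v : Space | ∀ i : Fin 3, |v i| = 1} ∪
      {v | ∃ i : Fin 3, v i = 0 ∧ |v (i + 1)| = goldenRatio⁻¹ ∧ |v (i + 2)| = goldenRatio} =
      swapIso '' Set.range dodecaVec := by
  have hφ : goldenRatio⁻¹ = goldenRatio - 1 := by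
    refine inv_eq_of_mul_eq_one_right ?_
    have := goldenRatio_sq
    generalize goldenRatio = φ at *
    linear_combination this
  ext v
  obtain ⟨u, rfl⟩ := swapIso.surjective v
  obtain ⟨h0, h1, h2⟩ := swapIso_apply u
  rw [swapIso.injective.mem_set_image, range_dodecaVec, hφ]
  simp only [Set.mem_union, Set.mem_ofPred_eq]
  rw [forall_fin_three_iff, forall_fin_three_iff,
    exists_fin_three_iff (p := fun i j k => swapIso u i = 0 ∧ |swapIso u j| = goldenRatio - 1 ∧
      |swapIso u k| = goldenRatio),
    exists_fin_three_iff (p := fun i j k => u i = 0 ∧ |u j| = goldenRatio ∧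
      |u k| = goldenRatio - 1), h0, h1, h2]
  tauto

/-! ### Majorana points and closest product points from a factorised overlap -/

theorem majoranaPoints_and_closestProductPoints {n : ℕ} [NeZero n] {ψ : NQubit n} (hψ : IsSymm ψ)
    {g : Space ≃ₗᵢ[ℝ] Space} {κ τ : Type*} [Fintype κ] [Nonempty τ] {w : κ → Space}
    {w' : τ → Space} {s s' c M : ℝ} (hw : ∀ k, ‖s • w k‖ = 1)
    (hw' : ∀ k, ‖s' • w' k‖ = 1) (hc : 0 < c) (hM : 0 < M)
    (hF : ∀ {σ : Qubit}, ‖σ‖ = 1 → ∀ {q : Space}, blochVector σ = g q →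
      ‖amplitude ψ σ‖ ^ 2 = c * ∏ k, (1 + s * inner ℝ q (w k)))
    (hmax : ∀ {q : Space}, ‖q‖ = 1 → ∏ k, (1 + s * inner ℝ q (w k)) ≤ M ∧
      (∏ k, (1 + s * inner ℝ q (w k)) = M ↔ q ∈ Set.range fun k => s' • w' k)) :
    majoranaPoints ψ = (Set.range fun k => s • g (w k)) ∧
      closestProductPoints ψ = Set.range fun k => s' • g (w' k) := by
  obtain ⟨t⟩ := ‹Nonempty τ›
  have hval : ∀ k, ∏ l, (1 + s * inner ℝ (s' • w' k) (w l)) = M := fun k =>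
    (hmax (hw' k)).2.2 ⟨k, rfl⟩
  have h0 : ψ ≠ 0 := by
    rintro rfl
    obtain ⟨σ, hσ, hb⟩ := exists_blochVector_eq
      (show ‖g (s' • w' t)‖ = 1 by rw [g.norm_map, hw'])
    have h1 := hF hσ hb
    rw [hval, show amplitude (0 : NQubit n) σ = 0 by simp [amplitude_eq]] at h1
    have := mul_pos hc hM
    simp at h1
    rcases h1 with h1 | h1
    · exact hc.ne' h1
    · exact hM.ne' h1
  constructor
  · refine majoranaPoints_eq_range hψ h0 (fun k => ?_) hc.ne' fun σ hσ => ?_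
    · rw [← map_smul, g.norm_map, hw]
    · rw [hF hσ (g.apply_symm_apply _).symm]
      congr 1
      refine Finset.prod_congr rfl fun k _ => ?_
      rw [inner_smul_right, ← g.inner_map_map, g.apply_symm_apply]
  · rw [closestProductPoints_eq hψ
      (F := fun p => c * ∏ k, (1 + s * inner ℝ (g.symm p) (w k)))
      fun σ hσ => hF hσ (g.apply_symm_apply _).symm]
    ext p
    obtain ⟨q, rfl⟩ := g.surjective p
    have hr : g q ∈ (Set.range fun k => s' • g (w' k)) ↔ q ∈ Set.range fun k => s' • w' k := by
      simp only [Set.mem_range, ← map_smul, g.injective.eq_iff]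
    rw [hr, Set.mem_ofPred_eq]
    simp only [g.symm_apply_apply, g.norm_map]
    constructor
    · rintro ⟨hq, h⟩
      refine (hmax hq).2.1 (le_antisymm (hmax hq).1 ?_)
      have := h (g (s' • w' t)) (by rw [g.norm_map, hw'])
      rw [g.symm_apply_apply, hval] at this
      exact le_of_mul_le_mul_left this hc
    · rintro ⟨k, rfl⟩
      refine ⟨hw' k, fun q hq => mul_le_mul_of_nonneg_left ?_ hc.le⟩
      rw [hval]
      exact (hmax (by rwa [g.symm.norm_map])).1

theorem dualVertices_range_eq {κ τ : Type*} {w : κ → Space} {w' : τ → Space} {s s' : ℝ}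
    (hs : 0 < s) (hinj : Function.Injective w) (hw : ∀ k, ‖s • w k‖ = 1)
    (hw' : ∀ k, ‖s' • w' k‖ = 1) (g : Space ≃ₗᵢ[ℝ] Space)
    (hface : ∀ {u : Space}, ‖u‖ = 1 →
      (ExposesFace w u ↔ u ∈ Set.range fun k => s' • w' k)) :
    dualVertices (Set.range fun k => s • g (w k)) = Set.range fun k => s' • g (w' k) := by
  rw [dualVertices_range hinj (R := s⁻¹) (fun k => ?_) hs g]
  · have : {u : Space | ‖u‖ = 1 ∧ ExposesFace w u} = Set.range fun k => s' • w' k := by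
      ext u
      refine ⟨fun h => (hface h.1).1 h.2, ?_⟩
      rintro ⟨k, rfl⟩
      exact ⟨hw' k, (hface (hw' k)).2 ⟨k, rfl⟩⟩
    rw [this, ← Set.range_comp]
    simp [Function.comp_def]
  · have := hw k
    rw [norm_smul, Real.norm_of_nonneg hs.le] at this
    exact eq_inv_of_mul_eq_one_right this

theorem isSymm_icosahedronState : IsSymm icosahedronState :=
  (((isSymm_dicke _ _).smul _).sub ((isSymm_dicke _ _).smul _)).sub ((isSymm_dicke _ _).smul _)

theorem isSymm_dodecahedronState : IsSymm dodecahedronState :=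
  (((((isSymm_dicke _ _).smul _).add ((isSymm_dicke _ _).smul _)).add
    ((isSymm_dicke _ _).smul _)).sub ((isSymm_dicke _ _).smul _)).add ((isSymm_dicke _ _).smul _)

theorem isSymm_octahedronState : IsSymm octahedronState :=
  ((isSymm_dicke _ _).add (isSymm_dicke _ _)).smul _

theorem isSymm_cubeState : IsSymm cubeState :=
  (((isSymm_dicke _ _).smul _).sub ((isSymm_dicke _ _).smul _)).add ((isSymm_dicke _ _).smul _)

theorem isSymm_tetrahedronState : IsSymm tetrahedronState :=
  ((isSymm_dicke _ _).smul _).add ((isSymm_dicke _ _).smul _)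

theorem icosahedronState_points :
    majoranaPoints icosahedronState =
        (Set.range fun k => (1 / √(goldenRatio + 2)) • icosaFrame (icosaVec k)) ∧
      closestProductPoints icosahedronState =
        Set.range fun k => (1 / √3) • icosaFrame (dodecaVec k) :=
  majoranaPoints_and_closestProductPoints isSymm_icosahedronState norm_smul_icosaVec
    norm_smul_dodecaVec (by positivity) (by positivity) norm_sq_amplitude_icosahedronState
    prod_icosaVec_max

theorem dodecahedronState_points :
    majoranaPoints dodecahedronState =
        (Set.range fun k => (1 / √3) • icosaFrame (dodecaVec k)) ∧
      closestProductPoints dodecahedronState =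
        Set.range fun k => (1 / √(goldenRatio + 2)) • icosaFrame (icosaVec k) :=
  majoranaPoints_and_closestProductPoints isSymm_dodecahedronState norm_smul_dodecaVec
    norm_smul_icosaVec (by positivity) (by positivity) norm_sq_amplitude_dodecahedronState
    prod_dodecaVec_max

theorem octahedronState_points :
    majoranaPoints octahedronState = (Set.range fun k => (1 : ℝ) • octaFrame (octaVec k)) ∧
      closestProductPoints octahedronState =
        Set.range fun k => (1 / √3) • octaFrame (cubeVec k) :=
  majoranaPoints_and_closestProductPoints isSymm_octahedronState norm_smul_octaVec
    norm_smul_cubeVec (by positivity) (by positivity) norm_sq_amplitude_octahedronState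
    prod_octaVec_max

theorem cubeState_points :
    majoranaPoints cubeState = (Set.range fun k => (1 / √3) • octaFrame (cubeVec k)) ∧
      closestProductPoints cubeState = Set.range fun k => (1 : ℝ) • octaFrame (octaVec k) :=
  majoranaPoints_and_closestProductPoints isSymm_cubeState norm_smul_cubeVec norm_smul_octaVec
    (by positivity) (by positivity) norm_sq_amplitude_cubeState prod_cubeVec_max

theorem tetrahedronState_points :
    majoranaPoints tetrahedronState = (Set.range fun k => (1 / √3) • tetraFrame (tetraVec k)) ∧
      closestProductPoints tetrahedronState =
        Set.range fun k => (1 / √3) • tetraFrame (tetraVec k) :=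
  majoranaPoints_and_closestProductPoints isSymm_tetrahedronState norm_smul_tetraVec
    norm_smul_tetraVec (by positivity) (by positivity) norm_sq_amplitude_tetrahedronState
    prod_tetraVec_max

theorem inv_sqrt_golden_pos : 0 < 1 / √(goldenRatio + 2) := one_div_pos.2 sqrt_golden_pos

theorem inv_sqrt_three_pos : 0 < 1 / √3 := by positivity

theorem isIcosahedron_range :
    IsIcosahedron (Set.range fun k => (1 / √(goldenRatio + 2)) • icosaFrame (icosaVec k)) :=
  isInscribedCopy_range inv_sqrt_golden_pos norm_smul_icosaVec icosaFrame
    (LinearIsometryEquiv.refl ℝ Space) (by simp [range_icosaVec])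

theorem isDodecahedron_range :
    IsDodecahedron (Set.range fun k => (1 / √3) • icosaFrame (dodecaVec k)) :=
  isInscribedCopy_range inv_sqrt_three_pos norm_smul_dodecaVec icosaFrame swapIso
    image_swapIso_range_dodecaVec

theorem isOctahedron_range :
    IsOctahedron (Set.range fun k => (1 : ℝ) • octaFrame (octaVec k)) :=
  isInscribedCopy_range one_pos norm_smul_octaVec octaFrame
    (LinearIsometryEquiv.refl ℝ Space) (by simp [range_octaVec])

theorem isCube_range : IsCube (Set.range fun k => (1 / √3) • octaFrame (cubeVec k)) :=
  isInscribedCopy_range inv_sqrt_three_pos norm_smul_cubeVec octaFrame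
    (LinearIsometryEquiv.refl ℝ Space) (by simp [range_cubeVec])

theorem isTetrahedron_range :
    IsTetrahedron (Set.range fun k => (1 / √3) • tetraFrame (tetraVec k)) :=
  isInscribedCopy_range inv_sqrt_three_pos norm_smul_tetraVec tetraFrame
    (LinearIsometryEquiv.refl ℝ Space) (by simp [range_tetraVec])

theorem dualVertices_tetra :
    dualVertices (Set.range fun k => (1 / √3) • tetraFrame (tetraVec k)) =
      (fun p => -p) '' Set.range fun k => (1 / √3) • tetraFrame (tetraVec k) := by
  have hneg : ∀ k, (-(1 / √3)) • tetraVec k = -((1 / √3) • tetraVec k) := fun k => neg_smul _ _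
  rw [dualVertices_range_eq inv_sqrt_three_pos tetraVec_injective norm_smul_tetraVec
    (s' := -(1 / √3)) (w' := tetraVec) (fun k => by rw [hneg, norm_neg, norm_smul_tetraVec])
    tetraFrame (fun hu => by simp only [hneg]; exact exposesFace_tetraVec_iff hu), ← Set.range_comp]
  simp only [neg_smul, Function.comp_def]

end MajoranaStates

open MajoranaStates in
theorem mainTheorem4 :
    -- icosahedron state
    ((majoranaPoints icosahedronState).ncard = 12 ∧
      IsIcosahedron (majoranaPoints icosahedronState) ∧
      (closestProductPoints icosahedronState).ncard = 20 ∧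
      IsDodecahedron (closestProductPoints icosahedronState) ∧
      closestProductPoints icosahedronState = dualVertices (majoranaPoints icosahedronState)) ∧
    -- dodecahedron state
    ((majoranaPoints dodecahedronState).ncard = 20 ∧
      IsDodecahedron (majoranaPoints dodecahedronState) ∧
      (closestProductPoints dodecahedronState).ncard = 12 ∧
      IsIcosahedron (closestProductPoints dodecahedronState) ∧
      closestProductPoints dodecahedronState = dualVertices (majoranaPoints dodecahedronState)) ∧
    -- Majorana points and closest product points of these two states are interchanged
    (closestProductPoints icosahedronState = majoranaPoints dodecahedronState ∧
      closestProductPoints dodecahedronState = majoranaPoints icosahedronState) ∧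
    -- octahedron state
    ((majoranaPoints octahedronState).ncard = 6 ∧
      IsOctahedron (majoranaPoints octahedronState) ∧
      (closestProductPoints octahedronState).ncard = 8 ∧
      IsCube (closestProductPoints octahedronState) ∧
      closestProductPoints octahedronState = dualVertices (majoranaPoints octahedronState)) ∧
    -- cube state
    ((majoranaPoints cubeState).ncard = 8 ∧
      IsCube (majoranaPoints cubeState) ∧
      (closestProductPoints cubeState).ncard = 6 ∧
      IsOctahedron (closestProductPoints cubeState) ∧
      closestProductPoints cubeState = dualVertices (majoranaPoints cubeState)) ∧
    -- Majorana points and closest product points of these two states are interchanged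
    (closestProductPoints octahedronState = majoranaPoints cubeState ∧
      closestProductPoints cubeState = majoranaPoints octahedronState) ∧
    -- tetrahedron state: self-dual, the two point sets coincide, whereas the dual of the
    -- tetrahedron of Majorana points is its antipodal image
    ((majoranaPoints tetrahedronState).ncard = 4 ∧
      IsTetrahedron (majoranaPoints tetrahedronState) ∧
      closestProductPoints tetrahedronState = majoranaPoints tetrahedronState ∧
      dualVertices (majoranaPoints tetrahedronState) =
        (fun p => -p) '' majoranaPoints tetrahedronState) := by
  rw [icosahedronState_points.1, icosahedronState_points.2, dodecahedronState_points.1,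
    dodecahedronState_points.2, octahedronState_points.1, octahedronState_points.2,
    cubeState_points.1, cubeState_points.2, tetrahedronState_points.1, tetrahedronState_points.2]
  have hi : Fintype.card (Fin 3 × Bool × Bool) = 12 := by simp
  have hd : Fintype.card ((Bool × Bool × Bool) ⊕ (Fin 3 × Bool × Bool)) = 20 := by simp
  have ho : Fintype.card (Fin 3 × Bool) = 6 := by simp
  have hcu : Fintype.card (Bool × Bool × Bool) = 8 := by simp
  have ht : Fintype.card (Bool × Bool) = 4 := by simp
  have ni := (ncard_range_smul icosaVec_injective inv_sqrt_golden_pos icosaFrame).trans hi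
  have nd := (ncard_range_smul dodecaVec_injective inv_sqrt_three_pos icosaFrame).trans hd
  have no := (ncard_range_smul octaVec_injective one_pos octaFrame).trans ho
  have nc := (ncard_range_smul cubeVec_injective inv_sqrt_three_pos octaFrame).trans hcu
  have nt := (ncard_range_smul tetraVec_injective inv_sqrt_three_pos tetraFrame).trans ht
  have di := dualVertices_range_eq inv_sqrt_golden_pos icosaVec_injective norm_smul_icosaVec
    norm_smul_dodecaVec icosaFrame exposesFace_icosaVec_iff
  have dd := dualVertices_range_eq inv_sqrt_three_pos dodecaVec_injective norm_smul_dodecaVec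
    norm_smul_icosaVec icosaFrame exposesFace_dodecaVec_iff
  have do' := dualVertices_range_eq one_pos octaVec_injective norm_smul_octaVec
    norm_smul_cubeVec octaFrame exposesFace_octaVec_iff
  have dc := dualVertices_range_eq inv_sqrt_three_pos cubeVec_injective norm_smul_cubeVec
    norm_smul_octaVec octaFrame exposesFace_cubeVec_iff
  exact ⟨⟨ni, isIcosahedron_range, nd, isDodecahedron_range, di.symm⟩,
    ⟨nd, isDodecahedron_range, ni, isIcosahedron_range, dd.symm⟩, ⟨rfl, rfl⟩,
    ⟨no, isOctahedron_range, nc, isCube_range, do'.symm⟩,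
    ⟨nc, isCube_range, no, isOctahedron_range, dc.symm⟩, ⟨rfl, rfl⟩,
    ⟨nt, isTetrahedron_range, rfl, dualVertices_tetra⟩⟩
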